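/- Let $\mathcal M$ be a matroid with finite ground set $X$, let $G=(X\,\dot\cup\, W,E)$ be a finite bipartite graph whose second side $W$ consists of resources, and let every resource $w\in W$ have a size $p_w\ge 0$. The base polytope $P_{\mathcal B(\mathcal M)}$ is the convex hull of the characteristic vectors $\chi(S)\in\{0,1\}^X$ of the bases $S$ of $\mathcal M$. For $T\in\mathbb R$ let $Q(T)$ be the set of all $(x,y)\in\mathbb R_{\ge 0}^X\times\mathbb R_{\ge 0}^E$ with \[ x\in P_{\mathcal B(\mathcal M)};\qquad \sum_{w:(i,w)\in E}p_w\,y_{iw}\ \ge\ T\,x_i\ \ \forall i\in X;\qquad \sum_{i:(i,w)\in E}y_{iw}\le 1\ \ \forall w\in W;\qquad y_{iw}\le x_i\ \ \forall (i,w)\in E . \] Put $n:=|X|+|W|$. Theorem. There is an algorithm that, given $\varepsilon>0$, the graph $G$, the sizes $p$, a number $T\ge 0$ with $Q(T)\ne\emptyset$, and access to $\mathcal M$ through a membership test for its independent sets, computes \[ (x,y)\in Q\Big(\big(\tfrac13-\varepsilon\big)\,T-\tfrac13\max_{w\in W}p_w\Big)\qquad\text{with } x \text{ and } y \text{ integral.}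 \] Equivalently, it computes a basis $S$ of $\mathcal M$, with $x=\chi(S)$, and an assignment, along edges of $G$, of some of the resources to elements of $S$, each resource to at most one element, such that every element of $S$ receives resources of total size at least $(\frac13-\varepsilon)T-\frac13\max_{w}p_w$. If a membership test takes time polynomial in $n$, then for every fixed $\varepsilon>0$ the total running time is $n^{O_\varepsilon(1)}$. Here time is the number of elementary steps of a real RAM (exact arithmetic on real numbers at unit cost, without rounding), each membership test being charged its own time; the exponent depends only on $\varepsilon$ and on the polynomial that bounds the time of a membership test. (For $W=\emptyset$ the maximum is read as $0$; for $n\le 1$ the bound is read as $O_\varepsilon(1)$.) -/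

import Mathlib

/-! ### The linear programming relaxation -/

/-- The base polytope of a matroid: the convex hull of the characteristic vectors of its bases. -/
def basePolytope {X : Type*} (M : Matroid X) : Set (X → ℝ) :=
  convexHull ℝ {x | ∃ S : Set X, M.IsBase S ∧ x = S.indicator (fun _ => (1 : ℝ))}

/-- The relaxation `Q(T)`, for a matroid `M` on `X`, a bipartite graph on `X` and `W` with edge set
`E`, sizes `p` and a target value `T`. A vector `y` indexed by the edges is written as a matrix
that vanishes outside `E`. -/
def lpRelaxation {X W : Type*} [Fintype X] [Fintype W] [DecidableEq X] [DecidableEq W]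
    (M : Matroid X) (E : Finset (X × W)) (p : W → ℝ) (T : ℝ) : Set ((X → ℝ) × (X → W → ℝ)) :=
  {z | (∀ i, 0 ≤ z.1 i) ∧ (∀ i w, 0 ≤ z.2 i w) ∧ (∀ i w, (i, w) ∉ E → z.2 i w = 0) ∧
    z.1 ∈ basePolytope M ∧
    (∀ i, T * z.1 i ≤ ∑ w with (i, w) ∈ E, p w * z.2 i w) ∧
    (∀ w, ∑ i with (i, w) ∈ E, z.2 i w ≤ 1) ∧
    (∀ i w, (i, w) ∈ E → z.2 i w ≤ z.1 i)}

/-- A basis `S` and an assignment of (some of) the resources along edges to elements of `S`, such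
that every element of `S` receives total size at least `v`. -/
def IsAllocation {X W : Type*} [Fintype W] [DecidableEq X]
    (M : Matroid X) (E : Finset (X × W)) (p : W → ℝ) (v : ℝ)
    (S : Set X) (σ : W → Option X) : Prop :=
  M.IsBase S ∧ (∀ w i, σ w = some i → i ∈ S ∧ (i, w) ∈ E) ∧
    ∀ i ∈ S, v ≤ ∑ w with σ w = some i, p w

/-! ### A real RAM with an oracle

Memory consists of two-dimensional arrays, named by natural numbers, whose cells hold natural
numbers (used for counting and addressing) or real numbers. Natural numbers can be added and
subtracted, real numbers can be added, subtracted, multiplied and divided, both can be compared;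
there is no rounding. Each elementary operation costs one unit; a query to the oracle has its own
price. -/

namespace RealRAM

/-- Memory contents: `nat a i j` and `real a i j` are the cells `(i, j)` of the arrays `a`. -/
structure State where
  nat : ℕ → ℕ → ℕ → ℕ
  real : ℕ → ℕ → ℕ → ℝ

/-- Write the number `v` into a cell of type `ℕ`. -/
def State.setNat (s : State) (a i j v : ℕ) : State :=
  { s with nat := fun a' i' j' => if a' = a ∧ i' = i ∧ j' = j then v else s.nat a' i' j' }

/-- Write the number `v` into a cell of type `ℝ`. -/
noncomputable def State.setReal (s : State) (a i j : ℕ) (v : ℝ) : State :=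
  { s with real := fun a' i' j' => if a' = a ∧ i' = i ∧ j' = j then v else s.real a' i' j' }

/-- Expressions of type `ℕ`. -/
inductive NatExpr where
  | lit (c : ℕ)
  | read (a : ℕ) (i j : NatExpr)
  | add (e f : NatExpr)
  | sub (e f : NatExpr)

/-- The value of an expression (subtraction is truncated). -/
def NatExpr.eval (s : State) : NatExpr → ℕ
  | lit c => c
  | read a i j => s.nat a (i.eval s) (j.eval s)
  | add e f => e.eval s + f.eval s
  | sub e f => e.eval s - f.eval s

/-- The number of elementary operations in the evaluation of an expression. -/
def NatExpr.cost : NatExpr → ℕ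
  | lit _ => 1
  | read _ i j => i.cost + j.cost + 1
  | add e f => e.cost + f.cost + 1
  | sub e f => e.cost + f.cost + 1

/-- Expressions of type `ℝ`; the only literals are rational numbers. -/
inductive RealExpr where
  | lit (c : ℚ)
  | read (a : ℕ) (i j : NatExpr)
  | ofNat (e : NatExpr)
  | add (e f : RealExpr)
  | sub (e f : RealExpr)
  | mul (e f : RealExpr)
  | div (e f : RealExpr)

/-- The value of an expression. -/
noncomputable def RealExpr.eval (s : State) : RealExpr → ℝ
  | lit c => (c : ℝ)
  | read a i j => s.real a (i.eval s) (j.eval s)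
  | ofNat e => (e.eval s : ℝ)
  | add e f => e.eval s + f.eval s
  | sub e f => e.eval s - f.eval s
  | mul e f => e.eval s * f.eval s
  | div e f => e.eval s / f.eval s

/-- The number of elementary operations in the evaluation of an expression. -/
def RealExpr.cost : RealExpr → ℕ
  | lit _ => 1
  | read _ i j => i.cost + j.cost + 1
  | ofNat e => e.cost + 1
  | add e f => e.cost + f.cost + 1
  | sub e f => e.cost + f.cost + 1
  | mul e f => e.cost + f.cost + 1
  | div e f => e.cost + f.cost + 1

/-- Conditions. -/
inductive Test where
  | natLe (e f : NatExpr)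
  | realLe (e f : RealExpr)
  | not (b : Test)
  | and (b c : Test)

/-- The truth value of a condition. -/
def Test.Holds (s : State) : Test → Prop
  | natLe e f => e.eval s ≤ f.eval s
  | realLe e f => e.eval s ≤ f.eval s
  | not b => ¬ b.Holds s
  | and b c => b.Holds s ∧ c.Holds s

/-- The number of elementary operations in the evaluation of a condition. -/
def Test.cost : Test → ℕ
  | natLe e f => e.cost + f.cost + 1
  | realLe e f => e.cost + f.cost + 1
  | not b => b.cost + 1
  | and b c => b.cost + c.cost + 1

/-- Programs. -/
inductive Program where
  | skip
  | setNat (a : ℕ) (i j e : NatExpr)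
  | setReal (a : ℕ) (i j : NatExpr) (e : RealExpr)
  /-- Ask the oracle about the set of all `v` for which the cell `(r, v)` of the array `b` of
  natural numbers is nonzero, and write the answer (`1` for yes, `0` for no) into the cell
  `(i, j)` of the array `a` of natural numbers. -/
  | query (a : ℕ) (i j : NatExpr) (b : ℕ) (r : NatExpr)
  | seq (P Q : Program)
  | ite (b : Test) (P Q : Program)
  | while (b : Test) (P : Program)

open Classical in
/-- `Exec O q P s t s'`: with the oracle `O`, and at the price `q` for a query, the program `P`
started in the state `s` halts after `t` steps in the state `s'`. -/
inductive Exec (O : Set ℕ → Prop) (q : ℕ) : Program → State → ℕ → State → Prop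
  | skip (s : State) : Exec O q .skip s 1 s
  | setNat (a : ℕ) (i j e : NatExpr) (s : State) :
      Exec O q (.setNat a i j e) s (i.cost + j.cost + e.cost + 1)
        (s.setNat a (i.eval s) (j.eval s) (e.eval s))
  | setReal (a : ℕ) (i j : NatExpr) (e : RealExpr) (s : State) :
      Exec O q (.setReal a i j e) s (i.cost + j.cost + e.cost + 1)
        (s.setReal a (i.eval s) (j.eval s) (e.eval s))
  | query (a : ℕ) (i j : NatExpr) (b : ℕ) (r : NatExpr) (s : State) :
      Exec O q (.query a i j b r) s (i.cost + j.cost + r.cost + 1 + q)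
        (s.setNat a (i.eval s) (j.eval s) (if O {v | s.nat b (r.eval s) v ≠ 0} then 1 else 0))
  | seq {P Q : Program} {s₁ s₂ s₃ : State} {t u : ℕ} :
      Exec O q P s₁ t s₂ → Exec O q Q s₂ u s₃ → Exec O q (.seq P Q) s₁ (t + u) s₃
  | iteTrue {b : Test} {P Q : Program} {s₁ s₂ : State} {t : ℕ} :
      b.Holds s₁ → Exec O q P s₁ t s₂ → Exec O q (.ite b P Q) s₁ (b.cost + t + 1) s₂
  | iteFalse {b : Test} {P Q : Program} {s₁ s₂ : State} {t : ℕ} :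
      ¬ b.Holds s₁ → Exec O q Q s₁ t s₂ → Exec O q (.ite b P Q) s₁ (b.cost + t + 1) s₂
  | whileTrue {b : Test} {P : Program} {s₁ s₂ s₃ : State} {t u : ℕ} :
      b.Holds s₁ → Exec O q P s₁ t s₂ → Exec O q (.while b P) s₂ u s₃ →
        Exec O q (.while b P) s₁ (b.cost + t + u + 1) s₃
  | whileFalse {b : Test} {P : Program} {s : State} :
      ¬ b.Holds s → Exec O q (.while b P) s (b.cost + 1) s

end RealRAM

/-! ### Input, oracle and output for the allocation problem on `Fin m` and `Fin k` -/

/-- The independence oracle of a matroid on `Fin m`. -/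
def indepOracle {m : ℕ} (M : Matroid (Fin m)) (A : Set ℕ) : Prop :=
  M.Indep {i : Fin m | (i : ℕ) ∈ A}

open Classical in
/-- The memory at the start: the array `0` of natural numbers holds `m` and `k`, the array `1` of
natural numbers the adjacency matrix of the graph, the array `0` of real numbers `T` and `ε`, the
array `1` of real numbers the sizes; every other cell is zero. The matroid is not part of it. -/
noncomputable def inputState {m k : ℕ} (E : Finset (Fin m × Fin k)) (p : Fin k → ℝ) (T ε : ℝ) :
    RealRAM.State where
  nat a i j := match a, i, j with
    | 0, 0, 0 => m
    | 0, 0, 1 => k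
    | 1, i, j => if ∃ e ∈ E, (e.1 : ℕ) = i ∧ (e.2 : ℕ) = j then 1 else 0
    | _, _, _ => 0
  real a i j := match a, i, j with
    | 0, 0, 0 => T
    | 0, 0, 1 => ε
    | 1, 0, j => if h : j < k then p ⟨j, h⟩ else 0
    | _, _, _ => 0

/-- The vector `x` that a halted program has left in the array `2` of real numbers. -/
def outputX (m : ℕ) (s : RealRAM.State) (i : Fin m) : ℝ := s.real 2 0 i

/-- The vector `y` that a halted program has left in the array `3` of real numbers. -/
def outputY (m k : ℕ) (s : RealRAM.State) (i : Fin m) (w : Fin k) : ℝ := s.real 3 i w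

/-! ### Programs with bounded loops

A fragment of the programming language with a total denotational semantics and a running time that
can be read off from the text. -/

namespace RealRAM

/-! The proof is a local search with an alternating tree, in the tradition of Haxell's theorem on
hypergraph matchings. An independent set `C` is maintained whose elements hold disjoint collections
of resources, each of value at least `v` and of size at most `v + pm`. Here `v` is the promised
value for `e = min ε (1/3)`, cut off at zero, so that `T = 3 v + pm + 3 e T` whenever `v > 0`. While
`C` is not a basis, a tree of layers is grown. The nodes of a layer are elements that are
independent together with the chosen elements outside the lower layers (`rest`), and each node has a
hyperedge of unused resources of value `(1 + e) v`. The owners of these resources are the blocking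
elements of the layer. If many nodes of one layer, independent over `rest`, have unowned resources
of value `v`, they join `C`, and blocking elements of the lower layers are retained as far as
independence permits. Either `C` becomes larger, or some lower layer loses a fixed fraction of its
blocking elements and the tree is cut back to the first such layer.

The linear program makes new layers large. Suppose that a layer with `d` nodes is put above `B`
blocking elements. The rank inequality of the base polytope gives mass at least `1 + B - d` to the
elements outside the span of `rest` and the nodes. Such an element sees less than `(1 + e) v` in
available resources, so it draws at least `T - (1 + e) v` per unit of mass from used ones. The used
ones amount to at most `v + pm` per blocking element, and to less than `v` for the unowned part of
every hyperedge that is not addable; of these there are at most `1 + e` per blocking element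
(`card_blocked_le`). If `d` were negligible, then `T` would be at most `3 v + pm` up to an error
smaller than `3 e T`, which is absurd. Hence `d` is at least a fixed fraction of `1 + B`
(`sum_used_le`, `sum_used_le_parts`, `width_estimate`, `wide_of_calm`). As few nodes are addable
when no collapse is possible, the layers grow geometrically (`large_of_calm`), and their number is
logarithmic.

The matroid enters once more when a collapse changes `C`: the nodes of the surviving layers must
remain independent over the new `rest`. Elements are retained beginning with the highest layer, so
that a rejected element is spanned by what remains above it and in its own layer. The old `rest` is
then spanned by the new one, and `Matroid.exists_extension_of_subset_closure` carries independence
over, with a loss that the recorded sizes `b0` account for (`Spread`, `Exchange.collapse_inv`).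

Termination is measured by a real potential, the sum of `rate ^ (-j) / weight j` over the layers,
plus a large multiple of the cardinality of `C`. A new layer adds a term. A collapse raises the term
of the layer to which the tree is cut back, and this outweighs all discarded terms, since `rate` is
a large constant. As the depth is logarithmic, each change is at least the inverse of a polynomial
(`Inv.gain_le`), so polynomially many iterations suffice.

Apart from one outer `while`, the program has only loops with limits known from the input. For such
programs the result is a function (`Bounded.run`), the running time is polynomial by structure
(`exists_cost_le`), and correctness is a matter of loop invariants. The outer loop is bounded by the
potential (`exec_while`). -/

theorem State.nat_setNat (s : State) (a i j v a' i' j' : ℕ) :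
    (s.setNat a i j v).nat a' i' j' =
      if a' = a ∧ i' = i ∧ j' = j then v else s.nat a' i' j' := rfl

theorem State.real_setNat (s : State) (a i j v : ℕ) : (s.setNat a i j v).real = s.real := rfl

theorem State.nat_setReal (s : State) (a i j : ℕ) (v : ℝ) :
    (s.setReal a i j v).nat = s.nat := rfl

theorem State.real_setReal (s : State) (a i j : ℕ) (v : ℝ) (a' i' j' : ℕ) :
    (s.setReal a i j v).real a' i' j' =
      if a' = a ∧ i' = i ∧ j' = j then v else s.real a' i' j' := rfl

theorem State.nat_setNat_ne (s : State) {a a' : ℕ} (h : a' ≠ a) (i j v : ℕ) :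
    (s.setNat a i j v).nat a' = s.nat a' := by
  funext i' j'; simp [State.nat_setNat, h]

theorem State.real_setReal_ne (s : State) {a a' : ℕ} (h : a' ≠ a) (i j : ℕ) (v : ℝ) :
    (s.setReal a i j v).real a' = s.real a' := by
  funext i' j'; simp [State.real_setReal, h]

/-- The admissible numbers of iterations of a bounded loop. -/
inductive Limit where
  | elements
  | resources
  | layers

/-- The number of iterations as an expression. -/
def Limit.expr : Limit → NatExpr
  | elements => .read 0 (.lit 0) (.lit 0)
  | resources => .read 0 (.lit 0) (.lit 1)
  | layers => .add (.read 0 (.lit 0) (.lit 0)) (.lit 2)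

/-- Programs whose only loops are bounded; the loop counter is the cell `(0, 0)` of its array. -/
inductive Bounded where
  | skip
  | setNat (a : ℕ) (i j e : NatExpr)
  | setReal (a : ℕ) (i j : NatExpr) (e : RealExpr)
  | query (a : ℕ) (i j : NatExpr) (b : ℕ) (r : NatExpr)
  | seq (P Q : Bounded)
  | ite (b : Test) (P Q : Bounded)
  | loop (c : ℕ) (l : Limit) (P : Bounded)

namespace Bounded

/-- The translation into the programming language. -/
def compile : Bounded → Program
  | skip => .skip
  | setNat a i j e => .setNat a i j e
  | setReal a i j e => .setReal a i j e
  | query a i j b r => .query a i j b r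
  | seq P Q => .seq P.compile Q.compile
  | ite b P Q => .ite b P.compile Q.compile
  | loop c l P =>
      .seq (.setNat c (.lit 0) (.lit 1) l.expr)
        (.seq (.setNat c (.lit 0) (.lit 0) (.lit 0))
          (.while (.natLe (.add (.read c (.lit 0) (.lit 0)) (.lit 1)) (.read c (.lit 0) (.lit 1)))
            (.seq P.compile
              (.setNat c (.lit 0) (.lit 0) (.add (.read c (.lit 0) (.lit 0)) (.lit 1))))))

/-- The state after `n` iterations of `f` that count in the array `c`. -/
def iterate (f : State → State) (c : ℕ) (s : State) : ℕ → State
  | 0 => s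
  | n + 1 => (f (iterate f c s n)).setNat c 0 0 (n + 1)

/-- The state in which the first iteration of a loop starts. -/
def loopInit (c : ℕ) (l : Limit) (s : State) : State :=
  (s.setNat c 0 1 (l.expr.eval s)).setNat c 0 0 0

open Classical in
/-- The state in which a program halts. -/
noncomputable def run (O : Set ℕ → Prop) : Bounded → State → State
  | skip, s => s
  | setNat a i j e, s => s.setNat a (i.eval s) (j.eval s) (e.eval s)
  | setReal a i j e, s => s.setReal a (i.eval s) (j.eval s) (e.eval s)
  | query a i j b r, s =>
      s.setNat a (i.eval s) (j.eval s) (if O {v | s.nat b (r.eval s) v ≠ 0} then 1 else 0)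
  | seq P Q, s => Q.run O (P.run O s)
  | ite b P Q, s => if b.Holds s then P.run O s else Q.run O s
  | loop c l P, s => iterate (P.run O) c (loopInit c l s) (l.expr.eval s)

/-- The arrays of natural numbers that a program may change. -/
def natWrites : Bounded → List ℕ
  | skip => []
  | setNat a _ _ _ => [a]
  | setReal _ _ _ _ => []
  | query a _ _ _ _ => [a]
  | seq P Q => P.natWrites ++ Q.natWrites
  | ite _ P Q => P.natWrites ++ Q.natWrites
  | loop c _ P => c :: P.natWrites

/-- The arrays of real numbers that a program may change. -/
def realWrites : Bounded → List ℕ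
  | skip => []
  | setNat _ _ _ _ => []
  | setReal a _ _ _ => [a]
  | query _ _ _ _ _ => []
  | seq P Q => P.realWrites ++ Q.realWrites
  | ite _ P Q => P.realWrites ++ Q.realWrites
  | loop _ _ P => P.realWrites

/-- No loop body changes its own counter or the dimensions of the input. -/
def Wellformed : Bounded → Prop
  | seq P Q => P.Wellformed ∧ Q.Wellformed
  | ite _ P Q => P.Wellformed ∧ Q.Wellformed
  | loop c _ P => P.Wellformed ∧ c ∉ P.natWrites ∧ 0 ∉ P.natWrites ∧ c ≠ 0
  | _ => True

/-- A bound for the number of steps if all loops have at most `B` iterations and a query costs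
`q`. -/
def cost (B q : ℕ) : Bounded → ℕ
  | skip => 1
  | setNat _ i j e => i.cost + j.cost + e.cost + 1
  | setReal _ i j e => i.cost + j.cost + e.cost + 1
  | query _ i j _ r => i.cost + j.cost + r.cost + 1 + q
  | seq P Q => P.cost B q + Q.cost B q
  | ite b P Q => b.cost + (P.cost B q + Q.cost B q) + 1
  | loop _ _ P => 22 + B * (P.cost B q + 18)

variable {O : Set ℕ → Prop}

theorem iterate_nat {f : State → State} {a : ℕ} (hf : ∀ s, (f s).nat a = s.nat a) {c : ℕ}
    (hc : a ≠ c) (s : State) (n : ℕ) : (iterate f c s n).nat a = s.nat a := by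
  induction n with
  | zero => rfl
  | succ n ih => rw [iterate, State.nat_setNat_ne _ hc, hf, ih]

theorem iterate_real {f : State → State} {a : ℕ} (hf : ∀ s, (f s).real a = s.real a) {c : ℕ}
    (s : State) (n : ℕ) : (iterate f c s n).real a = s.real a := by
  induction n with
  | zero => rfl
  | succ n ih => rw [iterate, State.real_setNat, hf, ih]

theorem run_nat (P : Bounded) {a : ℕ} (h : a ∉ P.natWrites) (s : State) :
    (P.run O s).nat a = s.nat a := by
  induction P generalizing s with
  | skip => rfl
  | setNat b i j e => exact State.nat_setNat_ne _ (by simpa [natWrites] using h) ..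
  | setReal b i j e => rfl
  | query b i j e r => exact State.nat_setNat_ne _ (by simpa [natWrites] using h) ..
  | seq P Q ihP ihQ =>
    simp only [natWrites, List.mem_append, not_or] at h
    rw [run, ihQ h.2, ihP h.1]
  | ite b P Q ihP ihQ =>
    simp only [natWrites, List.mem_append, not_or] at h
    rw [run]
    split_ifs
    · exact ihP h.1 s
    · exact ihQ h.2 s
  | loop c l P ih =>
    simp only [natWrites, List.mem_cons, not_or] at h
    rw [run, iterate_nat (ih h.2) h.1, loopInit, State.nat_setNat_ne _ h.1,
      State.nat_setNat_ne _ h.1]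

theorem run_real (P : Bounded) {a : ℕ} (h : a ∉ P.realWrites) (s : State) :
    (P.run O s).real a = s.real a := by
  induction P generalizing s with
  | skip => rfl
  | setNat b i j e => rfl
  | setReal b i j e => exact State.real_setReal_ne _ (by simpa [realWrites] using h) ..
  | query b i j e r => rfl
  | seq P Q ihP ihQ =>
    simp only [realWrites, List.mem_append, not_or] at h
    rw [run, ihQ h.2, ihP h.1]
  | ite b P Q ihP ihQ =>
    simp only [realWrites, List.mem_append, not_or] at h
    rw [run]
    split_ifs
    · exact ihP h.1 s
    · exact ihQ h.2 s
  | loop c l P ih =>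
    rw [run, iterate_real (ih h)]
    rfl

theorem loopInit_nat (c : ℕ) (l : Limit) (s : State) {a : ℕ} (h : a ≠ c) :
    (loopInit c l s).nat a = s.nat a := by
  rw [loopInit, State.nat_setNat_ne _ h, State.nat_setNat_ne _ h]

theorem loopInit_real (c : ℕ) (l : Limit) (s : State) : (loopInit c l s).real = s.real := rfl

/-- Induction along the iterations of a loop. -/
theorem run_loop_induction {c : ℕ} {l : Limit} {P : Bounded} {s : State}
    (I : ℕ → State → Prop) (h0 : I 0 (loopInit c l s))
    (hI : ∀ n < l.expr.eval s, ∀ u, u.nat c 0 0 = n →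
      (∀ a ∉ c :: P.natWrites, u.nat a = s.nat a) → (∀ a ∉ P.realWrites, u.real a = s.real a) →
      I n u → I (n + 1) ((P.run O u).setNat c 0 0 (n + 1))) :
    I (l.expr.eval s) ((loop c l P).run O s) := by
  have key : ∀ n ≤ l.expr.eval s, (iterate (P.run O) c (loopInit c l s) n).nat c 0 0 = n ∧
      I n (iterate (P.run O) c (loopInit c l s) n) := by
    intro n
    induction n with
    | zero => exact fun _ => ⟨by simp [iterate, loopInit, State.nat_setNat], h0⟩
    | succ n ih =>
      intro hn
      obtain ⟨h1, h2⟩ := ih (by omega)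
      refine ⟨by simp [iterate, State.nat_setNat], hI n (by omega) _ h1 ?_ ?_ h2⟩
      · intro a ha
        rw [List.mem_cons, not_or] at ha
        rw [iterate_nat (fun u => run_nat P ha.2 u) ha.1, loopInit_nat c l s ha.1]
      · intro a ha
        rw [iterate_real (fun u => run_real P ha u), loopInit_real]
  exact (key _ le_rfl).2

/-- The bound `B` holds in every intermediate state because array `0`, which holds the dimensions,
is never written. The counter and the copied limit of a loop survive its body by `Wellformed`. -/
theorem exec_compile (q B : ℕ) (P : Bounded) (hP : P.Wellformed) (s : State)
    (hB : ∀ l : Limit, l.expr.eval s ≤ B) (h0 : 0 ∉ P.natWrites) :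
    ∃ t ≤ P.cost B q, Exec O q P.compile s t (P.run O s) := by
  induction P generalizing s with
  | skip => exact ⟨_, le_rfl, .skip s⟩
  | setNat b i j e => exact ⟨_, le_rfl, .setNat ..⟩
  | setReal b i j e => exact ⟨_, le_rfl, .setReal ..⟩
  | query b i j e r => exact ⟨_, le_rfl, .query ..⟩
  | seq P Q ihP ihQ =>
    simp only [natWrites, List.mem_append, not_or] at h0
    obtain ⟨t, ht, hPt⟩ := ihP hP.1 s hB h0.1
    have hB' : ∀ l : Limit, l.expr.eval (P.run O s) ≤ B := by
      intro l
      have := hB l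
      cases l <;> simpa [Limit.expr, NatExpr.eval, run_nat P h0.1] using this
    obtain ⟨u, hu, hQu⟩ := ihQ hP.2 _ hB' h0.2
    exact ⟨t + u, Nat.add_le_add ht hu, .seq hPt hQu⟩
  | ite b P Q ihP ihQ =>
    simp only [natWrites, List.mem_append, not_or] at h0
    by_cases hb : b.Holds s
    · obtain ⟨t, ht, hPt⟩ := ihP hP.1 s hB h0.1
      refine ⟨b.cost + t + 1, by simp only [cost]; omega, ?_⟩
      rw [run, if_pos hb]
      exact .iteTrue hb hPt
    · obtain ⟨t, ht, hPt⟩ := ihQ hP.2 s hB h0.2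
      refine ⟨b.cost + t + 1, by simp only [cost]; omega, ?_⟩
      rw [run, if_neg hb]
      exact .iteFalse hb hPt
  | loop c l P ih =>
    obtain ⟨hP, hc, hz, hc0⟩ := hP
    set N := l.expr.eval s with hN
    set g := iterate (P.run O) c (loopInit c l s) with hg
    have g1 : ∀ n, (g n).nat c 0 0 = n := by
      intro n
      cases n with
      | zero => simp [hg, iterate, loopInit, State.nat_setNat]
      | succ n => simp [hg, iterate, State.nat_setNat]
    have g2 : ∀ n, (g n).nat c 0 1 = N := by
      intro n
      induction n with
      | zero => simp [hg, iterate, loopInit, State.nat_setNat, hN]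
      | succ n ihn =>
        change ((P.run O (g n)).setNat c 0 0 (n + 1)).nat c 0 1 = N
        rw [State.nat_setNat, if_neg (by simp), run_nat P hc, ihn]
    have g3 : ∀ n (l' : Limit), l'.expr.eval (g n) ≤ B := by
      intro n l'
      have h1 : (g n).nat 0 = s.nat 0 := by
        rw [hg, iterate_nat (fun u => run_nat P hz u) hc0.symm, loopInit_nat c l s hc0.symm]
      have := hB l'
      cases l' <;> simpa [Limit.expr, NatExpr.eval, h1] using this
    -- Induction on the number `d` of remaining iterations; the summand `10` pays for the final test
    -- that fails.
    have key : ∀ d n, n + d = N → ∃ t ≤ d * (P.cost B q + 18) + 10,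
        Exec O q (.while (.natLe (.add (.read c (.lit 0) (.lit 0)) (.lit 1))
            (.read c (.lit 0) (.lit 1)))
            (.seq P.compile
              (.setNat c (.lit 0) (.lit 0) (.add (.read c (.lit 0) (.lit 0)) (.lit 1)))))
          (g n) t (g N) := by
      intro d
      induction d with
      | zero =>
        intro n hn
        obtain rfl : n = N := by omega
        refine ⟨_, ?_, .whileFalse ?_⟩
        · simp [Test.cost, NatExpr.cost]
        · simp [Test.Holds, NatExpr.eval, g1, g2]
      | succ d ihd =>
        intro n hn
        obtain ⟨t, ht, hPt⟩ := ih hP (g n) (g3 n) hz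
        obtain ⟨u, hu, hQu⟩ := ihd (n + 1) (by omega)
        have hset : Exec O q (.setNat c (.lit 0) (.lit 0)
            (.add (.read c (.lit 0) (.lit 0)) (.lit 1))) (P.run O (g n)) 8 (g (n + 1)) := by
          have := Exec.setNat (O := O) (q := q) c (.lit 0) (.lit 0)
            (.add (.read c (.lit 0) (.lit 0)) (.lit 1)) (P.run O (g n))
          change Exec O q _ _ 8 ((P.run O (g n)).setNat c 0 0 (n + 1))
          simpa only [NatExpr.cost, NatExpr.eval, run_nat P hc, g1] using this
        refine ⟨_, ?_, .whileTrue ?_ (.seq hPt hset) hQu⟩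
        · simp only [Test.cost, NatExpr.cost]
          have : (d + 1) * (P.cost B q + 18) = d * (P.cost B q + 18) + (P.cost B q + 18) := by ring
          omega
        · simp only [Test.Holds, NatExpr.eval, g1, g2]
          omega
    obtain ⟨t, ht, hex⟩ := key N 0 (by omega)
    refine ⟨_, ?_, .seq (.setNat ..) (.seq (.setNat ..) hex)⟩
    have h1 : N * (P.cost B q + 18) ≤ B * (P.cost B q + 18) :=
      Nat.mul_le_mul_right _ (hB l)
    have h2 : l.expr.cost ≤ 5 := by cases l <;> simp [Limit.expr, NatExpr.cost]
    simp only [NatExpr.cost, cost]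
    omega

/-- The running time of a bounded program is bounded by a polynomial. -/
theorem exists_cost_le (P : Bounded) :
    ∃ a b : ℕ, ∀ B q, P.cost B q ≤ a * (B + q + 1) ^ b := by
  have mono : ∀ {x b b' : ℕ}, b ≤ b' → (x + 1) ^ b ≤ (x + 1) ^ b' := fun h =>
    Nat.pow_le_pow_right (Nat.succ_pos _) h
  have one : ∀ {x b : ℕ}, 1 ≤ (x + 1) ^ b := Nat.one_le_pow _ _ (Nat.succ_pos _)
  induction P with
  | skip => exact ⟨1, 0, fun B q => by simp [cost]⟩
  | setNat b i j e => exact ⟨_, 0, fun B q => by rw [cost, pow_zero, mul_one]⟩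
  | setReal b i j e => exact ⟨_, 0, fun B q => by rw [cost, pow_zero, mul_one]⟩
  | query b i j e r =>
    refine ⟨i.cost + j.cost + r.cost + 1, 1, fun B q => ?_⟩
    rw [cost, pow_one]
    nlinarith [Nat.zero_le B, Nat.zero_le q, Nat.zero_le (i.cost + j.cost + r.cost),
      Nat.zero_le ((i.cost + j.cost + r.cost) * (B + q))]
  | seq P Q ihP ihQ =>
    obtain ⟨a, b, h⟩ := ihP
    obtain ⟨a', b', h'⟩ := ihQ
    refine ⟨a + a', max b b', fun B q => ?_⟩
    rw [cost, add_mul]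
    exact Nat.add_le_add
      ((h B q).trans (Nat.mul_le_mul_left _ (mono (le_max_left ..))))
      ((h' B q).trans (Nat.mul_le_mul_left _ (mono (le_max_right ..))))
  | ite c P Q ihP ihQ =>
    obtain ⟨a, b, h⟩ := ihP
    obtain ⟨a', b', h'⟩ := ihQ
    refine ⟨c.cost + 1 + (a + a'), max b b', fun B q => ?_⟩
    have h1 := (h B q).trans (Nat.mul_le_mul_left a (mono (le_max_left b b')))
    have h2 := (h' B q).trans (Nat.mul_le_mul_left a' (mono (le_max_right b b')))
    have h3 : c.cost + 1 ≤ (c.cost + 1) * (B + q + 1) ^ max b b' := Nat.le_mul_of_pos_right _ one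
    rw [cost, add_mul, add_mul a]
    omega
  | loop c l P ih =>
    obtain ⟨a, b, h⟩ := ih
    refine ⟨40 + a, b + 1, fun B q => ?_⟩
    have h1 : B * (P.cost B q + 18) ≤ (B + q + 1) * ((a + 18) * (B + q + 1) ^ b) := by
      refine Nat.mul_le_mul (by omega) ?_
      rw [add_mul]
      exact Nat.add_le_add (h B q) (Nat.le_mul_of_pos_right _ one)
    have h2 : 22 ≤ 22 * (B + q + 1) ^ (b + 1) := Nat.le_mul_of_pos_right _ one
    rw [cost]
    calc 22 + B * (P.cost B q + 18)
        ≤ 22 * (B + q + 1) ^ (b + 1) + (B + q + 1) * ((a + 18) * (B + q + 1) ^ b) :=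
          Nat.add_le_add h2 h1
      _ = (40 + a) * (B + q + 1) ^ (b + 1) := by ring

end Bounded

/-- A loop terminates if every iteration increases a bounded quantity by a fixed amount. -/
theorem exec_while {O : Set ℕ → Prop} {q : ℕ} {b : Test} {P : Program} (I : State → Prop)
    (Φ : State → ℝ) {η U : ℝ} (t₀ : ℕ) (hU : ∀ s, I s → Φ s ≤ U)
    (hP : ∀ s, I s → b.Holds s → ∃ t ≤ t₀, ∃ s', Exec O q P s t s' ∧ I s' ∧ Φ s + η ≤ Φ s')
    (n : ℕ) (s : State) (hs : I s) (hn : U < Φ s + n * η) :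
    ∃ t ≤ n * (t₀ + b.cost + 1), ∃ s', Exec O q (.while b P) s t s' ∧ I s' ∧ ¬ b.Holds s' := by
  induction n generalizing s with
  -- With no iterations left, the measure would already exceed its bound.
  | zero => have := hU s hs; simp at hn; linarith
  | succ n ih =>
    by_cases hb : b.Holds s
    · obtain ⟨t, ht, s', hex, hI, hΦ⟩ := hP s hs hb
      obtain ⟨u, hu, s'', hex', hI', hb'⟩ := ih s' hI (by push_cast at hn; linarith)
      refine ⟨_, ?_, s'', .whileTrue hb hex hex', hI', hb'⟩
      have : (n + 1) * (t₀ + b.cost + 1) = n * (t₀ + b.cost + 1) + (t₀ + b.cost + 1) := by ring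
      omega
    · refine ⟨b.cost + 1, ?_, s, .whileFalse hb, hs, hb⟩
      have : (n + 1) * (t₀ + b.cost + 1) = n * (t₀ + b.cost + 1) + (t₀ + b.cost + 1) := by ring
      omega

end RealRAM

/-! ### Independent sets of a matroid on the natural numbers -/

namespace Matroid

variable {M : Matroid ℕ}

theorem Indep.card_le_of_subset_closure {I J : Finset ℕ} (hJ : M.Indep ↑J)
    (h : (J : Set ℕ) ⊆ M.closure ↑I) : J.card ≤ I.card := by
  have h1 : (J : Set ℕ).encard ≤ M.eRk (M.closure ↑I) := hJ.encard_le_eRk_of_subset h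
  rw [M.eRk_closure_eq] at h1
  have h2 := h1.trans (M.eRk_le_encard ↑I)
  simpa [Set.encard_coe_eq_coe_finsetCard] using h2

/-- This is what the refusal of an element by a greedy pass means. Being spanned persists while the
set grows, so all greedy loops state their invariants in terms of the closure. -/
theorem mem_closure_of_not_indep_insert {I : Finset ℕ} {x : ℕ} (hI : M.Indep ↑I) (hx : x ∈ M.E)
    (h : ¬ (x ∉ I ∧ M.Indep ↑(insert x I))) : x ∈ M.closure ↑I := by
  by_cases hxI : x ∈ I
  · exact M.subset_closure _ hI.subset_ground (by exact_mod_cast hxI)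
  · rw [hI.mem_closure_iff]
    left
    rw [← Matroid.not_indep_iff (by rw [Set.insert_subset_iff]; exact ⟨hx, hI.subset_ground⟩)]
    intro h'
    exact h ⟨hxI, by rwa [Finset.coe_insert]⟩

/-- A basis of `K' ∪ D` that contains `K'` spans both `K` and `D`, hence it has at least as many
elements as the independent set `K ∪ D`. It is used with the old and the new `rest` as `K` and `K'`,
and with nodes of a layer as `D`. -/
theorem exists_extension_of_subset_closure {K D K' : Finset ℕ} (hKD : Disjoint K D)
    (h : M.Indep ↑(K ∪ D)) (hK' : M.Indep ↑K') (hK : (K : Set ℕ) ⊆ M.closure ↑K') :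
    ∃ D' ⊆ D, Disjoint K' D' ∧ M.Indep ↑(K' ∪ D') ∧
      K.card + D.card ≤ K'.card + D'.card := by
  classical
  have hDE : (D : Set ℕ) ⊆ M.E := fun x hx => h.subset_ground (by simp at hx ⊢; exact Or.inr hx)
  obtain ⟨I, hI, hKI⟩ := hK'.subset_isBasis_of_subset
    (show (K' : Set ℕ) ⊆ ↑(K' ∪ D) by simp)
    (by rw [Finset.coe_union]; exact Set.union_subset hK'.subset_ground hDE)
  have hfin : I.Finite := Set.Finite.subset (Finset.finite_toSet _) hI.subset
  have hIe : I = ↑(K' ∪ D.filter (fun x => x ∈ I ∧ x ∉ K')) := by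
    ext x
    have := fun h => hI.subset (a := x) h
    have h' := @hKI x
    simp only [Finset.coe_union, Finset.mem_coe, Set.mem_union, Finset.coe_filter,
      Set.mem_ofPred_eq] at this h' ⊢
    tauto
  refine ⟨D.filter (fun x => x ∈ I ∧ x ∉ K'), Finset.filter_subset _ _, ?_, ?_, ?_⟩
  · rw [Finset.disjoint_left]
    intro x hx hx'
    exact (Finset.mem_filter.1 hx').2.2 hx
  · rw [← hIe]; exact hI.indep
  · rw [← Finset.card_union_of_disjoint hKD]
    have hdis : Disjoint K' (D.filter (fun x => x ∈ I ∧ x ∉ K')) := by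
      rw [Finset.disjoint_left]
      intro x hx hx'
      exact (Finset.mem_filter.1 hx').2.2 hx
    rw [← Finset.card_union_of_disjoint hdis]
    refine h.card_le_of_subset_closure ?_
    rw [← hIe, hI.closure_eq_closure, Finset.coe_union]
    refine Set.union_subset (hK.trans (M.closure_subset_closure (by simp))) ?_
    intro x hx
    exact M.mem_closure_of_mem' (by simp; exact Or.inr hx) (hDE hx)

end Matroid

/-! ### The state of the local search -/

/-- A matroid on `{0, …, m - 1}`, resources `0, …, k - 1` with their sizes and adjacency, a target
value `T`, an accuracy `e` and an upper bound `pm` for the sizes. -/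
structure Problem where
  m : ℕ
  k : ℕ
  M : Matroid ℕ
  adj : ℕ → ℕ → Prop
  p : ℕ → ℝ
  T : ℝ
  e : ℝ
  pm : ℝ

namespace Problem

variable (A : Problem)

/-- The value that every chosen element is to receive. -/
noncomputable def v : ℝ := max 0 ((1 / 3 - A.e) * A.T - A.pm / 3)

/-- The value of a hyperedge of the alternating tree. -/
noncomputable def ve : ℝ := (1 + A.e) * A.v

/-- The sizes, cut off at `ve`. -/
noncomputable def cap (w : ℕ) : ℝ := min (A.p w) A.ve

/-- The fraction of a layer whose loss makes it a new layer. -/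
noncomputable def mu : ℝ := A.e ^ 4 / 256

/-- The rate of growth of the layers. -/
noncomputable def sigma : ℝ := A.e ^ 3 / 32

/-- The assumptions on the numbers in the input. -/
structure Valid : Prop where
  ground : A.M.E = {i | i < A.m}
  p_nonneg : ∀ w, 0 ≤ A.p w
  p_le : ∀ w < A.k, A.p w ≤ A.pm
  pm_nonneg : 0 ≤ A.pm
  e_pos : 0 < A.e
  e_le : A.e ≤ 1 / 3
  T_nonneg : 0 ≤ A.T

open Classical in
/-- A fractional solution of value `T`. -/
structure Fractional (x : ℕ → ℝ) (y : ℕ → ℕ → ℝ) : Prop where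
  x_nonneg : ∀ i, 0 ≤ x i
  y_nonneg : ∀ i w, 0 ≤ y i w
  y_le : ∀ i w, y i w ≤ x i
  y_adj : ∀ i w, ¬ A.adj i w → y i w = 0
  value : ∀ i < A.m, A.T * x i ≤ ∑ w ∈ Finset.range A.k, A.p w * y i w
  load : ∀ w < A.k, ∑ i ∈ Finset.range A.m, y i w ≤ 1
  rank : ∀ Z I : Finset ℕ, A.M.Indep ↑Z → A.M.Indep ↑I →
    (I.card : ℝ) ≤ Z.card + ∑ i ∈ Finset.range A.m with i ∉ A.M.closure ↑Z, x i

variable {A}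

theorem v_nonneg : 0 ≤ A.v := le_max_left _ _

theorem Valid.ve_nonneg (h : A.Valid) : 0 ≤ A.ve :=
  mul_nonneg (by linarith [h.e_pos]) v_nonneg

theorem Valid.v_le_ve (h : A.Valid) : A.v ≤ A.ve := by
  have := mul_nonneg h.e_pos.le (v_nonneg (A := A))
  rw [ve]; linarith

theorem Valid.cap_nonneg (h : A.Valid) (w : ℕ) : 0 ≤ A.cap w := le_min (h.p_nonneg w) h.ve_nonneg

theorem cap_le (w : ℕ) : A.cap w ≤ A.p w := min_le_left _ _

theorem cap_le_ve (w : ℕ) : A.cap w ≤ A.ve := min_le_right _ _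

theorem p_eq_cap {w : ℕ} (h : A.cap w < A.ve) : A.p w = A.cap w := by
  rw [cap, min_lt_iff] at h
  rcases h with h | h
  · rw [cap, min_eq_left h.le]
  · exact absurd h (lt_irrefl _)

/-- A collection of total capped value below `ve` contains no resource that is cut off. Thus the
cut-off costs nothing in the places where the value of a collection is bounded from above. -/
theorem Valid.sum_p_eq (h : A.Valid) {R : Finset ℕ} (hR : ∑ w ∈ R, A.cap w < A.ve) :
    ∑ w ∈ R, A.p w = ∑ w ∈ R, A.cap w :=
  Finset.sum_congr rfl fun _ hw => p_eq_cap
    ((Finset.single_le_sum (fun i _ => h.cap_nonneg i) hw).trans_lt hR)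

/-- The balance in which the factor `1/3` and the term `pm / 3` originate; it requires that the
maximum in `v` is not attained at zero only. -/
theorem v_pos_facts (hv : 0 < A.v) (h : A.Valid) :
    A.T = 3 * A.v + A.pm + 3 * A.e * A.T ∧ 0 < A.T ∧ A.v ≤ A.T / 3 := by
  have h0 : A.v = (1 / 3 - A.e) * A.T - A.pm / 3 := by
    rw [v] at hv ⊢
    rcases le_total 0 ((1 / 3 - A.e) * A.T - A.pm / 3) with h | h
    · rw [max_eq_right h]
    · rw [max_eq_left h] at hv; exact absurd hv (lt_irrefl _)
  have h1 : A.T = 3 * A.v + A.pm + 3 * A.e * A.T := by rw [h0]; ring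
  have h2 := h.pm_nonneg
  have h3 := mul_nonneg h.e_pos.le h.T_nonneg
  exact ⟨h1, by nlinarith, by nlinarith⟩

theorem Valid.mem_ground (h : A.Valid) {x : ℕ} : x ∈ A.M.E ↔ x < A.m := by
  rw [h.ground]; rfl

theorem Valid.subset_range (h : A.Valid) {I : Finset ℕ} (hI : A.M.Indep ↑I) :
    I ⊆ Finset.range A.m := fun _ hx =>
  Finset.mem_range.2 (h.mem_ground.1 (hI.subset_ground hx))

end Problem

/-- A configuration of the local search: the chosen elements `C`, the owner `own w - 1` of the
resource `w` (no owner if `own w = 0`), the layer `lay c` of a blocking element, the layer `aL w`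
and the node `aN w` of the hyperedge of the tree that contains `w`, the number `top` of layers, and
the recorded sizes `b0` of the layers. -/
structure Config where
  C : Finset ℕ
  own : ℕ → ℕ
  lay : ℕ → ℕ
  aL : ℕ → ℕ
  aN : ℕ → ℕ
  top : ℕ
  b0 : ℕ → ℕ

namespace Config

open Finset Classical

variable (A : Problem) (s : Config)

/-- The resources of the chosen element `c`. -/
noncomputable def held (c : ℕ) : Finset ℕ := {w ∈ range A.k | s.own w = c + 1}

/-- The hyperedge at `x` in layer `j`. -/
noncomputable def edge (j x : ℕ) : Finset ℕ := {w ∈ range A.k | s.aL w = j ∧ s.aN w = x}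

/-- The resources of a hyperedge that are not owned. -/
noncomputable def freePart (j x : ℕ) : Finset ℕ := {w ∈ s.edge A j x | s.own w = 0}

/-- The nodes of the hyperedges in layer `j`. -/
noncomputable def nodes (j : ℕ) : Finset ℕ :=
  {x ∈ range A.m | ∃ w < A.k, s.aL w = j ∧ s.aN w = x}

/-- The blocking elements in layer `j`. -/
noncomputable def layer (j : ℕ) : Finset ℕ := {x ∈ range A.m | s.lay x = j}

/-- The chosen elements outside the first `i` layers. -/
noncomputable def rest (i : ℕ) : Finset ℕ := {c ∈ s.C | s.lay c = 0 ∨ i < s.lay c}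

/-- The nodes whose hyperedges in layer `j` have enough unowned resources. -/
noncomputable def addable (j : ℕ) : Finset ℕ :=
  {x ∈ range A.m | A.v ≤ ∑ w ∈ s.freePart A j x, A.cap w}

/-- The recorded total size of the root and the first `i` layers. -/
def beta (i : ℕ) : ℕ := 1 + ∑ j ∈ Icc 1 i, s.b0 j

/-- The value of the resources of `c` that lie in hyperedges of the tree. -/
noncomputable def touch (c : ℕ) : ℝ := ∑ w ∈ s.held A c with s.aL w ≠ 0, A.cap w

/-- The resources that are not available for hyperedges in layer `L`. -/
def Used (L w : ℕ) : Prop :=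
  s.aL w ≠ 0 ∨ ∃ c, s.own w = c + 1 ∧ s.lay c ≠ 0 ∧ (s.lay c ≠ L ∨ A.e ^ 2 * A.v ≤ s.touch A c)

/-- The resources available to `x` for a hyperedge in layer `L`. -/
noncomputable def avail (L x : ℕ) : Finset ℕ := {w ∈ range A.k | A.adj x w ∧ ¬ s.Used A L w}

/-- The chosen elements are independent and each of them owns enough, but not too much. -/
structure Covering : Prop where
  indep : A.M.Indep ↑s.C
  own : ∀ w c, s.own w = c + 1 → w < A.k ∧ c ∈ s.C ∧ A.adj c w
  ge : ∀ c ∈ s.C, A.v ≤ ∑ w ∈ s.held A c, A.cap w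
  le : ∀ c ∈ s.C, ∑ w ∈ s.held A c, A.p w ≤ A.v + A.pm

/-- The structure of the alternating tree with layers `1, …, t`. -/
structure Forest (t : ℕ) : Prop where
  lay : ∀ c, s.lay c ≠ 0 → c ∈ s.C ∧ s.lay c ≤ t
  aL : ∀ w, s.aL w ≠ 0 → w < A.k ∧ s.aN w < A.m ∧ A.adj (s.aN w) w ∧ s.aL w ≤ t
  blocked : ∀ w c, s.aL w ≠ 0 → s.own w = c + 1 → s.lay c = s.aL w
  edge_ge : ∀ j x, j ≠ 0 → x ∈ s.nodes A j → A.ve ≤ ∑ w ∈ s.edge A j x, A.cap w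
  edge_le : ∀ j x, ∑ w ∈ s.edge A (j + 1) x, A.cap w ≤ 2 * A.ve
  edge_p_le : ∀ j x, ∑ w ∈ s.edge A (j + 1) x, A.p w ≤ A.ve + A.pm
  last : ∀ c, s.lay c ≠ 0 →
    ∃ x, ∑ w ∈ s.held A c with s.aL w = s.lay c ∧ s.aN w ≠ x, A.cap w ≤ A.e ^ 2 * A.v

/-- The nodes of layer `j` are independent up to the recorded losses. -/
def Spread (j : ℕ) : Prop :=
  ∃ D ⊆ s.nodes A j, Disjoint (s.rest (j - 1)) D ∧ A.M.Indep ↑(s.rest (j - 1) ∪ D) ∧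
    (s.nodes A j).card + ∑ i ∈ Icc 1 (j - 1), (s.layer A i).card ≤
      D.card + ∑ i ∈ Icc 1 (j - 1), s.b0 i

/-- The size of layer `i` is close to the recorded one. -/
def Recorded (i : ℕ) : Prop :=
  (s.layer A i).card ≤ s.b0 i ∧ (s.b0 i : ℝ) - (s.layer A i).card ≤ A.mu * s.b0 i

/-- Layer `j` has many nodes. -/
def Wide (j : ℕ) : Prop := A.e ^ 3 / 8 * s.beta (j - 1) ≤ (s.nodes A j).card

/-- Layer `j` is large. -/
def Large (j : ℕ) : Prop := A.sigma * s.beta (j - 1) ≤ s.b0 j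

/-- The invariant of the local search. -/
structure Inv : Prop where
  covering : s.Covering A
  forest : s.Forest A s.top
  spread : ∀ j, 1 ≤ j → j ≤ s.top → s.Spread A j
  recorded : ∀ j, 1 ≤ j → j ≤ s.top → s.Recorded A j
  wide : ∀ j, 1 ≤ j → j ≤ s.top → s.Wide A j
  large : ∀ j, 1 ≤ j → j < s.top → s.Large A j

variable {A s}

theorem beta_pos (i : ℕ) : 0 < s.beta i := by rw [beta]; omega

theorem beta_succ (i : ℕ) : s.beta (i + 1) = s.beta i + s.b0 (i + 1) := by
  rw [beta, beta, Finset.sum_Icc_succ_top (by omega)]; omega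

theorem beta_mono {i j : ℕ} (h : i ≤ j) : s.beta i ≤ s.beta j := by
  rw [beta, beta]
  exact Nat.add_le_add_left (sum_le_sum_of_subset (Icc_subset_Icc_right h)) _

theorem mem_held {c w : ℕ} : w ∈ s.held A c ↔ w < A.k ∧ s.own w = c + 1 := by
  simp [held]

theorem mem_edge {j x w : ℕ} : w ∈ s.edge A j x ↔ w < A.k ∧ s.aL w = j ∧ s.aN w = x := by
  simp [edge]

theorem mem_nodes {j x : ℕ} : x ∈ s.nodes A j ↔ x < A.m ∧ ∃ w < A.k, s.aL w = j ∧ s.aN w = x := by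
  simp [nodes]

theorem mem_layer {j x : ℕ} : x ∈ s.layer A j ↔ x < A.m ∧ s.lay x = j := by
  simp [layer]

theorem mem_rest {i c : ℕ} : c ∈ s.rest i ↔ c ∈ s.C ∧ (s.lay c = 0 ∨ i < s.lay c) := by
  simp [rest]

theorem mem_avail {L x w : ℕ} : w ∈ s.avail A L x ↔ w < A.k ∧ A.adj x w ∧ ¬ s.Used A L w := by
  simp [avail]

theorem mem_freePart {j x w : ℕ} :
    w ∈ s.freePart A j x ↔ (w < A.k ∧ s.aL w = j ∧ s.aN w = x) ∧ s.own w = 0 := by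
  simp [freePart, edge]

theorem mem_addable {j x : ℕ} :
    x ∈ s.addable A j ↔ x < A.m ∧ A.v ≤ ∑ w ∈ s.freePart A j x, A.cap w := by
  simp [addable]

theorem Covering.rest_indep (h : s.Covering A) (i : ℕ) : A.M.Indep ↑(s.rest i) :=
  h.indep.subset (by exact_mod_cast filter_subset _ _)

theorem addable_subset_nodes (hv : 0 < A.v) (j : ℕ) : s.addable A j ⊆ s.nodes A j := by
  intro x hx
  rw [mem_addable] at hx
  rw [mem_nodes]
  refine ⟨hx.1, ?_⟩
  by_contra hne
  have : s.freePart A j x = ∅ := by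
    rw [eq_empty_iff_forall_notMem]
    intro w hw
    rw [mem_freePart] at hw
    exact hne ⟨w, hw.1.1, hw.1.2⟩
  rw [this, sum_empty] at hx
  linarith [hx.2]

/-- The number of chosen elements, sorted by layers. -/
theorem card_rest_add (hA : A.Valid) (hC : s.Covering A) {t : ℕ} (hF : s.Forest A t) (i : ℕ) :
    (s.rest i).card + ∑ j ∈ Icc 1 i, (s.layer A j).card = s.C.card := by
  have h1 : s.C = s.rest i ∪ (Icc 1 i).biUnion (s.layer A) := by
    ext c
    simp only [mem_union, mem_rest, mem_biUnion, mem_Icc, mem_layer]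
    constructor
    · intro hc
      have := Finset.mem_range.1 (hA.subset_range hC.indep hc)
      by_cases h : s.lay c = 0 ∨ i < s.lay c
      · exact Or.inl ⟨hc, h⟩
      · exact Or.inr ⟨s.lay c, by omega, this, rfl⟩
    · rintro (h | ⟨j, hj, -, h⟩)
      · exact h.1
      · exact (hF.lay c (by omega)).1
  have h2 : Disjoint (s.rest i) ((Icc 1 i).biUnion (s.layer A)) := by
    rw [disjoint_left]
    intro c hc hc'
    simp only [mem_rest, mem_biUnion, mem_Icc, mem_layer] at hc hc'
    obtain ⟨j, hj, -, h⟩ := hc'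
    omega
  have h3 : ((Icc 1 i).biUnion (s.layer A)).card = ∑ j ∈ Icc 1 i, (s.layer A j).card := by
    refine card_biUnion ?_
    intro a _ b _ hab
    rw [Function.onFun, disjoint_left]
    intro c hc hc'
    rw [mem_layer] at hc hc'
    omega
  conv_rhs => rw [h1]
  rw [card_union_of_disjoint h2, h3]

end Config

/-! ### Counting in a tree that admits no collapse, and the consequence of the linear program -/

namespace Config

open Finset Classical

variable {A : Problem} {s : Config}

variable (A s) in
/-- The addable hyperedges of layer `j` do not suffice for a collapse. -/
def Calm (j : ℕ) : Prop :=
  ∀ G ⊆ s.addable A j, Disjoint (s.rest (j - 1)) G → A.M.Indep ↑(s.rest (j - 1) ∪ G) →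
    (G.card : ℝ) < A.mu * s.beta (j - 1)

theorem sum_biUnion_le_of_nonneg {ι : Type*} (S : Finset ι) (f : ι → Finset ℕ) (g : ℕ → ℝ)
    (hg : ∀ w, 0 ≤ g w) : ∑ w ∈ S.biUnion f, g w ≤ ∑ i ∈ S, ∑ w ∈ f i, g w := by
  induction S using Finset.induction_on with
  | empty => simp
  | insert a S ha ih =>
    rw [biUnion_insert, sum_insert ha]
    have := sum_union_inter (s₁ := f a) (s₂ := S.biUnion f) (f := g)
    have h2 : 0 ≤ ∑ w ∈ f a ∩ S.biUnion f, g w := sum_nonneg fun i _ => hg i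
    linarith

theorem sum_union_le_of_nonneg (S R : Finset ℕ) (g : ℕ → ℝ) (hg : ∀ w, 0 ≤ g w) :
    ∑ w ∈ S ∪ R, g w ≤ ∑ w ∈ S, g w + ∑ w ∈ R, g w := by
  have := sum_union_inter (s₁ := S) (s₂ := R) (f := g)
  have h2 : 0 ≤ ∑ w ∈ S ∩ R, g w := sum_nonneg fun i _ => hg i
  linarith

theorem mu_pos (hA : A.Valid) : 0 < A.mu := by
  have := hA.e_pos
  rw [Problem.mu]; positivity

theorem sigma_pos (hA : A.Valid) : 0 < A.sigma := by
  have := hA.e_pos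
  rw [Problem.sigma]; positivity

theorem mu_eq : A.mu = A.e / 8 * A.sigma := by rw [Problem.mu, Problem.sigma]; ring

theorem mu_le (hA : A.Valid) : A.mu ≤ 1 / 2 := by
  have h1 := hA.e_pos
  have h2 : A.e ^ 4 ≤ 1 := pow_le_one₀ h1.le (by linarith [hA.e_le])
  rw [Problem.mu]; linarith

/-- `Calm` speaks only of addable nodes that are independent over `rest`. The set `D` from `Spread`
is of this kind, so fewer than `mu * beta` addable nodes lie in it. The nodes outside `D` are no
more than the losses of the lower layers since they were recorded, and these are at most a fraction
`mu` of the recorded sizes. -/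
theorem card_addable_le (hA : A.Valid) (hv : 0 < A.v) {j : ℕ} (hS : s.Spread A j)
    (hR : ∀ i, 1 ≤ i → i < j → s.Recorded A i) (hc : s.Calm A j) :
    ((s.addable A j).card : ℝ) ≤ 2 * A.mu * s.beta (j - 1) := by
  obtain ⟨D, hD, hdis, hind, hcard⟩ := hS
  have h1 := hc (D ∩ s.addable A j) inter_subset_right
    (disjoint_of_subset_right inter_subset_left hdis)
    (hind.subset (by exact_mod_cast union_subset_union_right inter_subset_left))
  have h2 : (s.addable A j).card ≤ (D ∩ s.addable A j).card + (s.nodes A j \ D).card := by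
    refine (card_le_card ?_).trans (card_union_le _ _)
    intro x hx
    have := addable_subset_nodes hv j hx
    simp only [mem_union, mem_inter, mem_sdiff]
    tauto
  have h3 : (s.nodes A j \ D).card + D.card = (s.nodes A j).card := card_sdiff_add_card_eq_card hD
  have h4 : ((s.nodes A j \ D).card : ℝ) + ∑ i ∈ Icc 1 (j - 1), ((s.layer A i).card : ℝ) ≤
      ∑ i ∈ Icc 1 (j - 1), (s.b0 i : ℝ) := by
    have : (s.nodes A j \ D).card + ∑ i ∈ Icc 1 (j - 1), (s.layer A i).card ≤
      ∑ i ∈ Icc 1 (j - 1), s.b0 i := by omega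
    exact_mod_cast this
  have h5 : ∑ i ∈ Icc 1 (j - 1), (s.b0 i : ℝ) - ∑ i ∈ Icc 1 (j - 1), ((s.layer A i).card : ℝ) ≤
      A.mu * ∑ i ∈ Icc 1 (j - 1), (s.b0 i : ℝ) := by
    rw [← sum_sub_distrib, mul_sum]
    refine sum_le_sum fun i hi => ?_
    rw [mem_Icc] at hi
    exact (hR i hi.1 (by omega)).2
  have h6 : (s.beta (j - 1) : ℝ) = 1 + ∑ i ∈ Icc 1 (j - 1), (s.b0 i : ℝ) := by
    rw [beta]; push_cast; rfl
  have h7 : ((s.addable A j).card : ℝ) ≤ (D ∩ s.addable A j).card + (s.nodes A j \ D).card := by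
    exact_mod_cast h2
  have h8 := mu_pos hA
  rw [h6] at h1 ⊢
  linarith

theorem sum_freePart_add (j x : ℕ) : ∑ w ∈ s.freePart A j x, A.cap w +
    ∑ w ∈ s.edge A j x with s.own w ≠ 0, A.cap w = ∑ w ∈ s.edge A j x, A.cap w :=
  sum_filter_add_sum_filter_not _ _ _

/-- A hyperedge has value at least `(1 + e) v`, and less than `v` of it is unowned if it is not
addable, so more than `e v` of it is blocked. Apart from one hyperedge, a blocking element
contributes at most `e ^ 2 v` to all hyperedges together. So there are at most one such hyperedge
per blocking element and a fraction `e` more. -/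
theorem card_blocked_le (hA : A.Valid) (hv : 0 < A.v) (hC : s.Covering A) {t : ℕ}
    (hF : s.Forest A t) {j : ℕ} (hj : j ≠ 0) :
    ((s.nodes A j \ s.addable A j).card : ℝ) ≤ (1 + A.e) * (s.layer A j).card := by
  have hlast : ∀ c, ∃ x, s.lay c ≠ 0 →
      ∑ w ∈ s.held A c with s.aL w = s.lay c ∧ s.aN w ≠ x, A.cap w ≤ A.e ^ 2 * A.v := by
    intro c
    by_cases h : s.lay c ≠ 0
    · obtain ⟨x, hx⟩ := hF.last c h
      exact ⟨x, fun _ => hx⟩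
    · exact ⟨0, fun h' => absurd h' h⟩
  choose f hf using hlast
  set N := s.nodes A j \ s.addable A j with hN
  -- One node `f c` for each blocking element `c` is set aside; over the nodes that remain, `c`
  -- contributes at most `e ^ 2 v`.
  set N2 := N \ (s.layer A j).image f with hN2
  have h1 : (N.card : ℝ) ≤ (s.layer A j).card + N2.card := by
    have h : N.card ≤ N2.card + ((s.layer A j).image f).card := by
      refine (card_le_card ?_).trans (card_union_le _ _)
      intro x hx
      simp only [hN2, mem_union, mem_sdiff]
      tauto
    have := card_image_le (s := s.layer A j) (f := f)
    exact_mod_cast (by omega : N.card ≤ (s.layer A j).card + N2.card)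
  set S : Finset ℕ := {w ∈ range A.k | s.aL w = j ∧ s.aN w ∈ N2 ∧ s.own w ≠ 0} with hS
  have h2 : A.e * A.v * N2.card ≤ ∑ w ∈ S, A.cap w := by
    rw [← sum_fiberwise_of_maps_to (s := S) (t := N2) (g := s.aN)
      (fun w hw => (mem_filter.1 hw).2.2.1), mul_comm, ← nsmul_eq_mul]
    refine card_nsmul_le_sum _ _ _ fun x hx => ?_
    have hx' : x ∈ s.nodes A j ∧ x ∉ s.addable A j := by
      simpa [hN] using (mem_sdiff.1 hx).1
    have e1 := hF.edge_ge j x hj hx'.1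
    have e2 : ∑ w ∈ s.freePart A j x, A.cap w < A.v := by
      by_contra hlt
      exact hx'.2 (mem_addable.2 ⟨(mem_nodes.1 hx'.1).1, not_lt.1 hlt⟩)
    have e3 := sum_freePart_add (A := A) (s := s) j x
    have e4 : {w ∈ S | s.aN w = x} = {w ∈ s.edge A j x | s.own w ≠ 0} := by
      ext w
      simp only [hS, mem_filter, mem_range, mem_edge]
      constructor
      · tauto
      · rintro ⟨⟨a, b, rfl⟩, d⟩
        exact ⟨⟨a, b, hx, d⟩, rfl⟩
    rw [e4]
    have e5 : A.ve = A.v + A.e * A.v := by rw [Problem.ve]; ring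
    linarith
  have h3 : ∑ w ∈ S, A.cap w ≤ (s.layer A j).card * (A.e ^ 2 * A.v) := by
    have hmaps : ∀ w ∈ S, s.own w - 1 ∈ s.layer A j := by
      intro w hw
      simp only [hS, mem_filter, mem_range] at hw
      obtain ⟨a, b, c, d⟩ := hw
      have ho : s.own w = (s.own w - 1) + 1 := by omega
      have hl := hF.blocked w _ (by omega) ho
      rw [mem_layer]
      exact ⟨mem_range.1 (hA.subset_range hC.indep (hC.own w _ ho).2.1), by omega⟩
    rw [← sum_fiberwise_of_maps_to hmaps, ← nsmul_eq_mul]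
    refine sum_le_card_nsmul _ _ _ fun c hc => ?_
    rw [mem_layer] at hc
    refine le_trans (sum_le_sum_of_subset_of_nonneg ?_ fun w _ _ => hA.cap_nonneg w)
      (hf c (by omega))
    intro w hw
    simp only [hS, mem_filter, mem_range, mem_held] at hw ⊢
    obtain ⟨⟨a, b, c', d⟩, g⟩ := hw
    refine ⟨⟨a, by omega⟩, by omega, ?_⟩
    intro hx
    rw [hN2, mem_sdiff] at c'
    exact c'.2 (mem_image.2 ⟨c, mem_layer.2 hc, hx.symm⟩)
  have h4 : A.v * (A.e * N2.card) ≤ A.v * (A.e * (A.e * (s.layer A j).card)) := by linarith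
  have h5 := le_of_mul_le_mul_left (le_of_mul_le_mul_left h4 hv) hA.e_pos
  linarith

/-- Of at least `e ^ 3 / 8 * beta` nodes at most `2 mu * beta ≤ e ^ 3 / 16 * beta` are addable. The
others number at most `1 + e ≤ 2` times the blocking elements, and this leaves `e ^ 3 / 32 = sigma`.
-/
theorem large_of_calm (hA : A.Valid) (hv : 0 < A.v) (hC : s.Covering A) {t : ℕ}
    (hF : s.Forest A t) {j : ℕ} (hj : j ≠ 0) (hS : s.Spread A j)
    (hR : ∀ i, 1 ≤ i → i < j → s.Recorded A i) (hc : s.Calm A j) (hW : s.Wide A j) :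
    A.sigma * s.beta (j - 1) ≤ (s.layer A j).card := by
  have h1 := card_addable_le hA hv hS hR hc
  have h2 := card_blocked_le hA hv hC hF hj
  have h3 : ((s.nodes A j \ s.addable A j).card : ℝ) + (s.addable A j).card =
      (s.nodes A j).card := by
    exact_mod_cast card_sdiff_add_card_eq_card (addable_subset_nodes hv j)
  rw [Wide] at hW
  have e0 := hA.e_pos
  have e1 := hA.e_le
  have hb : (0 : ℝ) ≤ s.beta (j - 1) := Nat.cast_nonneg _
  have hl : (0 : ℝ) ≤ (s.layer A j).card := Nat.cast_nonneg _
  rw [Problem.mu] at h1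
  rw [Problem.sigma]
  have h4 : (1 + A.e) * (s.layer A j).card ≤ 2 * ((s.layer A j).card : ℝ) :=
    mul_le_mul_of_nonneg_right (by linarith) hl
  have h5 : 2 * (A.e ^ 4 / 256) * (s.beta (j - 1) : ℝ) ≤ A.e ^ 3 / 16 * s.beta (j - 1) := by
    refine mul_le_mul_of_nonneg_right ?_ hb
    nlinarith [pow_pos e0 3]
  linarith

/-- An element of `Y` obtains at most `ve * x i` from available resources, since these have total
size below `ve` and `y i w ≤ x i`. The remainder of `T * x i` is drawn from used resources, each of
which is handed out at most once. -/
theorem sum_used_le (hA : A.Valid) {x : ℕ → ℝ} {y : ℕ → ℕ → ℝ} (hxy : A.Fractional x y)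
    (L : ℕ) (Y : Finset ℕ) (hY : ∀ i ∈ Y, i < A.m ∧ ∑ w ∈ s.avail A L i, A.cap w < A.ve) :
    (A.T - A.ve) * ∑ i ∈ Y, x i ≤ ∑ w ∈ range A.k with s.Used A L w, A.p w := by
  have h1 : ∀ i ∈ Y, A.T * x i ≤
      ∑ w ∈ range A.k with s.Used A L w, A.p w * y i w + A.ve * x i := by
    intro i hi
    refine (hxy.value i (hY i hi).1).trans ?_
    rw [← sum_filter_add_sum_filter_not (range A.k) (s.Used A L)]
    gcongr
    have e1 := hA.sum_p_eq (hY i hi).2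
    calc ∑ w ∈ range A.k with ¬ s.Used A L w, A.p w * y i w
        = ∑ w ∈ s.avail A L i, A.p w * y i w := by
          symm
          refine sum_subset ?_ ?_
          · intro w hw
            rw [mem_avail] at hw
            simp [hw.1, hw.2.2]
          · intro w hw hw'
            rw [mem_filter, mem_range] at hw
            rw [mem_avail] at hw'
            rw [hxy.y_adj i w (by tauto), mul_zero]
      _ ≤ ∑ w ∈ s.avail A L i, A.p w * x i :=
          sum_le_sum fun w _ => mul_le_mul_of_nonneg_left (hxy.y_le i w) (hA.p_nonneg w)
      _ = (∑ w ∈ s.avail A L i, A.cap w) * x i := by rw [← sum_mul, e1]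
      _ ≤ A.ve * x i := mul_le_mul_of_nonneg_right (hY i hi).2.le (hxy.x_nonneg i)
  have h2 := sum_le_sum h1
  rw [sum_add_distrib, ← mul_sum, ← mul_sum, sum_comm] at h2
  have h3 : ∑ w ∈ range A.k with s.Used A L w, ∑ i ∈ Y, A.p w * y i w ≤
      ∑ w ∈ range A.k with s.Used A L w, A.p w := by
    refine sum_le_sum fun w hw => ?_
    rw [← mul_sum]
    have e1 := hxy.load w (mem_range.1 (mem_filter.1 hw).1)
    have e2 : ∑ i ∈ Y, y i w ≤ ∑ i ∈ range A.m, y i w :=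
      sum_le_sum_of_subset_of_nonneg (fun i hi => mem_range.2 (hY i hi).1)
        fun i _ _ => hxy.y_nonneg i w
    nlinarith [hA.p_nonneg w]
  linarith

/-- The four summands: the resources held by blocking elements of the complete layers, those held by
saturated elements of the new layer, the hyperedges of the new layer, and the unowned parts of the
older hyperedges. -/
theorem sum_used_le_parts (hA : A.Valid) (hC : s.Covering A) {l : ℕ}
    (hF : s.Forest A (l + 1)) :
    ∑ w ∈ range A.k with s.Used A (l + 1) w, A.p w ≤
      (∑ j ∈ Icc 1 l, ((s.layer A j).card : ℝ)) * (A.v + A.pm) +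
      ((s.layer A (l + 1)).filter fun c => A.e ^ 2 * A.v ≤ s.touch A c).card * (A.v + A.pm) +
      (s.nodes A (l + 1)).card * (A.ve + A.pm) +
      ∑ j ∈ Icc 1 l, ∑ x ∈ s.nodes A j, ∑ w ∈ s.freePart A j x, A.p w := by
  set Sat := (s.layer A (l + 1)).filter fun c => A.e ^ 2 * A.v ≤ s.touch A c with hSat
  have hm : ∀ {w c}, s.own w = c + 1 → c < A.m := fun h =>
    mem_range.1 (hA.subset_range hC.indep (hC.own _ _ h).2.1)
  have hsub : (range A.k).filter (s.Used A (l + 1)) ⊆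
      ((((Icc 1 l).biUnion fun j => (s.layer A j).biUnion (s.held A)) ∪
        Sat.biUnion (s.held A)) ∪ (s.nodes A (l + 1)).biUnion (s.edge A (l + 1))) ∪
        (Icc 1 l).biUnion fun j => (s.nodes A j).biUnion (s.freePart A j) := by
    intro w hw
    rw [mem_filter, mem_range] at hw
    obtain ⟨hwk, hu⟩ := hw
    simp only [mem_union, mem_biUnion, mem_Icc]
    -- An owned resource in an older hyperedge is counted with its owner, who belongs to the same
    -- layer by `blocked`; therefore only the unowned part of an older hyperedge is listed
    -- separately.
    by_cases ho : s.own w = 0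
    · rcases hu with hu | ⟨c, hc, -⟩
      · obtain ⟨-, h2, -, h4⟩ := hF.aL w hu
        by_cases h : s.aL w = l + 1
        · exact Or.inl (Or.inr ⟨s.aN w, mem_nodes.2 ⟨h2, w, hwk, h, rfl⟩,
            mem_edge.2 ⟨hwk, h, rfl⟩⟩)
        · exact Or.inr ⟨s.aL w, by omega, s.aN w, mem_nodes.2 ⟨h2, w, hwk, rfl, rfl⟩,
            mem_freePart.2 ⟨⟨hwk, rfl, rfl⟩, ho⟩⟩
      · omega
    · obtain ⟨c, hc⟩ : ∃ c, s.own w = c + 1 := ⟨s.own w - 1, by omega⟩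
      by_cases hl : s.aL w = l + 1
      · obtain ⟨-, h2, -, h4⟩ := hF.aL w (by omega)
        exact Or.inl (Or.inr ⟨s.aN w, mem_nodes.2 ⟨h2, w, hwk, hl, rfl⟩,
            mem_edge.2 ⟨hwk, hl, rfl⟩⟩)
      · have hheld : w ∈ s.held A c := mem_held.2 ⟨hwk, hc⟩
        rcases hu with hu | ⟨c', hc', h1, h2⟩
        · have h3 := hF.blocked w c hu hc
          have h4 := (hF.aL w hu).2.2.2
          exact Or.inl (Or.inl (Or.inl ⟨s.aL w, by omega, c,
            mem_layer.2 ⟨hm hc, h3⟩, hheld⟩))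
        · obtain rfl : c' = c := by omega
          have h4 := (hF.lay c' h1).2
          by_cases h5 : s.lay c' = l + 1
          · refine Or.inl (Or.inl (Or.inr ⟨c', ?_, hheld⟩))
            rw [hSat, mem_filter, mem_layer]
            exact ⟨⟨hm hc, h5⟩, by tauto⟩
          · exact Or.inl (Or.inl (Or.inl ⟨s.lay c', by omega, c',
              mem_layer.2 ⟨hm hc, rfl⟩, hheld⟩))
  have hp := hA.p_nonneg
  have hheldle : ∀ (S : Finset ℕ), (∀ c ∈ S, c ∈ s.C) →
      ∑ c ∈ S, ∑ w ∈ s.held A c, A.p w ≤ S.card * (A.v + A.pm) := by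
    intro S hS
    rw [← nsmul_eq_mul]
    exact sum_le_card_nsmul _ _ _ fun c hc => hC.le c (hS c hc)
  refine (sum_le_sum_of_subset_of_nonneg hsub fun w _ _ => hp w).trans ?_
  refine (sum_union_le_of_nonneg _ _ _ hp).trans (add_le_add ?_ ?_)
  · refine (sum_union_le_of_nonneg _ _ _ hp).trans (add_le_add ?_ ?_)
    · refine (sum_union_le_of_nonneg _ _ _ hp).trans (add_le_add ?_ ?_)
      · refine (sum_biUnion_le_of_nonneg _ _ _ hp).trans ?_
        rw [sum_mul]
        refine sum_le_sum fun j hj => (sum_biUnion_le_of_nonneg _ _ _ hp).trans ?_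
        refine hheldle _ fun c hc => ?_
        rw [mem_layer] at hc
        rw [mem_Icc] at hj
        exact (hF.lay c (by omega)).1
      · refine (sum_biUnion_le_of_nonneg _ _ _ hp).trans (hheldle _ fun c hc => ?_)
        rw [hSat, mem_filter, mem_layer] at hc
        exact (hF.lay c (by omega)).1
    · refine (sum_biUnion_le_of_nonneg _ _ _ hp).trans ?_
      rw [← nsmul_eq_mul]
      exact sum_le_card_nsmul _ _ _ fun x _ => hF.edge_p_le l x
  · refine (sum_biUnion_le_of_nonneg _ _ _ hp).trans (sum_le_sum fun j _ => ?_)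
    exact sum_biUnion_le_of_nonneg _ _ _ hp

/-- A layer with few nodes saturates few elements. -/
theorem card_saturated_le (hA : A.Valid) (hv : 0 < A.v) {l : ℕ} (hF : s.Forest A (l + 1)) :
    A.e ^ 2 * ((s.layer A (l + 1)).filter fun c => A.e ^ 2 * A.v ≤ s.touch A c).card ≤
      2 * (1 + A.e) * (s.nodes A (l + 1)).card := by
  set Sat := (s.layer A (l + 1)).filter fun c => A.e ^ 2 * A.v ≤ s.touch A c with hSat
  have h1 : Sat.card * (A.e ^ 2 * A.v) ≤ ∑ c ∈ Sat, s.touch A c := by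
    rw [← nsmul_eq_mul]
    exact card_nsmul_le_sum _ _ _ fun c hc => (mem_filter.1 hc).2
  set S : Finset ℕ := {w ∈ range A.k | s.aL w = l + 1} with hS
  -- By `blocked`, an element of the new layer is touched by hyperedges of this layer only.
  have h2 : ∑ c ∈ Sat, s.touch A c ≤ ∑ w ∈ S, A.cap w := by
    have hd : (Sat : Set ℕ).PairwiseDisjoint
        (fun c => {w ∈ s.held A c | s.aL w ≠ 0}) := by
      intro a _ b _ hab
      rw [Function.onFun, disjoint_left]
      intro w hw hw'
      simp only [mem_filter, mem_held] at hw hw'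
      omega
    simp only [touch]
    rw [← sum_biUnion hd]
    refine sum_le_sum_of_subset_of_nonneg ?_ fun w _ _ => hA.cap_nonneg w
    intro w hw
    simp only [mem_biUnion, mem_filter, mem_held, hSat, mem_layer] at hw
    obtain ⟨c, ⟨⟨-, hc⟩, -⟩, ⟨hk, ho⟩, ha⟩ := hw
    rw [hS, mem_filter, mem_range]
    exact ⟨hk, by rw [← hF.blocked w c ha ho, hc]⟩
  -- This is the purpose of the cut-off: in capped value a hyperedge is worth at most `2 * ve`,
  -- however large `pm` is compared with `v`.
  have h3 : ∑ w ∈ S, A.cap w ≤ (s.nodes A (l + 1)).card * (2 * A.ve) := by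
    have hmaps : ∀ w ∈ S, s.aN w ∈ s.nodes A (l + 1) := by
      intro w hw
      simp only [hS, mem_filter, mem_range] at hw
      exact mem_nodes.2 ⟨(hF.aL w (by omega)).2.1, w, hw.1, hw.2, rfl⟩
    rw [← sum_fiberwise_of_maps_to hmaps, ← nsmul_eq_mul]
    refine sum_le_card_nsmul _ _ _ fun x _ => ?_
    have he : {w ∈ S | s.aN w = x} = s.edge A (l + 1) x := by
      ext w
      simp only [hS, mem_filter, mem_range, mem_edge]
      tauto
    rw [he]
    exact hF.edge_le l x
  have h4 : A.v * (A.e ^ 2 * Sat.card) ≤ A.v * (2 * (1 + A.e) * (s.nodes A (l + 1)).card) := by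
    rw [Problem.ve] at h3
    linarith
  exact le_of_mul_le_mul_left h4 hv

/-- For `d = b = N = 0` the inequality would amount to `T ≤ 3 v + pm` up to terms of order `e v`,
against the surplus `3 e T` in `hT`. The surplus has to be covered by the `d` new nodes, the `b`
saturated elements and the `N` addable nodes. Here `N` is too small, and `b` is at most of the order
of `d / e ^ 2`, whence the factor `e ^ 3`. -/
theorem width_estimate {T v e pm B d b N : ℝ} (hT : T = 3 * v + pm + 3 * e * T) (hT0 : 0 < T)
    (hv : 0 ≤ v) (hvT : v ≤ T / 3) (e0 : 0 < e) (e1 : e ≤ 1 / 3) (hpm : 0 ≤ pm) (hB : 0 ≤ B)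
    (hd : 0 ≤ d) (hb : 0 ≤ b) (hN : 0 ≤ N)
    (h : (T - (v + e * v)) * (1 + B - d) ≤ B * (v + pm) + b * (v + pm) +
      d * (v + e * v + pm) + (N * (v + e * v + pm) + (1 + e) * B * v))
    (hbd : e ^ 2 * b ≤ 2 * (1 + e) * d) (hNB : N ≤ e / 4 * B) : e ^ 3 * (1 + B) ≤ 2 * d := by
  have hev : e * v ≤ e * (T / 3) := mul_le_mul_of_nonneg_left hvT e0.le
  have hev0 : 0 ≤ e * v := mul_nonneg e0.le hv
  have heT0 : 0 < e * T := mul_pos e0 hT0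
  have heT : e * T ≤ 1 / 3 * T := mul_le_mul_of_nonneg_right e1 hT0.le
  have k1 : b * (v + pm) ≤ b * T := mul_le_mul_of_nonneg_left (by linarith) hb
  have k2 : N * (v + e * v + pm) ≤ N * (2 * T) := mul_le_mul_of_nonneg_left (by linarith) hN
  have k3 : d * (T + pm) ≤ d * (2 * T) := mul_le_mul_of_nonneg_left (by linarith) hd
  -- The bracket on the right is `3 e T - 2 e v`, and `e v ≤ e T / 3`.
  have k4 : 2 * (e * T) * (1 + B) ≤ (T - (v + e * v) - (v + pm) - (1 + e) * v) * (1 + B) :=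
    mul_le_mul_of_nonneg_right (by linarith) (by linarith)
  have k5 : 0 ≤ v + pm + (1 + e) * v := by linarith
  have k6 : T * (2 * e * (1 + B)) ≤ T * (2 * d + b + 2 * N) := by linarith
  have k7 := le_of_mul_le_mul_left k6 hT0
  -- The term `2 N ≤ e / 2 * B` absorbs a quarter of the left side.
  have k8 : 3 / 2 * e * (1 + B) ≤ 2 * d + b := by linarith
  have k9 : e ^ 2 * (3 / 2 * e * (1 + B)) ≤ e ^ 2 * (2 * d + b) :=
    mul_le_mul_of_nonneg_left k8 (by positivity)
  have k10 : e ^ 2 ≤ 1 / 9 := by nlinarith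
  have k11 : e ^ 2 * d ≤ 1 / 9 * d := mul_le_mul_of_nonneg_right k10 hd
  have k12 : e * d ≤ 1 / 3 * d := mul_le_mul_of_nonneg_right e1 hd
  linarith

/-- A new layer is wide unless there are many addable hyperedges. -/
theorem wide_of_calm (hA : A.Valid) (hv : 0 < A.v) {x : ℕ → ℝ} {y : ℕ → ℕ → ℝ}
    (hxy : A.Fractional x y) (hC : s.Covering A) {l : ℕ} (hF : s.Forest A (l + 1))
    (hS : ∀ j, 1 ≤ j → j ≤ l → s.Spread A j) (hR : ∀ j, 1 ≤ j → j ≤ l → s.Recorded A j)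
    (hW : ∀ j, 1 ≤ j → j ≤ l → s.Wide A j) (hc : ∀ j, 1 ≤ j → j ≤ l → s.Calm A j)
    (hdis : Disjoint (s.rest l) (s.nodes A (l + 1)))
    (hind : A.M.Indep ↑(s.rest l ∪ s.nodes A (l + 1)))
    (hmax : ∀ i < A.m, i ∉ A.M.closure ↑(s.rest l ∪ s.nodes A (l + 1)) →
      ∑ w ∈ s.avail A (l + 1) i, A.cap w < A.ve)
    (hI : ∃ I : Finset ℕ, A.M.Indep ↑I ∧ s.C.card + 1 ≤ I.card) : s.Wide A (l + 1) := by
  obtain ⟨hT, hT0, hvT⟩ := Problem.v_pos_facts hv hA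
  obtain ⟨I, hI, hIc⟩ := hI
  have e0 := hA.e_pos
  have e1 := hA.e_le
  have hpm := hA.pm_nonneg
  set B : ℝ := ∑ j ∈ Icc 1 l, ((s.layer A j).card : ℝ) with hB
  set d : ℝ := ((s.nodes A (l + 1)).card : ℝ) with hd
  set b : ℝ := (((s.layer A (l + 1)).filter fun c => A.e ^ 2 * A.v ≤ s.touch A c).card : ℝ)
    with hb
  set Y : Finset ℕ := {i ∈ range A.m | i ∉ A.M.closure ↑(s.rest l ∪ s.nodes A (l + 1))} with hY
  have hd0 : 0 ≤ d := Nat.cast_nonneg _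
  have hb0 : 0 ≤ b := Nat.cast_nonneg _
  have hB0 : 0 ≤ B := sum_nonneg fun j _ => Nat.cast_nonneg _
  -- The rank inequality is applied to `rest ∪ nodes` and an independent set larger than `C`.
  -- Leaving out the first `l` layers makes `rest` smaller than `C` by `B`, and the new nodes return
  -- `d`.
  have hYx : 1 + B - d ≤ ∑ i ∈ Y, x i := by
    have h1 := hxy.rank _ I hind hI
    have h2 : ((s.rest l).card : ℝ) + B = s.C.card := by
      rw [hB]; exact_mod_cast card_rest_add hA hC hF l
    rw [card_union_of_disjoint hdis] at h1
    have h3 : (s.C.card : ℝ) + 1 ≤ I.card := by exact_mod_cast hIc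
    rw [Nat.cast_add] at h1
    linarith
  have hL := sum_used_le (s := s) hA hxy (l + 1) Y (fun i hi => by
    rw [hY, mem_filter, mem_range] at hi
    exact ⟨hi.1, hmax i hi.1 hi.2⟩)
  have hU := sum_used_le_parts hA hC hF
  have hsat := card_saturated_le hA hv hF
  set NI : ℝ := ∑ j ∈ Icc 1 l, ((s.addable A j).card : ℝ) with hNI
  have hNI0 : 0 ≤ NI := sum_nonneg fun j _ => Nat.cast_nonneg _
  -- The full size `ve + pm` is charged for addable nodes only; any other node has less than `v`
  -- unowned, and the number of those is controlled by `card_blocked_le`.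
  have hfree : ∑ j ∈ Icc 1 l, ∑ x ∈ s.nodes A j, ∑ w ∈ s.freePart A j x, A.p w ≤
      NI * (A.ve + A.pm) + (1 + A.e) * B * A.v := by
    rw [hNI, hB, mul_sum, sum_mul, sum_mul, ← sum_add_distrib]
    refine sum_le_sum fun j hj => ?_
    rw [mem_Icc] at hj
    rw [← sum_sdiff (addable_subset_nodes hv j), add_comm]
    refine add_le_add ?_ ?_
    · rw [← nsmul_eq_mul]
      refine sum_le_card_nsmul _ _ _ fun x _ => ?_
      obtain ⟨i, rfl⟩ : ∃ i, j = i + 1 := ⟨j - 1, by omega⟩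
      exact (sum_le_sum_of_subset_of_nonneg (filter_subset _ _)
        fun w _ _ => hA.p_nonneg w).trans (hF.edge_p_le i x)
    · refine le_trans ?_ (mul_le_mul_of_nonneg_right
        (card_blocked_le hA hv hC hF (by omega : j ≠ 0)) hv.le)
      rw [← nsmul_eq_mul]
      refine sum_le_card_nsmul _ _ _ fun x hx => ?_
      have hlt : ∑ w ∈ s.freePart A j x, A.cap w < A.v := by
        by_contra hlt
        rw [mem_sdiff] at hx
        exact hx.2 (mem_addable.2 ⟨(mem_nodes.1 hx.1).1, not_lt.1 hlt⟩)
      rw [hA.sum_p_eq (hlt.trans_le hA.v_le_ve)]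
      exact hlt.le
  -- At most `2 mu * beta = e / 4 * sigma * beta` nodes of a layer are addable, and `sigma * beta`
  -- is at most the size of the layer.
  have hNIB : NI ≤ A.e / 4 * B := by
    rw [hNI, hB, mul_sum]
    refine sum_le_sum fun j hj => ?_
    rw [mem_Icc] at hj
    have hR' : ∀ i, 1 ≤ i → i < j → s.Recorded A i := fun i h1 h2 => hR i h1 (by omega)
    have h1 := card_addable_le hA hv (hS j hj.1 hj.2) hR' (hc j hj.1 hj.2)
    have h2 := large_of_calm hA hv hC hF (by omega) (hS j hj.1 hj.2) hR' (hc j hj.1 hj.2)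
      (hW j hj.1 hj.2)
    rw [mu_eq] at h1
    have h3 := mul_le_mul_of_nonneg_left h2 (by linarith : 0 ≤ A.e / 4)
    linarith
  -- Recorded sizes exceed the actual ones by at most the fraction `mu ≤ 1/2`, hence by a factor of
  -- at most two.
  have hbeta : (s.beta l : ℝ) ≤ 2 * (1 + B) := by
    have h1 : (s.beta l : ℝ) = 1 + ∑ i ∈ Icc 1 l, (s.b0 i : ℝ) := by
      rw [beta]; push_cast; rfl
    have h2 : ∑ i ∈ Icc 1 l, (s.b0 i : ℝ) ≤ 2 * B := by
      rw [hB, mul_sum]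
      refine sum_le_sum fun i hi => ?_
      rw [mem_Icc] at hi
      have h3 := (hR i hi.1 hi.2).2
      have h4 := mul_le_mul_of_nonneg_right (mu_le hA) (Nat.cast_nonneg (s.b0 i) : (0 : ℝ) ≤ _)
      linarith
    linarith
  have hve : A.ve = A.v + A.e * A.v := by rw [Problem.ve]; ring
  have hTve : 0 ≤ A.T - A.ve := by nlinarith
  have hkey : (A.T - A.ve) * (1 + B - d) ≤ B * (A.v + A.pm) + b * (A.v + A.pm) +
      d * (A.ve + A.pm) + (NI * (A.ve + A.pm) + (1 + A.e) * B * A.v) := by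
    have := mul_le_mul_of_nonneg_left hYx hTve
    linarith
  rw [hve] at hkey
  have := width_estimate hT hT0 hv.le hvT e0 e1 hpm hB0 hd0 hb0 hNI0 hkey hsat hNIB
  have k14 : A.e ^ 3 * s.beta l ≤ A.e ^ 3 * (2 * (1 + B)) :=
    mul_le_mul_of_nonneg_left hbeta (by positivity)
  rw [Wide, Nat.add_sub_cancel]
  linarith

end Config

/-! ### Construction of a new layer -/

namespace Config

open Finset Classical

variable {A : Problem} {s s₀ : Config}

theorem Forest.mono {t u : ℕ} (h : s.Forest A t) (htu : t ≤ u) : s.Forest A u where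
  lay c hc := ⟨(h.lay c hc).1, (h.lay c hc).2.trans htu⟩
  aL w hw := by
    obtain ⟨h1, h2, h3, h4⟩ := h.aL w hw
    exact ⟨h1, h2, h3, h4.trans htu⟩
  blocked := h.blocked
  edge_ge := h.edge_ge
  edge_le := h.edge_le
  edge_p_le := h.edge_p_le
  last := h.last

/-- Add the hyperedge `R` at the node `x` to layer `L`. -/
noncomputable def addEdge (s : Config) (L x : ℕ) (R : Finset ℕ) : Config where
  C := s.C
  own := s.own
  lay c := if s.lay c = 0 ∧ ∃ w ∈ R, s.own w = c + 1 then L else s.lay c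
  aL w := if w ∈ R then L else s.aL w
  aN w := if w ∈ R then x else s.aN w
  top := s.top
  b0 := s.b0

/-- The situation during the construction of a new layer on top of `s₀`, when the elements below
`n` have been examined and `Z` consists of the chosen elements outside the tree and the new nodes. -/
structure Building (A : Problem) (s₀ s : Config) (Z : Finset ℕ) (n : ℕ) : Prop where
  C : s.C = s₀.C
  own : s.own = s₀.own
  top : s.top = s₀.top
  b0 : s.b0 = s₀.b0
  lay_old : ∀ c, s₀.lay c ≠ 0 → s.lay c = s₀.lay c
  lay_new : ∀ c, s₀.lay c = 0 → s.lay c = 0 ∨ s.lay c = s₀.top + 1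
  aL_old : ∀ w, s₀.aL w ≠ 0 → s.aL w = s₀.aL w ∧ s.aN w = s₀.aN w
  aL_new : ∀ w, s₀.aL w = 0 → s.aL w = 0 ∨ s.aL w = s₀.top + 1
  forest : s.Forest A (s₀.top + 1)
  indep : A.M.Indep ↑Z
  rest_subset : s₀.rest s₀.top ⊆ Z
  nodes_subset : s.nodes A (s₀.top + 1) ⊆ Z
  disjoint : Disjoint (s₀.rest s₀.top) (s.nodes A (s₀.top + 1))
  subset : 0 < A.v → Z ⊆ s₀.rest s₀.top ∪ s.nodes A (s₀.top + 1)
  nodes_lt : ∀ x ∈ s.nodes A (s₀.top + 1), x < n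
  max : ∀ i < n, i ∈ A.M.closure ↑Z ∨ ∑ w ∈ s.avail A (s₀.top + 1) i, A.cap w < A.ve

theorem Building.init (h : s.Inv A) : Building A s s (s.rest s.top) 0 := by
  have hn : s.nodes A (s.top + 1) = ∅ := by
    rw [eq_empty_iff_forall_notMem]
    intro x hx
    rw [mem_nodes] at hx
    obtain ⟨-, w, -, hw, -⟩ := hx
    have := (h.forest.aL w (by omega)).2.2.2
    omega
  exact
    { C := rfl
      own := rfl
      top := rfl
      b0 := rfl
      lay_old := fun _ _ => rfl
      lay_new := fun _ h => Or.inl h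
      aL_old := fun _ _ => ⟨rfl, rfl⟩
      aL_new := fun _ h => Or.inl h
      forest := h.forest.mono (Nat.le_succ _)
      indep := h.covering.rest_indep _
      rest_subset := Subset.rfl
      nodes_subset := by simp [hn]
      disjoint := by simp [hn]
      subset := by simp [hn]
      nodes_lt := by simp [hn]
      max := by simp }

theorem Building.skip {Z : Finset ℕ} {n : ℕ} (hA : A.Valid) (hn : n < A.m)
    (h : Building A s₀ s Z n)
    (hs : ¬ (A.ve ≤ ∑ w ∈ s.avail A (s₀.top + 1) n, A.cap w ∧ n ∉ Z ∧ A.M.Indep ↑(insert n Z))) :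
    Building A s₀ s Z (n + 1) where
  C := h.C
  own := h.own
  top := h.top
  b0 := h.b0
  lay_old := h.lay_old
  lay_new := h.lay_new
  aL_old := h.aL_old
  aL_new := h.aL_new
  forest := h.forest
  indep := h.indep
  rest_subset := h.rest_subset
  nodes_subset := h.nodes_subset
  disjoint := h.disjoint
  subset := h.subset
  nodes_lt x hx := (h.nodes_lt x hx).trans (Nat.lt_succ_self n)
  max i hi := by
    rcases Nat.lt_succ_iff_lt_or_eq.1 hi with hi | rfl
    · exact h.max i hi
    · by_cases hlt : ∑ w ∈ s.avail A (s₀.top + 1) i, A.cap w < A.ve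
      · exact Or.inr hlt
      · exact Or.inl (Matroid.mem_closure_of_not_indep_insert h.indep (hA.mem_ground.2 hn)
          fun h' => hs ⟨not_lt.1 hlt, h'⟩)

theorem Building.lay_eq {Z : Finset ℕ} {n : ℕ} (h : Building A s₀ s Z n) (c : ℕ) :
    s.lay c = s₀.lay c ∨ s₀.lay c = 0 ∧ s.lay c = s₀.top + 1 := by
  by_cases h0 : s₀.lay c = 0
  · rcases h.lay_new c h0 with h1 | h1
    · exact Or.inl (by omega)
    · exact Or.inr ⟨h0, h1⟩
  · exact Or.inl (h.lay_old c h0)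

/-- An available resource is unowned, or owned outside the tree, or owned by an element of the layer
under construction of which less than `e ^ 2 v` has been touched. In the last case the new hyperedge
may touch arbitrarily much, but the earlier ones together have touched little. This gives
`Forest.last` with the new node as the exception. -/
theorem Building.add {Z : Finset ℕ} {n : ℕ} {R : Finset ℕ} (hA : A.Valid) (hC : s₀.Covering A)
    (hn : n < A.m) (h : Building A s₀ s Z n) (hnZ : n ∉ Z) (hind : A.M.Indep ↑(insert n Z))
    (hR : R ⊆ s.avail A (s₀.top + 1) n) (hge : A.ve ≤ ∑ w ∈ R, A.cap w)
    (hle : ∑ w ∈ R, A.cap w ≤ 2 * A.ve) (hp : ∑ w ∈ R, A.p w ≤ A.ve + A.pm) :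
    Building A s₀ (s.addEdge (s₀.top + 1) n R) (insert n Z) (n + 1) := by
  set L := s₀.top + 1 with hL
  set s' := s.addEdge L n R with hs'
  have hRk : ∀ w ∈ R, w < A.k ∧ A.adj n w ∧ ¬ s.Used A L w := fun w hw => mem_avail.1 (hR hw)
  have hR0 : ∀ w ∈ R, s.aL w = 0 := fun w hw => by
    by_contra h0
    exact (hRk w hw).2.2 (Or.inl h0)
  have aLR : ∀ w ∈ R, s'.aL w = L ∧ s'.aN w = n := fun w hw => by simp [hs', addEdge, hw]
  have aLn : ∀ w ∉ R, s'.aL w = s.aL w ∧ s'.aN w = s.aN w := fun w hw => by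
    simp [hs', addEdge, hw]
  have hlay : ∀ c, s'.lay c = if s.lay c = 0 ∧ ∃ w ∈ R, s.own w = c + 1 then L else s.lay c :=
    fun c => rfl
  have lay_ne : ∀ c, s.lay c ≠ 0 → s'.lay c = s.lay c := fun c hc => by
    rw [hlay, if_neg (fun h' => hc h'.1)]
  have hown : s'.own = s.own := rfl
  have hRlay : ∀ w ∈ R, ∀ c, s.own w = c + 1 → s'.lay c = L ∧
      (s.lay c = 0 ∨ (s.lay c = L ∧ s.touch A c < A.e ^ 2 * A.v)) := by
    intro w hw c hc
    by_cases h0 : s.lay c = 0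
    · exact ⟨by rw [hlay, if_pos ⟨h0, w, hw, hc⟩], Or.inl h0⟩
    · have h1 : s.lay c = L := by
        by_contra h1
        exact (hRk w hw).2.2 (Or.inr ⟨c, hc, h0, Or.inl h1⟩)
      refine ⟨by rw [lay_ne c h0, h1], Or.inr ⟨h1, ?_⟩⟩
      by_contra h2
      exact (hRk w hw).2.2 (Or.inr ⟨c, hc, h0, Or.inr (not_lt.1 h2)⟩)
  have hheld : ∀ c, s'.held A c = s.held A c := fun c => rfl
  have nodes_new : ∀ x ∈ s'.nodes A L, x = n ∨ x ∈ s.nodes A L := by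
    intro x hx
    rw [mem_nodes] at hx
    obtain ⟨hxm, w, hwk, hw, hx⟩ := hx
    by_cases hwR : w ∈ R
    · left; rw [← hx, (aLR w hwR).2]
    · right
      rw [(aLn w hwR).1] at hw
      rw [(aLn w hwR).2] at hx
      exact mem_nodes.2 ⟨hxm, w, hwk, hw, hx⟩
  have hnn : n ∉ s.nodes A L := fun h' => lt_irrefl _ (h.nodes_lt n h')
  have edge_n : s'.edge A L n = R := by
    ext w
    rw [mem_edge]
    by_cases hwR : w ∈ R
    · simp [hwR, aLR w hwR, (hRk w hwR).1]
    · simp only [hwR, aLn w hwR, iff_false]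
      rintro ⟨h1, h2, h3⟩
      exact hnn (mem_nodes.2 ⟨hn, w, h1, h2, h3⟩)
  have edge_ne : ∀ j x, j ≠ 0 → (j ≠ L ∨ x ≠ n) → s'.edge A j x = s.edge A j x := by
    intro j x hj hjx
    ext w
    rw [mem_edge, mem_edge]
    by_cases hwR : w ∈ R
    · rw [(aLR w hwR).1, (aLR w hwR).2, hR0 w hwR]
      constructor
      · rintro ⟨-, rfl, rfl⟩
        simp at hjx
      · rintro ⟨-, rfl, -⟩
        exact absurd rfl hj
    · rw [(aLn w hwR).1, (aLn w hwR).2]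
  have hedge : ∀ j x, j ≠ 0 → (s'.edge A j x = s.edge A j x ∨ (j = L ∧ x = n)) := by
    intro j x hj
    by_cases hjx : j = L ∧ x = n
    · exact Or.inr hjx
    · exact Or.inl (edge_ne j x hj (by tauto))
  -- Touched values only grow, so what is unavailable stays unavailable. Elements that had too
  -- little to form a hyperedge need not be examined again.
  have used_mono : ∀ w, s.Used A L w → s'.Used A L w := by
    rintro w (hw | ⟨c, hc, h0, h1⟩)
    · left
      by_cases hwR : w ∈ R
      · rw [(aLR w hwR).1]; omega
      · rwa [(aLn w hwR).1]
    · right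
      refine ⟨c, hc, by rwa [lay_ne c h0], ?_⟩
      rw [lay_ne c h0]
      refine h1.imp_right fun h1 => h1.trans ?_
      refine sum_le_sum_of_subset_of_nonneg ?_ fun w _ _ => hA.cap_nonneg w
      intro u hu
      rw [mem_filter] at hu ⊢
      refine ⟨hu.1, ?_⟩
      by_cases huR : u ∈ R
      · rw [(aLR u huR).1]; omega
      · rw [(aLn u huR).1]; exact hu.2
  have hF := h.forest
  refine
    { C := h.C
      own := h.own
      top := h.top
      b0 := h.b0
      lay_old := fun c hc => by
        rw [lay_ne c (by rw [h.lay_old c hc]; exact hc), h.lay_old c hc]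
      lay_new := fun c hc => by
        rw [hlay]
        split_ifs
        · exact Or.inr rfl
        · exact h.lay_new c hc
      aL_old := fun w hw => by
        have hwR : w ∉ R := fun hwR => by
          have := (h.aL_old w hw).1
          rw [hR0 w hwR] at this
          exact hw this.symm
        rw [(aLn w hwR).1, (aLn w hwR).2]
        exact h.aL_old w hw
      aL_new := fun w hw => by
        by_cases hwR : w ∈ R
        · exact Or.inr (aLR w hwR).1
        · rw [(aLn w hwR).1]
          exact h.aL_new w hw
      forest := ?_
      indep := hind
      rest_subset := h.rest_subset.trans (subset_insert _ _)
      nodes_subset := fun x hx => by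
        rw [mem_insert]
        exact (nodes_new x hx).imp_right fun h' => h.nodes_subset h'
      disjoint := by
        rw [disjoint_left]
        intro x hx hx'
        rcases nodes_new x hx' with rfl | h'
        · exact hnZ (h.rest_subset hx)
        · exact disjoint_left.1 h.disjoint hx h'
      -- Nodes are visible only through the resources of their hyperedges, and only for `v > 0` is
      -- `R` sure to be nonempty.
      subset := fun hv => by
        have hne : R.Nonempty := by
          rw [nonempty_iff_ne_empty]
          rintro rfl
          rw [sum_empty] at hge
          have := hA.v_le_ve
          linarith
        intro x hx
        rw [mem_insert] at hx
        rw [mem_union]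
        obtain ⟨w, hw⟩ := hne
        rcases hx with rfl | hx
        · exact Or.inr (mem_nodes.2 ⟨hn, w, (hRk w hw).1, aLR w hw⟩)
        · have := h.subset hv hx
          rw [mem_union] at this
          refine this.imp_right fun h' => ?_
          rw [mem_nodes] at h' ⊢
          obtain ⟨h1, u, h2, h3⟩ := h'
          have huR : u ∉ R := fun huR => by have := hR0 u huR; omega
          exact ⟨h1, u, h2, by rw [(aLn u huR).1, (aLn u huR).2]; exact h3⟩
      nodes_lt := fun x hx => by
        rcases nodes_new x hx with rfl | h'
        · exact Nat.lt_succ_self _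
        · exact (h.nodes_lt x h').trans (Nat.lt_succ_self n)
      max := fun i hi => by
        rcases Nat.lt_succ_iff_lt_or_eq.1 hi with hi | rfl
        · refine (h.max i hi).imp (fun h' => ?_) fun h' => ?_
          · exact A.M.closure_subset_closure (by simp) h'
          · refine lt_of_le_of_lt (sum_le_sum_of_subset_of_nonneg ?_
              fun w _ _ => hA.cap_nonneg w) h'
            intro w hw
            rw [mem_avail] at hw ⊢
            exact ⟨hw.1, hw.2.1, fun h' => hw.2.2 (used_mono w h')⟩
        · left
          exact A.M.mem_closure_of_mem' (by simp) (hA.mem_ground.2 hn) }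
  exact
    { lay := fun c hc => by
        by_cases h0 : s.lay c = 0
        · rw [hlay] at hc ⊢
          split_ifs at hc ⊢ with hif
          · obtain ⟨-, w, hw, ho⟩ := hif
            refine ⟨?_, le_rfl⟩
            rw [h.own] at ho
            change c ∈ s.C
            rw [h.C]
            exact (hC.own w c ho).2.1
          · exact absurd h0 hc
        · rw [lay_ne c h0]
          exact hF.lay c h0
      aL := fun w hw => by
        by_cases hwR : w ∈ R
        · rw [(aLR w hwR).1, (aLR w hwR).2]
          exact ⟨(hRk w hwR).1, hn, (hRk w hwR).2.1, le_rfl⟩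
        · rw [(aLn w hwR).1] at hw ⊢
          rw [(aLn w hwR).2]
          exact hF.aL w hw
      blocked := fun w c hw hc => by
        by_cases hwR : w ∈ R
        · rw [(aLR w hwR).1]
          exact (hRlay w hwR c hc).1
        · rw [(aLn w hwR).1] at hw ⊢
          have h1 := hF.blocked w c hw hc
          rw [lay_ne c (by omega), h1]
      edge_ge := fun j x hj hx => by
        rcases hedge j x hj with he | ⟨rfl, rfl⟩
        · rw [he]
          refine hF.edge_ge j x hj ?_
          rw [mem_nodes] at hx ⊢
          obtain ⟨h1, u, h2, h3⟩ := hx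
          have : u ∈ s'.edge A j x := mem_edge.2 ⟨h2, h3⟩
          rw [he, mem_edge] at this
          exact ⟨h1, u, this⟩
        · rw [edge_n]; exact hge
      edge_le := fun j x => by
        rcases hedge (j + 1) x (by omega) with he | ⟨he, rfl⟩
        · rw [he]; exact hF.edge_le j x
        · rw [he, edge_n]; exact hle
      edge_p_le := fun j x => by
        rcases hedge (j + 1) x (by omega) with he | ⟨he, rfl⟩
        · rw [he]; exact hF.edge_p_le j x
        · rw [he, edge_n]; exact hp
      last := fun c hc => by
        -- If the new hyperedge takes a resource of `c`, then what the other nodes of the layer take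
        -- from `c` was touched before; otherwise nothing changes for `c`.
        by_cases hRc : ∃ w ∈ R, s.own w = c + 1
        · obtain ⟨w, hw, ho⟩ := hRc
          obtain ⟨h1, h2⟩ := hRlay w hw c ho
          refine ⟨n, ?_⟩
          rw [h1, hheld]
          have hsub : {w ∈ s.held A c | s'.aL w = L ∧ s'.aN w ≠ n} ⊆
              {w ∈ s.held A c | s.aL w ≠ 0} := by
            intro u hu
            rw [mem_filter] at hu ⊢
            have huR : u ∉ R := fun huR => hu.2.2 (aLR u huR).2
            rw [(aLn u huR).1] at hu
            exact ⟨hu.1, by omega⟩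
          refine (sum_le_sum_of_subset_of_nonneg hsub fun w _ _ => hA.cap_nonneg w).trans ?_
          rcases h2 with h2 | ⟨-, h2⟩
          · have : {w ∈ s.held A c | s.aL w ≠ 0} = ∅ := by
              rw [filter_eq_empty_iff]
              intro u hu h'
              have := hF.blocked u c h' (mem_held.1 hu).2
              omega
            rw [this, sum_empty]
            exact mul_nonneg (sq_nonneg _) Problem.v_nonneg
          · exact h2.le
        · have h0 : s'.lay c = s.lay c := by
            rw [hlay, if_neg (fun h' => hRc h'.2)]
          rw [h0] at hc ⊢
          obtain ⟨x, hx⟩ := hF.last c hc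
          refine ⟨x, ?_⟩
          convert hx using 2
          rw [hheld]
          refine filter_congr fun u hu => ?_
          have huR : u ∉ R := fun huR => hRc ⟨u, huR, (mem_held.1 hu).2⟩
          rw [(aLn u huR).1, (aLn u huR).2] }

end Config

/-! ### The invariant after growth, and its restoration by keeping or collapsing -/

namespace Config

open Finset Classical

variable {A : Problem} {s s₀ : Config}

variable (A s) in
/-- The invariant after the construction of a new layer. -/
structure Grown : Prop where
  pos : 1 ≤ s.top
  covering : s.Covering A
  forest : s.Forest A s.top
  spread : ∀ j, 1 ≤ j → j ≤ s.top → s.Spread A j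
  recorded : ∀ j, 1 ≤ j → j ≤ s.top → s.Recorded A j
  wide : ∀ j, 1 ≤ j → j < s.top → s.Wide A j
  wide_top : 0 < A.v → (∀ j, 1 ≤ j → j ≤ s.top → s.Calm A j) → s.Wide A s.top
  large : ∀ j, 1 ≤ j → j + 1 < s.top → s.Large A j
  augmentable : ∃ x < A.m, x ∉ s.C ∧ A.M.Indep ↑(insert x s.C)

variable (A s) in
/-- Declare the layer under construction complete. -/
noncomputable def finish : Config :=
  { s with
    top := s.top + 1
    b0 := Function.update s.b0 (s.top + 1) (s.layer A (s.top + 1)).card }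

theorem beta_congr {s s' : Config} {i : ℕ} (h : ∀ j, 1 ≤ j → j ≤ i → s'.b0 j = s.b0 j) :
    s'.beta i = s.beta i := by
  rw [beta, beta]
  congr 1
  exact sum_congr rfl fun j hj => h j (mem_Icc.1 hj).1 (mem_Icc.1 hj).2

/-- The new layer carries numbers that did not occur before, so all statements about the older
layers carry over. The width of the new layer is claimed only under the condition that no layer
admits a collapse, because the search for a collapse takes place after the growth. -/
theorem Building.grown (hA : A.Valid) {x : ℕ → ℝ} {y : ℕ → ℕ → ℝ} (hxy : A.Fractional x y)
    (h₀ : s₀.Inv A) {Z : Finset ℕ} {n : ℕ} (hn : A.m ≤ n) (h : Building A s₀ s Z n)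
    (haug : ∃ x < A.m, x ∉ s₀.C ∧ A.M.Indep ↑(insert x s₀.C)) :
    (s.finish A).Grown A ∧ (s.finish A).C = s₀.C ∧ (s.finish A).top = s₀.top + 1 ∧
      ∀ j ≤ s₀.top, (s.finish A).b0 j = s₀.b0 j := by
  set s₁ := s.finish A with hs₁
  have htop : s₁.top = s₀.top + 1 := by rw [← h.top]; rfl
  have hb0 : ∀ j ≤ s₀.top, s₁.b0 j = s₀.b0 j := by
    intro j hj
    rw [← h.b0]
    exact Function.update_of_ne (by rw [h.top]; omega) _ _
  have hlayer : ∀ j, 1 ≤ j → j ≤ s₀.top → s₁.layer A j = s₀.layer A j := by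
    intro j h1 h2
    ext c
    rw [mem_layer, mem_layer]
    have := h.lay_eq c
    change _ ∧ s.lay c = j ↔ _
    omega
  have hnodes : ∀ j, 1 ≤ j → j ≤ s₀.top → s₁.nodes A j = s₀.nodes A j := by
    intro j h1 h2
    ext c
    rw [mem_nodes, mem_nodes]
    refine and_congr_right fun _ => exists_congr fun w => and_congr_right fun _ => ?_
    change s.aL w = j ∧ s.aN w = c ↔ _
    by_cases h0 : s₀.aL w = 0
    · have := h.aL_new w h0
      omega
    · rw [(h.aL_old w h0).1, (h.aL_old w h0).2]
  have hrest : ∀ j ≤ s₀.top, s₁.rest j = s₀.rest j := by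
    intro j h2
    ext c
    rw [mem_rest, mem_rest]
    change c ∈ s.C ∧ (s.lay c = 0 ∨ j < s.lay c) ↔ _
    rw [h.C]
    have := h.lay_eq c
    refine and_congr_right fun _ => ?_
    omega
  have hC : s₁.Covering A := by
    have hc := h₀.covering
    have e1 : s₁.C = s₀.C := h.C
    have e2 : s₁.own = s₀.own := h.own
    have e3 : ∀ c, s₁.held A c = s₀.held A c := fun c => by
      ext w; rw [mem_held, mem_held, e2]
    exact ⟨by rw [e1]; exact hc.indep, by rw [e1, e2]; exact hc.own,
      by simp only [e1, e3]; exact hc.ge, by simp only [e1, e3]; exact hc.le⟩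
  have hF : s₁.Forest A s₁.top := by
    rw [htop]
    exact ⟨h.forest.lay, h.forest.aL, h.forest.blocked, h.forest.edge_ge, h.forest.edge_le,
      h.forest.edge_p_le, h.forest.last⟩
  have hrec : ∀ j, 1 ≤ j → j ≤ s₀.top → s₁.Recorded A j := by
    intro j h1 h2
    rw [Recorded, hlayer j h1 h2, hb0 j h2]
    exact h₀.recorded j h1 h2
  have hspr : ∀ j, 1 ≤ j → j ≤ s₀.top → s₁.Spread A j := by
    intro j h1 h2
    have := h₀.spread j h1 h2
    rw [Spread] at this ⊢
    rw [hnodes j h1 h2, hrest (j - 1) (by omega)]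
    have e1 : ∑ i ∈ Icc 1 (j - 1), s₁.b0 i = ∑ i ∈ Icc 1 (j - 1), s₀.b0 i :=
      sum_congr rfl fun i hi => hb0 i (by rw [mem_Icc] at hi; omega)
    have e2 : ∑ i ∈ Icc 1 (j - 1), (s₁.layer A i).card =
        ∑ i ∈ Icc 1 (j - 1), (s₀.layer A i).card :=
      sum_congr rfl fun i hi => by
        rw [mem_Icc] at hi
        rw [hlayer i hi.1 (by omega)]
    rw [e1, e2]
    exact this
  have hbeta : ∀ j ≤ s₀.top, s₁.beta j = s₀.beta j := fun j hj =>
    beta_congr fun i _ hi => hb0 i (by omega)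
  have hwide : ∀ j, 1 ≤ j → j ≤ s₀.top → s₁.Wide A j := by
    intro j h1 h2
    rw [Wide, hnodes j h1 h2, hbeta _ (by omega)]
    exact h₀.wide j h1 h2
  have hrest_top := hrest s₀.top le_rfl
  have hindep : A.M.Indep ↑(s₁.rest s₀.top ∪ s₁.nodes A (s₀.top + 1)) := by
    rw [hrest_top]
    refine h.indep.subset ?_
    exact_mod_cast union_subset h.rest_subset h.nodes_subset
  have hdisj : Disjoint (s₁.rest s₀.top) (s₁.nodes A (s₀.top + 1)) := by
    rw [hrest_top]
    exact h.disjoint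
  refine ⟨?_, h.C, htop, hb0⟩
  exact
    { pos := by omega
      covering := hC
      forest := hF
      spread := fun j h1 h2 => by
        rcases Nat.lt_or_ge s₀.top j with hj | hj
        · obtain rfl : j = s₀.top + 1 := by omega
          -- All new nodes are independent over `rest`; no loss has to be charged to the recorded
          -- sizes.
          refine ⟨_, Subset.rfl, hdisj, hindep, Nat.add_le_add_left ?_ _⟩
          rw [Nat.add_sub_cancel]
          refine sum_le_sum fun i hi => ?_
          rw [mem_Icc] at hi
          exact (hrec i hi.1 hi.2).1
        · exact hspr j h1 hj
      recorded := fun j h1 h2 => by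
        rcases Nat.lt_or_ge s₀.top j with hj | hj
        · obtain rfl : j = s₁.top := by omega
          have : s₁.b0 s₁.top = (s₁.layer A s₁.top).card := Function.update_self ..
          rw [Recorded, this]
          exact ⟨le_rfl, by
            rw [sub_self]
            exact mul_nonneg (mu_pos hA).le (Nat.cast_nonneg _)⟩
        · exact hrec j h1 hj
      wide := fun j h1 h2 => hwide j h1 (by omega)
      wide_top := fun hv hc => by
        rw [htop] at hc ⊢
        refine wide_of_calm hA hv hxy hC (htop ▸ hF) hspr hrec hwide
          (fun j h1 h2 => hc j h1 (by omega)) hdisj hindep ?_ ?_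
        · intro i hi hcl
          refine (h.max i (by omega)).resolve_left fun h' => hcl ?_
          refine A.M.closure_subset_closure ?_ h'
          rw [hrest_top]
          exact_mod_cast h.subset hv
        · obtain ⟨x, -, hx, hi⟩ := haug
          refine ⟨_, hi, ?_⟩
          rw [card_insert_of_notMem hx, ← h.C]
          rfl
      large := fun j h1 h2 => by
        rw [Large, hbeta _ (by omega), hb0 j (by omega)]
        exact h₀.large j h1 (by omega)
      augmentable := by
        have e1 : s₁.C = s₀.C := h.C
        rw [e1]
        exact haug }

/-- If no layer has many addable hyperedges, then the tree is kept. -/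
theorem Grown.inv (hA : A.Valid) (h : s.Grown A) (hv : 0 < A.v)
    (hc : ∀ j, 1 ≤ j → j ≤ s.top → s.Calm A j) : s.Inv A where
  covering := h.covering
  forest := h.forest
  spread := h.spread
  recorded := h.recorded
  wide j h1 h2 := by
    rcases Nat.lt_or_ge j s.top with hj | hj
    · exact h.wide j h1 hj
    · obtain rfl : j = s.top := by omega
      exact h.wide_top hv hc
  -- The layer that was the last one before the growth may have been small, since a collapse can
  -- shrink it. It is large now because it admits no collapse.
  large j h1 h2 := by
    have := large_of_calm hA hv h.covering h.forest (by omega) (h.spread j h1 h2.le)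
      (fun i h3 h4 => h.recorded i h3 (by omega)) (hc j h1 h2.le) (h.wide j h1 h2)
    exact this.trans (by exact_mod_cast (h.recorded j h1 h2.le).1)

/-- For `v = 0` every element is addable, even without resources, and a single element that augments
`C` already suffices for a collapse in layer `1`, as `beta 0 = 1` and `mu < 1`. -/
theorem Grown.v_pos (hA : A.Valid) (h : s.Grown A)
    (hc : s.Calm A 1) : 0 < A.v := by
  by_contra hv
  obtain ⟨x, hxm, hxC, hi⟩ := h.augmentable
  have hr : s.rest (1 - 1) = s.C := by
    ext c
    rw [mem_rest]
    constructor
    · exact fun h' => h'.1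
    · exact fun h' => ⟨h', by omega⟩
  have h1 := hc {x} (by
    rw [singleton_subset_iff, mem_addable]
    exact ⟨hxm, (not_lt.1 hv).trans (sum_nonneg fun w _ => hA.cap_nonneg w)⟩)
    (by rw [hr]; simpa using hxC)
    (by rw [hr, union_comm, ← insert_eq]; exact hi)
  have h2 : s.beta (1 - 1) = 1 := by simp [beta]
  rw [h2, card_singleton] at h1
  have := mu_le hA
  norm_num at h1
  linarith

/-! #### Collapse -/

variable (A s) in
/-- The blocking elements in the first layers that give up their resources when the elements of `G`
are chosen, so that the set of chosen elements becomes `Z`. -/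
def Hit (Z G : Finset ℕ) (i c : ℕ) : Prop := 1 ≤ s.lay c ∧ s.lay c < i ∧ (c ∉ Z ∨ c ∈ G)

variable (A s) in
/-- The blocking elements in layer `j` that stay. -/
noncomputable def kept (Z G : Finset ℕ) (j : ℕ) : Finset ℕ :=
  {c ∈ s.layer A j | c ∈ Z ∧ c ∉ G}

theorem mem_kept {Z G : Finset ℕ} {j c : ℕ} :
    c ∈ s.kept A Z G j ↔ (c < A.m ∧ s.lay c = j) ∧ c ∈ Z ∧ c ∉ G := by
  rw [kept, mem_filter, mem_layer]

variable (A s) in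
/-- The elements of `G` are nodes of addable hyperedges in layer `i`, and `Z` arises from the chosen
elements outside the first `i - 1` layers together with `G` by adding elements of these layers as
long as possible, beginning with the last layer. -/
structure Exchange (Z G : Finset ℕ) (i : ℕ) : Prop where
  pos : 1 ≤ i
  le_top : i ≤ s.top
  addable : G ⊆ s.addable A i
  disjoint : Disjoint (s.rest (i - 1)) G
  card_ge : A.mu * s.beta (i - 1) ≤ G.card
  indep : A.M.Indep ↑Z
  rest_subset : s.rest (i - 1) ⊆ Z
  G_subset : G ⊆ Z
  subset : Z ⊆ s.C ∪ G
  closure : ∀ c, 1 ≤ s.lay c → s.lay c < i → c ∉ Z →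
    c ∈ A.M.closure ↑({z ∈ Z | z ∈ G ∨ z ∈ s.rest (s.lay c - 1)} : Finset ℕ)

/-- The configuration after an exchange in which the first `j` layers are retained; the elements
`x` of `G` receive the resources in `R x`. -/
noncomputable def collapse (A : Problem) (s : Config) (Z G : Finset ℕ) (R : ℕ → Finset ℕ)
    (i j : ℕ) : Config where
  C := Z
  own w := if s.own w ≠ 0 then (if s.Hit Z G i (s.own w - 1) then 0 else s.own w)
    else if s.aN w ∈ G ∧ w ∈ R (s.aN w) then s.aN w + 1 else 0
  lay c := if s.Hit Z G i c ∨ j < s.lay c then 0 else s.lay c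
  aL w := if j < s.aL w then 0 else s.aL w
  aN := s.aN
  top := j
  b0 := if j = 0 then s.b0 else Function.update s.b0 j (s.kept A Z G j).card

theorem Exchange.mem_of_not_hit {Z G : Finset ℕ} {i c : ℕ} (hE : s.Exchange A Z G i) (hc : c ∈ s.C)
    (h : ¬ s.Hit Z G i c) : c ∈ Z := by
  by_cases hl : s.lay c = 0 ∨ i ≤ s.lay c
  · exact hE.rest_subset (mem_rest.2 ⟨hc, by omega⟩)
  · by_contra hcZ
    exact h ⟨by omega, by omega, Or.inl hcZ⟩

theorem Exchange.hit_of_mem {Z G : Finset ℕ} {i c : ℕ} (hE : s.Exchange A Z G i) (hc : c ∈ s.C)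
    (h : c ∈ G) : s.Hit Z G i c := by
  have : c ∉ s.rest (i - 1) := fun h' => disjoint_left.1 hE.disjoint h' h
  rw [mem_rest] at this
  have hp := hE.pos
  have h2 : ¬(s.lay c = 0 ∨ i - 1 < s.lay c) := fun h' => this ⟨hc, h'⟩
  exact ⟨by omega, by omega, Or.inr h⟩

/-- An element of `G` that is already chosen belongs to a lower layer. It is hit and surrenders its
resources before it receives `R x`, so its total size remains at most `v + pm`. -/
theorem Exchange.collapse_covering {Z G : Finset ℕ} {R : ℕ → Finset ℕ} {i j : ℕ}
    (hE : s.Exchange A Z G i) (hC : s.Covering A) (hF : s.Forest A s.top)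
    (hR : ∀ x ∈ G, R x ⊆ s.freePart A i x ∧ A.v ≤ ∑ w ∈ R x, A.cap w ∧
      ∑ w ∈ R x, A.p w ≤ A.v + A.pm) : (s.collapse A Z G R i j).Covering A := by
  set s' := s.collapse A Z G R i j with hs'
  have hown : ∀ w, s'.own w = if s.own w ≠ 0 then
      (if s.Hit Z G i (s.own w - 1) then 0 else s.own w)
      else if s.aN w ∈ G ∧ w ∈ R (s.aN w) then s.aN w + 1 else 0 := fun w => rfl
  -- The two ways to own a resource exclude each other, since `R x` consists of unowned resources of
  -- the hyperedge at `x`.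
  have key : ∀ w c, s'.own w = c + 1 ↔
      (s.own w = c + 1 ∧ ¬ s.Hit Z G i c) ∨ (c ∈ G ∧ w ∈ R c) := by
    intro w c
    rw [hown]
    have hfree : ∀ x ∈ G, w ∈ R x → s.own w = 0 ∧ s.aN w = x := fun x hx hw => by
      have := mem_freePart.1 ((hR x hx).1 hw)
      exact ⟨this.2, this.1.2.2⟩
    split_ifs with h1 h2 h3
    · constructor
      · intro h; exact h.elim
      · rintro (⟨h4, h5⟩ | ⟨h4, h5⟩)
        · rw [h4, Nat.add_sub_cancel] at h2
          exact absurd h2 h5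
        · exact absurd (hfree c h4 h5).1 h1
    · constructor
      · intro h
        rw [h, Nat.add_sub_cancel] at h2
        exact Or.inl ⟨h, h2⟩
      · rintro (⟨h4, h5⟩ | ⟨h4, h5⟩)
        · exact h4
        · exact absurd (hfree c h4 h5).1 h1
    · constructor
      · intro h
        obtain rfl : s.aN w = c := by omega
        exact Or.inr h3
      · rintro (⟨h4, h5⟩ | ⟨h4, h5⟩)
        · omega
        · rw [(hfree c h4 h5).2]
    · constructor
      · intro h; exact h.elim
      · rintro (⟨h4, h5⟩ | ⟨h4, h5⟩)
        · omega
        · exact absurd ⟨(hfree c h4 h5).2 ▸ h4, (hfree c h4 h5).2 ▸ h5⟩ h3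
  have hheld : ∀ c ∈ Z, (c ∈ s.C ∧ c ∉ G ∧ s'.held A c = s.held A c) ∨
      (c ∈ G ∧ s'.held A c = R c) := by
    intro c hc
    by_cases hcG : c ∈ G
    · right
      refine ⟨hcG, ?_⟩
      ext w
      rw [mem_held, key]
      constructor
      · rintro ⟨-, (⟨h1, h2⟩ | ⟨-, h⟩)⟩
        · exact absurd (hE.hit_of_mem (hC.own w c h1).2.1 hcG) h2
        · exact h
      · intro h
        exact ⟨(mem_freePart.1 ((hR c hcG).1 h)).1.1, Or.inr ⟨hcG, h⟩⟩
    · left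
      have hcC : c ∈ s.C := by
        have := hE.subset hc
        rw [mem_union] at this
        tauto
      refine ⟨hcC, hcG, ?_⟩
      ext w
      rw [mem_held, mem_held, key]
      have : ¬ s.Hit Z G i c := fun h => by
        rcases h.2.2 with h | h
        · exact h hc
        · exact hcG h
      tauto
  refine ⟨hE.indep, ?_, ?_, ?_⟩
  · intro w c hw
    rcases (key w c).1 hw with ⟨h1, h2⟩ | ⟨h1, h2⟩
    · obtain ⟨h3, h4, h5⟩ := hC.own w c h1
      exact ⟨h3, hE.mem_of_not_hit h4 h2, h5⟩
    · have := mem_freePart.1 ((hR c h1).1 h2)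
      have hp := hE.pos
      have h3 := hF.aL w (by omega)
      exact ⟨h3.1, hE.G_subset h1, this.1.2.2 ▸ h3.2.2.1⟩
  · intro c hc
    rcases hheld c hc with ⟨h1, -, h2⟩ | ⟨h1, h2⟩
    · rw [h2]; exact hC.ge c h1
    · rw [h2]; exact (hR c h1).2.1
  · intro c hc
    rcases hheld c hc with ⟨h1, -, h2⟩ | ⟨h1, h2⟩
    · rw [h2]; exact hC.le c h1
    · rw [h2]; exact (hR c h1).2.2

/-- The new chosen set spans the old one: what is not kept lies in the closure of a part of `Z`. -/
theorem Exchange.card_le {Z G : Finset ℕ} {i : ℕ} (hE : s.Exchange A Z G i)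
    (hC : s.Covering A) : s.C.card ≤ Z.card := by
  refine hC.indep.card_le_of_subset_closure fun c hc => ?_
  by_cases hcZ : c ∈ Z
  · exact A.M.mem_closure_of_mem' (by exact_mod_cast hcZ) (hC.indep.subset_ground hc)
  · have : ¬ (s.lay c = 0 ∨ i ≤ s.lay c) := fun h =>
      hcZ (hE.rest_subset (mem_rest.2 ⟨by exact_mod_cast hc, by have := hE.pos; omega⟩))
    exact A.M.closure_subset_closure (by exact_mod_cast filter_subset _ _)
      (hE.closure c (by omega) (by omega) hcZ)

/-- An exchange that does not increase the number of chosen elements hits some layer hard. -/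
theorem Exchange.exists_layer (hA : A.Valid) {Z G : Finset ℕ} {i : ℕ} (hE : s.Exchange A Z G i)
    (hG : s.Grown A) (hZ : Z.card ≤ s.C.card) :
    ∃ j, 1 ≤ j ∧ j < i ∧ A.mu * s.b0 j < s.b0 j - (s.kept A Z G j).card := by
  by_contra hno
  have hp := hE.pos
  have hle := hE.le_top
  have h1 : ∀ j ∈ Icc 1 (i - 1), (s.b0 j : ℝ) - (s.kept A Z G j).card ≤ A.mu * s.b0 j := by
    intro j hj
    rw [mem_Icc] at hj
    by_contra h
    exact hno ⟨j, hj.1, by omega, not_le.1 h⟩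
  have h2 := sum_le_sum h1
  rw [sum_sub_distrib, ← mul_sum] at h2
  have h3 : (s.rest (i - 1)).card + G.card + ∑ j ∈ Icc 1 (i - 1), (s.kept A Z G j).card ≤
      Z.card := by
    have e1 : ((Icc 1 (i - 1)).biUnion (s.kept A Z G)).card =
        ∑ j ∈ Icc 1 (i - 1), (s.kept A Z G j).card := by
      refine card_biUnion ?_
      intro a _ b _ hab
      rw [Function.onFun, disjoint_left]
      intro c hc hc'
      rw [mem_kept] at hc hc'
      omega
    rw [← e1, ← card_union_of_disjoint hE.disjoint, ← card_union_of_disjoint]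
    · refine card_le_card (union_subset (union_subset hE.rest_subset hE.G_subset) ?_)
      intro c hc
      rw [mem_biUnion] at hc
      obtain ⟨j, -, hc⟩ := hc
      exact (mem_kept.1 hc).2.1
    · rw [disjoint_left]
      intro c hc hc'
      rw [mem_biUnion] at hc'
      obtain ⟨j, hj, hc'⟩ := hc'
      rw [mem_kept] at hc'
      rw [mem_Icc] at hj
      rw [mem_union, mem_rest] at hc
      rcases hc with hc | hc
      · omega
      · exact hc'.2.2 hc
  have h4 := card_rest_add hA hG.covering hG.forest (i - 1)
  have h5 : ∑ j ∈ Icc 1 (i - 1), (s.layer A j).card ≤ ∑ j ∈ Icc 1 (i - 1), s.b0 j :=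
    sum_le_sum fun j hj => (hG.recorded j (mem_Icc.1 hj).1 (by have := mem_Icc.1 hj; omega)).1
  have h6 : (G.card : ℝ) + ∑ j ∈ Icc 1 (i - 1), ((s.kept A Z G j).card : ℝ) ≤
      ∑ j ∈ Icc 1 (i - 1), (s.b0 j : ℝ) := by
    exact_mod_cast (by omega :
      G.card + ∑ j ∈ Icc 1 (i - 1), (s.kept A Z G j).card ≤ ∑ j ∈ Icc 1 (i - 1), s.b0 j)
  have h7 := hE.card_ge
  have h8 : (s.beta (i - 1) : ℝ) = 1 + ∑ j ∈ Icc 1 (i - 1), (s.b0 j : ℝ) := by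
    rw [beta]; push_cast; rfl
  -- The root, counted as `1` in `beta`, makes the inequality strict: `G` exceeds the total of the
  -- tolerated losses by at least `mu`, so `Z` would be larger than `C`.
  rw [h8] at h7
  have := mu_pos hA
  linarith

/-- The tree is discarded entirely, and only the chosen elements and their resources are left to
check. -/
theorem Exchange.collapse_inv_zero (hA : A.Valid) {Z G : Finset ℕ} {R : ℕ → Finset ℕ} {i : ℕ}
    (hE : s.Exchange A Z G i) (hC : s.Covering A) (hF : s.Forest A s.top)
    (hR : ∀ x ∈ G, R x ⊆ s.freePart A i x ∧ A.v ≤ ∑ w ∈ R x, A.cap w ∧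
      ∑ w ∈ R x, A.p w ≤ A.v + A.pm) : (s.collapse A Z G R i 0).Inv A := by
  set s' := s.collapse A Z G R i 0 with hs'
  have h1 : ∀ c, s'.lay c = 0 := fun c => by
    change (if s.Hit Z G i c ∨ 0 < s.lay c then 0 else s.lay c) = 0
    split_ifs with h
    · rfl
    · omega
  have h2 : ∀ w, s'.aL w = 0 := fun c => by
    change (if 0 < s.aL c then 0 else s.aL c) = 0
    split_ifs with h
    · rfl
    · omega
  have h3 : s'.top = 0 := rfl
  have h4 : ∀ j x, s'.edge A (j + 1) x = ∅ := fun j x => by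
    rw [eq_empty_iff_forall_notMem]
    intro w hw
    rw [mem_edge, h2] at hw
    omega
  have hve := hA.ve_nonneg
  have hpm := hA.pm_nonneg
  refine ⟨hE.collapse_covering hC hF hR, ?_, ?_, ?_, ?_, ?_⟩
  · exact
      { lay := fun c hc => absurd (h1 c) hc
        aL := fun w hw => absurd (h2 w) hw
        blocked := fun w c hw => absurd (h2 w) hw
        edge_ge := fun j x hj hx => by
          rw [mem_nodes] at hx
          obtain ⟨-, w, -, hw, -⟩ := hx
          rw [h2] at hw
          exact absurd hw.symm hj
        edge_le := fun j x => by rw [h4, sum_empty]; linarith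
        edge_p_le := fun j x => by rw [h4, sum_empty]; linarith
        last := fun c hc => absurd (h1 c) hc }
  all_goals intro j h5 h6; omega

/-- The retained layers keep their nodes and hyperedges and lose only blocking elements. Below layer
`j` the losses are within the tolerance by the minimality of `j`, and layer `j` has its size
recorded afresh. The resources given to `G` lie in layer `i > j`, which disappears. The delicate
point is `spread`. -/
theorem Exchange.collapse_inv (hA : A.Valid) {Z G : Finset ℕ} {R : ℕ → Finset ℕ} {i j : ℕ}
    (hE : s.Exchange A Z G i) (hG : s.Grown A)
    (hR : ∀ x ∈ G, R x ⊆ s.freePart A i x ∧ A.v ≤ ∑ w ∈ R x, A.cap w ∧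
      ∑ w ∈ R x, A.p w ≤ A.v + A.pm) (hZ : Z.card ≤ s.C.card) (hj : 1 ≤ j) (hji : j < i)
    (hmin : ∀ t, 1 ≤ t → t < j → (s.b0 t : ℝ) - (s.kept A Z G t).card ≤ A.mu * s.b0 t) :
    (s.collapse A Z G R i j).Inv A := by
  have hC' := hE.collapse_covering (j := j) hG.covering hG.forest hR
  set s' := s.collapse A Z G R i j with hs'
  have hle := hE.le_top
  have hF := hG.forest
  have hve := hA.ve_nonneg
  have hpm := hA.pm_nonneg
  have hlay : ∀ c, s'.lay c = if s.Hit Z G i c ∨ j < s.lay c then 0 else s.lay c := fun c => rfl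
  have lay_iff : ∀ c t, t ≠ 0 → (s'.lay c = t ↔ ¬ s.Hit Z G i c ∧ s.lay c = t ∧ t ≤ j) := by
    intro c t ht
    rw [hlay]
    split_ifs with h
    · constructor
      · intro h'; omega
      · rintro ⟨h1, h2, h3⟩
        rcases h with h | h
        · exact absurd h h1
        · omega
    · rw [not_or] at h
      constructor
      · intro h'; exact ⟨h.1, h', by omega⟩
      · exact fun h' => h'.2.1
  have haL : ∀ w t, t ≠ 0 → (s'.aL w = t ↔ s.aL w = t ∧ t ≤ j) := by
    intro w t ht
    change (if j < s.aL w then 0 else s.aL w) = t ↔ _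
    split_ifs with h <;> omega
  have haN : ∀ w, s'.aN w = s.aN w := fun w => rfl
  have hkept : ∀ t, 1 ≤ t → t ≤ j → s'.layer A t = s.kept A Z G t := by
    intro t h1 h2
    ext c
    rw [mem_layer, mem_kept, lay_iff c t (by omega)]
    constructor
    · rintro ⟨h3, h4, h5, -⟩
      refine ⟨⟨h3, h5⟩, ?_⟩
      by_contra h6
      exact h4 ⟨by omega, by omega, by tauto⟩
    · rintro ⟨⟨h3, h4⟩, h5, h6⟩
      exact ⟨h3, fun h => by rcases h.2.2 with h | h <;> contradiction, h4, h2⟩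
  have hnodes : ∀ t, 1 ≤ t → t ≤ j → s'.nodes A t = s.nodes A t := by
    intro t h1 h2
    ext x
    rw [mem_nodes, mem_nodes]
    refine and_congr_right fun _ => exists_congr fun w => and_congr_right fun _ => ?_
    rw [haL w t (by omega), haN]
    tauto
  have hedge : ∀ t x, 1 ≤ t → t ≤ j → s'.edge A t x = s.edge A t x := by
    intro t x h1 h2
    ext w
    rw [mem_edge, mem_edge, haL w t (by omega), haN]
    tauto
  have hedge' : ∀ t x, j < t → s'.edge A t x = ∅ := by
    intro t x h1
    rw [eq_empty_iff_forall_notMem]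
    intro w hw
    rw [mem_edge, haL w t (by omega)] at hw
    omega
  have hown : ∀ w c, s.lay c ≠ 0 → ¬ s.Hit Z G i c → c ∈ s.C →
      (s'.own w = c + 1 ↔ s.own w = c + 1) := by
    intro w c h0 hc hcC
    change (if s.own w ≠ 0 then (if s.Hit Z G i (s.own w - 1) then 0 else s.own w)
      else if s.aN w ∈ G ∧ w ∈ R (s.aN w) then s.aN w + 1 else 0) = c + 1 ↔ _
    split_ifs with h1 h2 h3
    · constructor
      · intro h; exact h.elim
      · intro h
        rw [h, Nat.add_sub_cancel] at h2
        exact absurd h2 hc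
    · rfl
    · constructor
      · intro h
        obtain rfl : s.aN w = c := by omega
        exact absurd (hE.hit_of_mem hcC h3.1) hc
      · intro h; omega
    · exact ⟨False.elim, fun h => by omega⟩
  have hforest : s'.Forest A j := by
    refine ⟨?_, ?_, ?_, ?_, ?_, ?_, ?_⟩
    · intro c hc
      obtain ⟨h1, h2, h3⟩ := (lay_iff c _ hc).1 rfl
      exact ⟨hE.mem_of_not_hit (hF.lay c (by omega)).1 h1, h3⟩
    · intro w hw
      obtain ⟨h1, h2⟩ := (haL w _ hw).1 rfl
      obtain ⟨h3, h4, h5, -⟩ := hF.aL w (by omega)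
      exact ⟨h3, h4, h5, h2⟩
    · intro w c hw hc
      obtain ⟨h1, h2⟩ := (haL w _ hw).1 rfl
      change (if s.own w ≠ 0 then (if s.Hit Z G i (s.own w - 1) then 0 else s.own w)
        else if s.aN w ∈ G ∧ w ∈ R (s.aN w) then s.aN w + 1 else 0) = c + 1 at hc
      split_ifs at hc with h3 h4 h5
      · rw [hc, Nat.add_sub_cancel] at h4
        rw [lay_iff c _ hw]
        exact ⟨h4, by rw [hF.blocked w c (by omega) hc, h1], h2⟩
      · have := mem_freePart.1 ((hR _ h5.1).1 h5.2)
        omega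
    · intro t x ht hx
      have h1 : t ≤ j := by
        rw [mem_nodes] at hx
        obtain ⟨-, w, -, hw, -⟩ := hx
        exact ((haL w t ht).1 hw).2
      rw [hnodes t (by omega) h1] at hx
      rw [hedge t x (by omega) h1]
      exact hF.edge_ge t x ht hx
    · intro t x
      by_cases h1 : t + 1 ≤ j
      · rw [hedge _ x (by omega) h1]; exact hF.edge_le t x
      · rw [hedge' _ x (by omega), sum_empty]; linarith
    · intro t x
      by_cases h1 : t + 1 ≤ j
      · rw [hedge _ x (by omega) h1]; exact hF.edge_p_le t x
      · rw [hedge' _ x (by omega), sum_empty]; linarith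
    · intro c hc
      obtain ⟨h1, h2, h3⟩ := (lay_iff c _ hc).1 rfl
      have h0 : s.lay c ≠ 0 := by omega
      obtain ⟨x, hx⟩ := hF.last c h0
      refine ⟨x, ?_⟩
      convert hx using 2
      ext w
      rw [mem_filter, mem_filter, mem_held, mem_held, hown w c h0 h1 (hF.lay c h0).1,
        haL w _ hc, haN, h2]
      tauto
  -- Equality is essential: `rest` gains exactly as many elements as the layers below lose.
  have hZC : Z.card = s.C.card := le_antisymm hZ (hE.card_le hG.covering)
  have hb0 : ∀ t, t ≠ j → s'.b0 t = s.b0 t := by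
    intro t ht
    change (if j = 0 then s.b0 else Function.update s.b0 j _) t = _
    rw [if_neg (by omega), Function.update_of_ne ht]
  have hb0j : s'.b0 j = (s.kept A Z G j).card := by
    change (if j = 0 then s.b0 else Function.update s.b0 j _) j = _
    rw [if_neg (by omega), Function.update_self]
  have hbeta : ∀ t < j, s'.beta t = s.beta t := fun t ht =>
    beta_congr fun i _ hi => hb0 i (by omega)
  -- An element that drops out of layer `l` is spanned by `G` and by those retained elements that
  -- lie outside the layers below `l`. All of these belong to the new `rest (t - 1)` when `t ≤ l`;
  -- the elements of `G` do so because they leave the tree.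
  have hrest : ∀ t, 1 ≤ t → t ≤ j →
      (s.rest (t - 1) : Set ℕ) ⊆ A.M.closure ↑(s'.rest (t - 1)) := by
    intro t h1 h2 c hc
    rw [mem_coe, mem_rest] at hc
    have hin : ∀ z ∈ Z, (z ∈ G ∨ (z ∈ s.C ∧ (s.lay z = 0 ∨ t - 1 < s.lay z))) →
        z ∈ s'.rest (t - 1) := by
      intro z hz hz'
      refine mem_rest.2 ⟨hz, ?_⟩
      rw [hlay]
      split_ifs with h
      · exact Or.inl rfl
      · rw [not_or] at h
        rcases hz' with hz' | hz'
        · rcases mem_union.1 (hE.subset hz) with h5 | h5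
          · exact absurd (hE.hit_of_mem h5 hz') h.1
          · by_cases h6 : s.lay z = 0
            · exact Or.inl h6
            · exact absurd (hE.hit_of_mem (hF.lay z h6).1 hz') h.1
        · exact hz'.2
    by_cases hcZ : c ∈ Z
    · exact A.M.mem_closure_of_mem' (by exact_mod_cast hin c hcZ (Or.inr hc))
        (hG.covering.indep.subset_ground (by exact_mod_cast hc.1))
    · have h3 : ¬ (s.lay c = 0 ∨ i ≤ s.lay c) := fun h =>
        hcZ (hE.rest_subset (mem_rest.2 ⟨hc.1, by omega⟩))
      refine A.M.closure_subset_closure ?_ (hE.closure c (by omega) (by omega) hcZ)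
      intro z hz
      rw [mem_coe, mem_filter, mem_rest] at hz
      exact hin z hz.1 (hz.2.imp_right fun h => ⟨h.1, by omega⟩)
  exact
    { covering := hC'
      forest := hforest
      -- The shrinking of `D` to `D'` is at most the growth of `rest`, which equals the decrease of
      -- the layers below `t`. So both sides of the inequality in `Spread` stay in balance, the
      -- recorded sizes below `t` being unchanged.
      spread := fun t h1 h2 => by
        change t ≤ j at h2
        obtain ⟨D, hD, hdis, hind, hcard⟩ := hG.spread t h1 (by omega)
        obtain ⟨D', hD', hdis', hind', hcard'⟩ := Matroid.exists_extension_of_subset_closure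
          hdis hind (hC'.rest_indep (t - 1)) (hrest t h1 h2)
        refine ⟨D', by rw [hnodes t h1 h2]; exact hD'.trans hD, hdis', hind', ?_⟩
        have e1 := card_rest_add hA hC' hforest (t - 1)
        have e2 := card_rest_add hA hG.covering hF (t - 1)
        have e3 : s'.C.card = s.C.card := hZC
        have e4 : ∑ i ∈ Icc 1 (t - 1), s'.b0 i = ∑ i ∈ Icc 1 (t - 1), s.b0 i :=
          sum_congr rfl fun i hi => hb0 i (by rw [mem_Icc] at hi; omega)
        rw [hnodes t h1 h2, e4]
        omega
      recorded := fun t h1 h2 => by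
        change t ≤ j at h2
        rw [Recorded, hkept t h1 h2]
        rcases eq_or_ne t j with rfl | htj
        · rw [hb0j]
          exact ⟨le_rfl, by
            rw [sub_self]
            exact mul_nonneg (mu_pos hA).le (Nat.cast_nonneg _)⟩
        · rw [hb0 t htj]
          exact ⟨(card_filter_le _ _).trans (hG.recorded t h1 (by omega)).1,
            hmin t h1 (by omega)⟩
      wide := fun t h1 h2 => by
        change t ≤ j at h2
        rw [Wide, hnodes t h1 h2, hbeta _ (by omega)]
        exact hG.wide t h1 (by omega)
      large := fun t h1 h2 => by
        change t < j at h2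
        rw [Large, hb0 t (by omega), hbeta _ (by omega)]
        exact hG.large t h1 (by omega) }

end Config

/-! ### A potential that increases in every iteration -/

namespace Problem

variable (A : Problem)

/-- The factor between the weights of consecutive layers in the potential. -/
noncomputable def rate : ℝ := 1 + 4 / (A.sigma * A.mu)

/-- An exponent with `rate ≤ (1 + sigma) ^ degree`. -/
noncomputable def degree : ℕ := sInf {n | A.rate ≤ (1 + A.sigma) ^ n}

/-- The increase of the measure in every iteration. -/
noncomputable def gain : ℝ := A.mu / 2 / (A.rate ^ 2 * (2 * A.m + 2) ^ (A.degree + 1))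

end Problem

namespace Config

open Finset Classical

variable {A : Problem} {s s₀ : Config}

variable (A s) in
/-- The size of layer `j`, regularized by means of the recorded sizes of the layers below. -/
noncomputable def weight (j : ℕ) : ℝ := max (s.b0 j) (A.sigma / 2 * s.beta (j - 1))

variable (A s) in
/-- The potential of the tree. -/
noncomputable def potential : ℝ := ∑ j ∈ Icc 1 s.top, (A.rate ^ j)⁻¹ * (s.weight A j)⁻¹

variable (A s) in
/-- The measure of progress. -/
noncomputable def progress : ℝ := s.C.card * (2 / A.sigma + A.gain) + s.potential A

theorem sigma_le (hA : A.Valid) : A.sigma ≤ 1 := by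
  have h2 : A.e ^ 3 ≤ 1 := pow_le_one₀ hA.e_pos.le (by linarith [hA.e_le])
  rw [Problem.sigma]; linarith

theorem two_le_rate (hA : A.Valid) : 2 ≤ A.rate := by
  have h1 := mu_pos hA
  have h2 := sigma_pos hA
  have h3 : A.sigma * A.mu ≤ 4 := by nlinarith [mu_le hA, sigma_le hA]
  have : 1 ≤ 4 / (A.sigma * A.mu) := by rw [le_div_iff₀ (by positivity)]; linarith
  rw [Problem.rate]; linarith

/-- The set in the definition of `degree` is nonempty because powers of `1 + sigma` are unbounded;
thus the infimum is attained and is not a default value. -/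
theorem rate_le_pow (hA : A.Valid) : A.rate ≤ (1 + A.sigma) ^ A.degree := by
  obtain ⟨n, hn⟩ := pow_unbounded_of_one_lt A.rate (show 1 < 1 + A.sigma by linarith [sigma_pos hA])
  exact Nat.sInf_mem (s := {n | A.rate ≤ (1 + A.sigma) ^ n}) ⟨n, hn.le⟩

theorem gain_pos (hA : A.Valid) : 0 < A.gain := by
  have h1 := mu_pos hA
  have h2 := two_le_rate hA
  rw [Problem.gain]; positivity

theorem weight_ge (hA : A.Valid) (j : ℕ) : A.sigma / 2 ≤ s.weight A j := by
  refine le_trans ?_ (le_max_right _ _)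
  have h1 : (1 : ℝ) ≤ s.beta (j - 1) := by exact_mod_cast beta_pos _
  have := sigma_pos hA
  nlinarith

theorem weight_pos (hA : A.Valid) (j : ℕ) : 0 < s.weight A j :=
  lt_of_lt_of_le (by have := sigma_pos hA; positivity) (weight_ge hA j)

theorem potential_nonneg (hA : A.Valid) : 0 ≤ s.potential A := by
  refine sum_nonneg fun j _ => ?_
  have h1 := weight_pos (s := s) hA j
  have h2 := two_le_rate hA
  positivity

/-- A tail of the geometric series. -/
theorem sum_rate_le (hA : A.Valid) (a b : ℕ) :
    ∑ j ∈ Ioc a b, (A.rate ^ j)⁻¹ ≤ (A.rate ^ a)⁻¹ * (A.sigma * A.mu / 4) := by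
  have hr := two_le_rate hA
  have h1 := mu_pos hA
  have h2 := sigma_pos hA
  have key : ∀ n, ∑ j ∈ Ioc a (a + n), (A.rate ^ j)⁻¹ + (A.rate ^ (a + n))⁻¹ *
      (A.sigma * A.mu / 4) = (A.rate ^ a)⁻¹ * (A.sigma * A.mu / 4) := by
    intro n
    induction n with
    | zero => simp
    | succ n ih =>
      rw [← add_assoc, sum_Ioc_succ_top (by omega), ← ih]
      -- `rate` is chosen so that this identity holds and the geometric sum telescopes with constant
      -- `sigma * mu / 4`.
      have h3 : A.rate * (A.sigma * A.mu / 4) = A.sigma * A.mu / 4 + 1 := by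
        rw [Problem.rate]; field_simp
      have h4 : (A.rate ^ (a + n))⁻¹ = (A.rate ^ (a + n + 1))⁻¹ * A.rate := by
        rw [pow_succ]; field_simp
      rw [h4, mul_assoc _ A.rate, h3]
      ring
  rcases Nat.le_total a b with h | h
  · obtain ⟨n, rfl⟩ := Nat.exists_eq_add_of_le h
    rw [← key n]
    have : 0 ≤ (A.rate ^ (a + n))⁻¹ * (A.sigma * A.mu / 4) := by positivity
    linarith
  · rw [Ioc_eq_empty (by omega), sum_empty]
    positivity

/-- The lower bound `sigma / 2` for the weights, due to the regularization by `beta ≥ 1`, bounds the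
potential even if the last layer is empty. So one additional chosen element outweighs the loss of a
whole tree. -/
theorem potential_le (hA : A.Valid) : s.potential A ≤ 2 / A.sigma := by
  have hr := two_le_rate hA
  have h1 := mu_pos hA
  have h2 := sigma_pos hA
  have h3 : s.potential A ≤ ∑ j ∈ Ioc 0 s.top, (A.rate ^ j)⁻¹ * (2 / A.sigma) := by
    rw [potential, ← Icc_succ_left_eq_Ioc]
    refine sum_le_sum fun j _ => mul_le_mul_of_nonneg_left ?_ (by positivity)
    rw [← inv_div]
    exact inv_anti₀ (by positivity) (weight_ge hA j)
  rw [← sum_mul] at h3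
  have h4 := sum_rate_le hA 0 s.top
  rw [pow_zero, inv_one, one_mul] at h4
  have h5 : A.sigma * A.mu / 4 ≤ 1 := by nlinarith [mu_le hA, sigma_le hA]
  exact h3.trans (mul_le_of_le_one_left (by positivity) (h4.trans h5))

theorem progress_le (hA : A.Valid) (hC : s.Covering A) :
    s.progress A ≤ A.m * (2 / A.sigma + A.gain) + 2 / A.sigma := by
  have h1 : (s.C.card : ℝ) ≤ A.m := by
    have := card_le_card (hA.subset_range hC.indep)
    rw [card_range] at this
    exact_mod_cast this
  have h2 := sigma_pos hA
  have h3 := gain_pos hA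
  exact add_le_add (mul_le_mul_of_nonneg_right h1 (by positivity)) (potential_le hA)

theorem progress_nonneg (hA : A.Valid) : 0 ≤ s.progress A := by
  have h2 := sigma_pos hA
  have h3 := gain_pos hA
  have h4 := potential_nonneg (s := s) hA
  rw [progress]
  positivity

theorem b0_le (hA : A.Valid) {j : ℕ} (h : s.Recorded A j) : s.b0 j ≤ 2 * (s.layer A j).card := by
  have h1 := h.2
  have h2 := mul_le_mul_of_nonneg_right (mu_le hA) (Nat.cast_nonneg (α := ℝ) (s.b0 j))
  have : (s.b0 j : ℝ) ≤ 2 * (s.layer A j).card := by linarith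
  exact_mod_cast this

theorem sum_card_layer_le (hA : A.Valid) (hC : s.Covering A) (hF : s.Forest A s.top) (i : ℕ) :
    ∑ j ∈ Icc 1 i, (s.layer A j).card ≤ s.C.card := by
  have := card_rest_add hA hC hF i
  omega

theorem card_C_le (hA : A.Valid) (hC : s.Covering A) : s.C.card ≤ A.m := by
  have := card_le_card (hA.subset_range hC.indep)
  rwa [card_range] at this

theorem beta_le (hA : A.Valid) (hC : s.Covering A) (hF : s.Forest A s.top) {i : ℕ}
    (hR : ∀ j, 1 ≤ j → j ≤ i → s.Recorded A j) : s.beta i ≤ 2 * A.m + 1 := by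
  have h1 : ∑ j ∈ Icc 1 i, s.b0 j ≤ ∑ j ∈ Icc 1 i, 2 * (s.layer A j).card :=
    sum_le_sum fun j hj => b0_le hA (hR j (mem_Icc.1 hj).1 (mem_Icc.1 hj).2)
  rw [← mul_sum] at h1
  have h2 := sum_card_layer_le hA hC hF i
  have h3 := card_C_le hA hC
  rw [beta]
  omega

theorem weight_le (hA : A.Valid) (hC : s.Covering A) (hF : s.Forest A s.top) {i : ℕ} (hi : 1 ≤ i)
    (hR : ∀ j, 1 ≤ j → j ≤ i → s.Recorded A j) : s.weight A i ≤ 2 * A.m + 2 := by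
  obtain ⟨i, rfl⟩ := Nat.exists_eq_add_of_le' hi
  have h1 : (s.beta (i + 1) : ℝ) ≤ 2 * A.m + 1 := by exact_mod_cast beta_le hA hC hF hR
  rw [beta_succ] at h1
  push_cast at h1
  rw [weight, Nat.add_sub_cancel]
  have h2 := sigma_le hA
  have h3 : (0 : ℝ) ≤ s.beta i := Nat.cast_nonneg _
  have h4 : (0 : ℝ) ≤ s.b0 (i + 1) := Nat.cast_nonneg _
  exact max_le (by linarith) (by nlinarith)

/-- All layers but the last are large, hence nonempty, and they are disjoint parts of `C`. -/
theorem Inv.top_le (hA : A.Valid) (h : s.Inv A) : s.top ≤ s.C.card + 1 := by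
  have h1 := sum_card_layer_le hA h.covering h.forest (s.top - 1)
  have h2 : ∑ j ∈ Icc 1 (s.top - 1), 1 ≤ ∑ j ∈ Icc 1 (s.top - 1), (s.layer A j).card := by
    refine sum_le_sum fun j hj => ?_
    rw [mem_Icc] at hj
    have h3 := b0_le hA (h.recorded j hj.1 (by omega))
    have h4 := h.large j hj.1 (by omega)
    have h5 : (1 : ℝ) ≤ s.beta (j - 1) := by exact_mod_cast beta_pos _
    have h6 : (0 : ℝ) < s.b0 j := by
      have := sigma_pos hA
      rw [Large] at h4
      nlinarith
    have h7 : 0 < s.b0 j := by exact_mod_cast h6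
    omega
  simp at h2
  omega

/-- Every large layer multiplies `beta` by at least `1 + sigma`, while `beta` is at most `2 m + 1`.
Since `rate` is at most a fixed power of `1 + sigma`, the power of `rate` is polynomial in `m`. The
factor `rate ^ 2` pays for the last layer and for the one about to be built. -/
theorem Inv.rate_pow_le (hA : A.Valid) (h : s.Inv A) :
    A.rate ^ (s.top + 1) ≤ A.rate ^ 2 * (2 * A.m + 2) ^ A.degree := by
  have hr := two_le_rate hA
  have hs := sigma_pos hA
  have h1 : ∀ i, i < s.top → (1 + A.sigma) ^ i ≤ s.beta i := by
    intro i
    induction i with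
    | zero => simp [beta]
    | succ i ih =>
      intro hi
      have h2 := h.large (i + 1) (by omega) hi
      rw [Large, Nat.add_sub_cancel] at h2
      rw [beta_succ, pow_succ]
      push_cast
      have h3 := mul_le_mul_of_nonneg_right (ih (by omega)) (show 0 ≤ 1 + A.sigma by linarith)
      nlinarith
  rcases Nat.eq_zero_or_pos s.top with h0 | h0
  · rw [h0]
    have h2 : (1 : ℝ) ≤ (2 * A.m + 2) ^ A.degree := by
      refine one_le_pow₀ ?_
      have : (0 : ℝ) ≤ A.m := Nat.cast_nonneg _
      linarith
    have h3 : A.rate ^ (0 + 1) ≤ A.rate ^ 2 := pow_le_pow_right₀ (by linarith) (by omega)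
    calc _ ≤ A.rate ^ 2 * 1 := by rw [mul_one]; exact h3
      _ ≤ _ := mul_le_mul_of_nonneg_left h2 (by positivity)
  · obtain ⟨t, ht⟩ := Nat.exists_eq_add_of_le' h0
    have h2 : (s.beta t : ℝ) ≤ 2 * A.m + 1 := by
      exact_mod_cast beta_le hA h.covering h.forest fun j h3 h4 => h.recorded j h3 (by omega)
    rw [ht, add_assoc, pow_add, mul_comm]
    refine mul_le_mul_of_nonneg_left ?_ (by positivity)
    calc A.rate ^ t ≤ ((1 + A.sigma) ^ A.degree) ^ t :=
          pow_le_pow_left₀ (by linarith) (rate_le_pow hA) _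
      _ = ((1 + A.sigma) ^ t) ^ A.degree := by rw [← pow_mul, ← pow_mul, mul_comm]
      _ ≤ _ := pow_le_pow_left₀ (by positivity) (by linarith [h1 t (by omega)]) _

/-- The gain is at most the change of the potential caused by a change in one layer. -/
theorem Inv.gain_le (hA : A.Valid) (h : s.Inv A) {j : ℕ} (hj : j ≤ s.top + 1) {g : ℝ} (hg : 0 < g)
    (hgm : g ≤ 2 * A.m + 2) : A.gain ≤ (A.rate ^ j)⁻¹ * (A.mu / 2 * g⁻¹) := by
  have hr := two_le_rate hA
  have hm := mu_pos hA
  have h1 : A.rate ^ j ≤ A.rate ^ 2 * (2 * A.m + 2) ^ A.degree :=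
    (pow_le_pow_right₀ (by linarith) hj).trans (h.rate_pow_le hA)
  rw [Problem.gain, pow_succ (2 * (A.m : ℝ) + 2), ← mul_assoc, div_eq_mul_inv, mul_inv]
  have h2 : (A.rate ^ 2 * (2 * (A.m : ℝ) + 2) ^ A.degree)⁻¹ ≤ (A.rate ^ j)⁻¹ :=
    inv_anti₀ (by positivity) h1
  have h3 : (2 * (A.m : ℝ) + 2)⁻¹ ≤ g⁻¹ := inv_anti₀ hg hgm
  calc A.mu / 2 * ((A.rate ^ 2 * (2 * (A.m : ℝ) + 2) ^ A.degree)⁻¹ * (2 * (A.m : ℝ) + 2)⁻¹)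
      ≤ A.mu / 2 * ((A.rate ^ j)⁻¹ * g⁻¹) := by gcongr
    _ = _ := by ring

/-- Keeping a new layer is progress. -/
theorem Grown.progress_of_calm (hA : A.Valid) (h₀ : s₀.Inv A) (h : s.Grown A) (hC : s.C = s₀.C)
    (ht : s.top = s₀.top + 1) (hb : ∀ j ≤ s₀.top, s.b0 j = s₀.b0 j)
    (hc : ∀ j, 1 ≤ j → j ≤ s.top → s.Calm A j) :
    s.Inv A ∧ s₀.progress A + A.gain ≤ s.progress A := by
  refine ⟨h.inv hA (h.v_pos hA (hc 1 le_rfl h.pos)) hc, ?_⟩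
  have hm := mu_pos hA
  have hw := weight_le hA h.covering h.forest h.pos h.recorded
  have hw0 := weight_pos (s := s) hA s.top
  have h1 := h₀.gain_le hA (j := s.top) (by omega) hw0 hw
  have hr := two_le_rate hA
  have h2 : (A.rate ^ s.top)⁻¹ * (A.mu / 2 * (s.weight A s.top)⁻¹) ≤
      (A.rate ^ s.top)⁻¹ * (s.weight A s.top)⁻¹ := by
    refine mul_le_mul_of_nonneg_left ?_ (by positivity)
    exact mul_le_of_le_one_left (by positivity) (by linarith [mu_le hA])
  have h3 : s.potential A = s₀.potential A + (A.rate ^ s.top)⁻¹ * (s.weight A s.top)⁻¹ := by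
    rw [potential, ht, sum_Icc_succ_top (by omega), potential]
    congr 1
    refine sum_congr rfl fun j hj => ?_
    rw [mem_Icc] at hj
    rw [weight, weight, hb j hj.2, beta_congr (s := s₀) fun i _ hi => hb i (by omega)]
  rw [progress, progress, hC, h3]
  linarith

/-- A collapse is progress. -/
theorem Exchange.progress (hA : A.Valid) (h₀ : s₀.Inv A) (h : s.Grown A) (hC : s.C = s₀.C)
    (ht : s.top = s₀.top + 1) (hb : ∀ j ≤ s₀.top, s.b0 j = s₀.b0 j)
    {Z G : Finset ℕ} {R : ℕ → Finset ℕ} {i j : ℕ} (hE : s.Exchange A Z G i)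
    (hR : ∀ x ∈ G, R x ⊆ s.freePart A i x ∧ A.v ≤ ∑ w ∈ R x, A.cap w ∧
      ∑ w ∈ R x, A.p w ≤ A.v + A.pm)
    (hc : ∀ t, 1 ≤ t → t < i → s.Calm A t)
    (hj : j = 0 ∧ s.C.card < Z.card ∨ Z.card ≤ s.C.card ∧ 1 ≤ j ∧ j < i ∧
      A.mu * s.b0 j < s.b0 j - (s.kept A Z G j).card ∧
      ∀ t, 1 ≤ t → t < j → (s.b0 t : ℝ) - (s.kept A Z G t).card ≤ A.mu * s.b0 t) :
    (s.collapse A Z G R i j).Inv A ∧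
      s₀.progress A + A.gain ≤ (s.collapse A Z G R i j).progress A := by
  have hm := mu_pos hA
  have hs := sigma_pos hA
  have hg := gain_pos hA
  have hr := two_le_rate hA
  rcases hj with ⟨rfl, hj⟩ | ⟨hZ, hj1, hji, hlt, hmin⟩
  -- The potential may drop to zero, but it was at most `2 / sigma`.
  · refine ⟨hE.collapse_inv_zero hA h.covering h.forest hR, ?_⟩
    have h1 := potential_le (s := s₀) hA
    have h2 := potential_nonneg (s := s.collapse A Z G R i 0) hA
    have h3 : (s₀.C.card : ℝ) + 1 ≤ Z.card := by rw [← hC]; exact_mod_cast hj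
    have h4 := mul_le_mul_of_nonneg_right h3 (show 0 ≤ 2 / A.sigma + A.gain by positivity)
    change _ ≤ (Z.card : ℝ) * _ + _
    rw [Config.progress]
    linarith
  · refine ⟨hE.collapse_inv hA h hR hZ hj1 hji hmin, ?_⟩
    set s' := s.collapse A Z G R i j with hs'
    have hle := hE.le_top
    have hv := h.v_pos hA (hc 1 le_rfl (by omega))
    -- Layer `j` lies below the first layer that admits a collapse, so it is calm and hence large;
    -- its weight before the collapse is therefore `b0 j` itself.
    have hlarge : A.sigma * s.beta (j - 1) ≤ s.b0 j := by
      have := large_of_calm hA hv h.covering h.forest (by omega) (h.spread j hj1 (by omega))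
        (fun t h3 h4 => h.recorded t h3 (by omega)) (hc j hj1 hji) (h.wide j hj1 (by omega))
      exact this.trans (by exact_mod_cast (h.recorded j hj1 (by omega)).1)
    have hb0 : ∀ t, t ≠ j → s'.b0 t = s.b0 t := by
      intro t htj
      change (if j = 0 then s.b0 else Function.update s.b0 j _) t = _
      rw [if_neg (by omega), Function.update_of_ne htj]
    have hb0j : s'.b0 j = (s.kept A Z G j).card := by
      change (if j = 0 then s.b0 else Function.update s.b0 j _) j = _
      rw [if_neg (by omega), Function.update_self]
    have hbeta : ∀ t < j, s'.beta t = s.beta t := fun t htj =>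
      beta_congr fun i _ hi => hb0 i (by omega)
    have hbpos : (1 : ℝ) ≤ s.beta (j - 1) := by exact_mod_cast beta_pos _
    have hbj : (0 : ℝ) < s.b0 j := by nlinarith
    -- The regularizing term does not obstruct the decrease: it is at most half of `b0 j`, by the
    -- factor `1/2` in `weight` and the size of the layer.
    have hw' : s'.weight A j ≤ (1 - A.mu) * s.b0 j := by
      rw [weight, hb0j, hbeta _ (by omega)]
      refine max_le (by linarith) ?_
      nlinarith [mu_le hA]
    have hw'0 := weight_pos (s := s') hA j
    have hwj : s.weight A j = s.b0 j := by
      rw [weight, max_eq_left]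
      nlinarith
    have hgain := h₀.gain_le hA (j := j) (by omega) hw'0 (by
      have := weight_le hA h.covering h.forest hj1 fun t h1 h2 => h.recorded t h1 (by omega)
      rw [hwj] at this
      nlinarith)
    have e1 : (s.b0 j : ℝ)⁻¹ ≤ (1 - A.mu) * (s'.weight A j)⁻¹ := by
      rw [inv_le_iff_one_le_mul₀ hbj, mul_assoc, mul_comm, mul_assoc]
      rw [inv_mul_eq_div, one_le_div hw'0, mul_comm]
      exact hw'
    have e2 : s₀.potential A ≤ ∑ l ∈ Icc 1 (j - 1), (A.rate ^ l)⁻¹ * (s'.weight A l)⁻¹ +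
        (A.rate ^ j)⁻¹ * (s.b0 j : ℝ)⁻¹ + (A.rate ^ j)⁻¹ * (A.mu / 2 * (s.b0 j : ℝ)⁻¹) := by
      have e3 : s₀.potential A ≤ ∑ l ∈ Icc 1 s.top, (A.rate ^ l)⁻¹ * (s.weight A l)⁻¹ := by
        rw [potential, ht, sum_Icc_succ_top (by omega)]
        have := weight_pos (s := s) hA (s₀.top + 1)
        refine le_add_of_le_of_nonneg (le_of_eq ?_) (by positivity)
        refine sum_congr rfl fun l hl => ?_
        rw [mem_Icc] at hl
        rw [weight, weight, hb l hl.2, beta_congr (s := s₀) fun i _ hi => hb i (by omega)]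
      have e4 : Icc 1 s.top = Icc 1 (j - 1) ∪ ({j} ∪ Ioc j s.top) := by
        ext l; simp only [mem_union, mem_Icc, mem_Ioc, mem_singleton]; omega
      have e5 : Disjoint (Icc 1 (j - 1)) ({j} ∪ Ioc j s.top) := by
        rw [disjoint_left]; intro l; simp only [mem_union, mem_Icc, mem_Ioc, mem_singleton]; omega
      have e6 : Disjoint {j} (Ioc j s.top) := by simp
      rw [e4, sum_union e5, sum_union e6, sum_singleton, hwj] at e3
      -- Layers above `j` have weight at least `sigma / 2 * b0 j`, because `b0 j` is a summand of
      -- their `beta`. The smallness of the geometric tail turns their total into the fraction `mu /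
      -- 2` of the term of layer `j`.
      have e7 : ∑ l ∈ Ioc j s.top, (A.rate ^ l)⁻¹ * (s.weight A l)⁻¹ ≤
          (A.rate ^ j)⁻¹ * (A.mu / 2 * (s.b0 j : ℝ)⁻¹) := by
        calc _ ≤ ∑ l ∈ Ioc j s.top, (A.rate ^ l)⁻¹ * (A.sigma / 2 * s.b0 j)⁻¹ := by
              refine sum_le_sum fun l hl => mul_le_mul_of_nonneg_left ?_ (by positivity)
              refine inv_anti₀ (by positivity) (le_trans ?_ (le_max_right _ _))
              refine mul_le_mul_of_nonneg_left ?_ (by positivity)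
              rw [mem_Ioc] at hl
              obtain ⟨j, rfl⟩ := Nat.exists_eq_add_of_le' hj1
              have := beta_mono (s := s) (show j + 1 ≤ l - 1 by omega)
              rw [beta_succ] at this
              exact_mod_cast (by omega : s.b0 (j + 1) ≤ s.beta (l - 1))
          _ = (∑ l ∈ Ioc j s.top, (A.rate ^ l)⁻¹) * (A.sigma / 2 * s.b0 j)⁻¹ := by rw [sum_mul]
          _ ≤ (A.rate ^ j)⁻¹ * (A.sigma * A.mu / 4) * (A.sigma / 2 * s.b0 j)⁻¹ :=
              mul_le_mul_of_nonneg_right (sum_rate_le hA _ _) (by positivity)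
          _ = _ := by field_simp; ring
      have e8 : ∑ l ∈ Icc 1 (j - 1), (A.rate ^ l)⁻¹ * (s'.weight A l)⁻¹ =
          ∑ l ∈ Icc 1 (j - 1), (A.rate ^ l)⁻¹ * (s.weight A l)⁻¹ := by
        refine sum_congr rfl fun l hl => ?_
        rw [mem_Icc] at hl
        rw [weight, weight, hb0 l (by omega), hbeta _ (by omega)]
      rw [e8]
      linarith
    have e9 : s'.potential A = ∑ l ∈ Icc 1 (j - 1), (A.rate ^ l)⁻¹ * (s'.weight A l)⁻¹ +
        (A.rate ^ j)⁻¹ * (s'.weight A j)⁻¹ := by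
      rw [potential]
      change ∑ l ∈ Icc 1 j, _ = _
      obtain ⟨j, rfl⟩ := Nat.exists_eq_add_of_le' hj1
      rw [sum_Icc_succ_top (by omega), Nat.add_sub_cancel]
    -- With `1 / b0 j ≤ (1 - mu) / weight`, this is `(1 + mu / 2) * (1 - mu) + mu / 2 = 1 - mu ^ 2 /
    -- 2 ≤ 1`: one share `mu / 2` covers the discarded layers, the other one is the gain.
    have e10 : (A.rate ^ j)⁻¹ * (s.b0 j : ℝ)⁻¹ + (A.rate ^ j)⁻¹ * (A.mu / 2 * (s.b0 j : ℝ)⁻¹) +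
        (A.rate ^ j)⁻¹ * (A.mu / 2 * (s'.weight A j)⁻¹) ≤ (A.rate ^ j)⁻¹ * (s'.weight A j)⁻¹ := by
      rw [← mul_add, ← mul_add]
      refine mul_le_mul_of_nonneg_left ?_ (by positivity)
      have : 0 < (s'.weight A j)⁻¹ := by positivity
      nlinarith [mul_le_mul_of_nonneg_left e1 (show 0 ≤ 1 + A.mu / 2 by linarith), sq_nonneg A.mu]
    have hcard : (s₀.C.card : ℝ) ≤ s'.C.card := by
      rw [← hC]; exact_mod_cast hE.card_le h.covering
    have h4 := mul_le_mul_of_nonneg_right hcard (show 0 ≤ 2 / A.sigma + A.gain by positivity)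
    rw [Config.progress, Config.progress, e9]
    linarith

end Config

/-! ### Building blocks of programs -/

namespace RealRAM

/-- The cell `(0, 0)` of an array. -/
def NatExpr.cell (a : ℕ) : NatExpr := .read a (.lit 0) (.lit 0)

/-- An entry of row `0` of an array. -/
def NatExpr.entry (a : ℕ) (e : NatExpr) : NatExpr := .read a (.lit 0) e

/-- An entry of row `0` of an array. -/
def RealExpr.entry (a : ℕ) (e : NatExpr) : RealExpr := .read a (.lit 0) e

/-- The test whether a number is zero. -/
def Test.isZero (e : NatExpr) : Test := .natLe e (.lit 0)

/-- The test whether two numbers are equal. -/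
def Test.natEq (e f : NatExpr) : Test := .and (.natLe e f) (.natLe f e)

/-- Disjunction. -/
def Test.or (b c : Test) : Test := .not (.and (.not b) (.not c))

@[simp] theorem NatExpr.eval_lit (s : State) (c : ℕ) : (lit c).eval s = c := rfl

@[simp] theorem NatExpr.eval_cell (s : State) (a : ℕ) : (cell a).eval s = s.nat a 0 0 := rfl

@[simp] theorem NatExpr.eval_entry (s : State) (a : ℕ) (e : NatExpr) :
    (entry a e).eval s = s.nat a 0 (e.eval s) := rfl

@[simp] theorem NatExpr.eval_read (s : State) (a : ℕ) (i j : NatExpr) :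
    (read a i j).eval s = s.nat a (i.eval s) (j.eval s) := rfl

@[simp] theorem NatExpr.eval_add (s : State) (e f : NatExpr) :
    (add e f).eval s = e.eval s + f.eval s := rfl

@[simp] theorem NatExpr.eval_sub (s : State) (e f : NatExpr) :
    (sub e f).eval s = e.eval s - f.eval s := rfl

@[simp] theorem RealExpr.eval_lit (s : State) (c : ℚ) : (lit c).eval s = c := rfl

@[simp] theorem RealExpr.eval_entry (s : State) (a : ℕ) (e : NatExpr) :
    (entry a e).eval s = s.real a 0 (e.eval s) := rfl

@[simp] theorem RealExpr.eval_ofNat (s : State) (e : NatExpr) :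
    (RealExpr.ofNat e).eval s = e.eval s := rfl

@[simp] theorem RealExpr.eval_add (s : State) (e f : RealExpr) :
    (add e f).eval s = e.eval s + f.eval s := rfl

@[simp] theorem RealExpr.eval_sub (s : State) (e f : RealExpr) :
    (sub e f).eval s = e.eval s - f.eval s := rfl

@[simp] theorem RealExpr.eval_mul (s : State) (e f : RealExpr) :
    (mul e f).eval s = e.eval s * f.eval s := rfl

@[simp] theorem RealExpr.eval_div (s : State) (e f : RealExpr) :
    (div e f).eval s = e.eval s / f.eval s := rfl

@[simp] theorem Test.holds_natLe (s : State) (e f : NatExpr) :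
    (natLe e f).Holds s ↔ e.eval s ≤ f.eval s := Iff.rfl

@[simp] theorem Test.holds_realLe (s : State) (e f : RealExpr) :
    (realLe e f).Holds s ↔ e.eval s ≤ f.eval s := Iff.rfl

@[simp] theorem Test.holds_not (s : State) (b : Test) : (Test.not b).Holds s ↔ ¬ b.Holds s :=
  Iff.rfl

@[simp] theorem Test.holds_and (s : State) (b c : Test) :
    (Test.and b c).Holds s ↔ b.Holds s ∧ c.Holds s := Iff.rfl

@[simp] theorem Test.holds_isZero (s : State) (e : NatExpr) :
    (isZero e).Holds s ↔ e.eval s = 0 := by simp [isZero]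

@[simp] theorem Test.holds_natEq (s : State) (e f : NatExpr) :
    (natEq e f).Holds s ↔ e.eval s = f.eval s := by simp [natEq, le_antisymm_iff]

@[simp] theorem Test.holds_or (s : State) (b c : Test) :
    (Test.or b c).Holds s ↔ b.Holds s ∨ c.Holds s := by
  simp only [Test.or, holds_not, holds_and]; tauto

/-- The number of iterations of a loop. -/
def Limit.count (m k : ℕ) : Limit → ℕ
  | elements => m
  | resources => k
  | layers => m + 2

theorem Limit.eval_expr {m k : ℕ} {s : State} (hm : s.nat 0 0 0 = m) (hk : s.nat 0 0 1 = k)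
    (l : Limit) : l.expr.eval s = l.count m k := by
  cases l <;> simp [Limit.expr, Limit.count, hm, hk]

namespace Bounded

open Finset Classical

variable {O : Set ℕ → Prop}

@[simp] theorem run_skip (s : State) : skip.run O s = s := rfl

@[simp] theorem run_setNat (a : ℕ) (i j e : NatExpr) (s : State) :
    (setNat a i j e).run O s = s.setNat a (i.eval s) (j.eval s) (e.eval s) := rfl

@[simp] theorem run_setReal (a : ℕ) (i j : NatExpr) (e : RealExpr) (s : State) :
    (setReal a i j e).run O s = s.setReal a (i.eval s) (j.eval s) (e.eval s) := rfl

@[simp] theorem run_query (a : ℕ) (i j : NatExpr) (b : ℕ) (r : NatExpr) (s : State) :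
    (query a i j b r).run O s = s.setNat a (i.eval s) (j.eval s)
      (if O {v | s.nat b (r.eval s) v ≠ 0} then 1 else 0) := rfl

@[simp] theorem run_seq (P Q : Bounded) (s : State) :
    (seq P Q).run O s = Q.run O (P.run O s) := rfl

@[simp] theorem run_ite (b : Test) (P Q : Bounded) (s : State) :
    (ite b P Q).run O s = if b.Holds s then P.run O s else Q.run O s := rfl

/-- Assignment to the cell `(0, 0)` of an array. -/
def assign (a : ℕ) (e : NatExpr) : Bounded := setNat a (.lit 0) (.lit 0) e

/-- Assignment to an entry of row `0` of an array. -/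
def store (a : ℕ) (i e : NatExpr) : Bounded := setNat a (.lit 0) i e

/-- Assignment to an entry of row `0` of an array. -/
def storeReal (a : ℕ) (i : NatExpr) (e : RealExpr) : Bounded := setReal a (.lit 0) i e

@[simp] theorem run_assign (a : ℕ) (e : NatExpr) (s : State) :
    (assign a e).run O s = s.setNat a 0 0 (e.eval s) := rfl

@[simp] theorem run_store (a : ℕ) (i e : NatExpr) (s : State) :
    (store a i e).run O s = s.setNat a 0 (i.eval s) (e.eval s) := rfl

@[simp] theorem run_storeReal (a : ℕ) (i : NatExpr) (e : RealExpr) (s : State) :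
    (storeReal a i e).run O s = s.setReal a 0 (i.eval s) (e.eval s) := rfl

/-- Add up the values of an expression over the iterations that satisfy a test. -/
def sumLoop (c : ℕ) (l : Limit) (r : ℕ) (b : Test) (e : RealExpr) : Bounded :=
  .seq (storeReal r (.lit 0) (.lit 0))
    (.loop c l (.ite b (storeReal r (.lit 0) (.add (.entry r (.lit 0)) e)) .skip))

/-- The hypothesis concerns all states that agree with `s` outside the counter and the accumulator,
so an application never has to describe the intermediate states. -/
theorem run_sumLoop {c : ℕ} {l : Limit} {r : ℕ} {b : Test} {e : RealExpr} {s : State} {N : ℕ}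
    (hN : l.expr.eval s = N) (T : ℕ → Prop) (f : ℕ → ℝ)
    (h : ∀ n < N, ∀ u : State, u.nat c 0 0 = n → (∀ a, a ≠ c → u.nat a = s.nat a) →
      (∀ a, a ≠ r → u.real a = s.real a) → (b.Holds u ↔ T n) ∧ e.eval u = f n) :
    ((sumLoop c l r b e).run O s).real r 0 0 = ∑ n ∈ range N with T n, f n := by
  set s₁ := s.setReal r 0 0 0 with hs₁
  have hN₁ : l.expr.eval s₁ = N := by rw [← hN]; cases l <;> rfl
  have key := run_loop_induction (O := O) (c := c) (l := l) (s := s₁)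
    (P := .ite b (storeReal r (.lit 0) (.add (.entry r (.lit 0)) e)) .skip)
    (fun n u => u.real r 0 0 = ∑ n ∈ range n with T n, f n) (by
      rw [loopInit_real]; simp [hs₁, State.real_setReal]) (by
      intro n hn u hc hnat hreal hI
      obtain ⟨h1, h2⟩ := h n (by omega) u hc (fun a ha => hnat a (by simp [natWrites, storeReal, ha]))
        (fun a ha => (hreal a (by simp [realWrites, storeReal, ha])).trans
          (State.real_setReal_ne _ ha _ _ _))
      rw [range_add_one, filter_insert]
      by_cases hT : T n
      · rw [if_pos hT, sum_insert (by simp), run_ite, if_pos (h1.2 hT)]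
        simp [State.real_setNat, State.real_setReal, hI, h2, add_comm]
      · rw [if_neg hT, run_ite, if_neg (fun h' => hT (h1.1 h'))]
        exact hI)
  rw [hN₁] at key
  have h0 : s₁ = (storeReal r (.lit 0) (.lit 0)).run O s := by simp [hs₁]
  rw [h0] at key
  exact key

/-- Count the iterations that satisfy a test. -/
def countLoop (c : ℕ) (l : Limit) (r : ℕ) (b : Test) : Bounded :=
  .seq (assign r (.lit 0)) (.loop c l (.ite b (assign r (.add (.cell r) (.lit 1))) .skip))

theorem run_countLoop {c : ℕ} {l : Limit} {r : ℕ} {b : Test} {s : State} {N : ℕ} (hcr : c ≠ r)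
    (hr : r ≠ 0) (hN : l.expr.eval s = N) (T : ℕ → Prop)
    (h : ∀ n < N, ∀ u : State, u.nat c 0 0 = n → (∀ a, a ≠ c → a ≠ r → u.nat a = s.nat a) →
      u.real = s.real → (b.Holds u ↔ T n)) :
    ((countLoop c l r b).run O s).nat r 0 0 = #{n ∈ range N | T n} := by
  set s₁ := s.setNat r 0 0 0 with hs₁
  have hN₁ : l.expr.eval s₁ = N := by
    have : s₁.nat 0 = s.nat 0 := State.nat_setNat_ne _ hr.symm _ _ _
    rw [← hN]; cases l <;> simp [Limit.expr, this]
  have key := run_loop_induction (O := O) (c := c) (l := l) (s := s₁)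
    (P := .ite b (assign r (.add (.cell r) (.lit 1))) .skip)
    (fun n u => u.nat r 0 0 = #{n ∈ range n | T n}) (by
      rw [loopInit_nat _ _ _ hcr.symm]; simp [hs₁, State.nat_setNat]) (by
      intro n hn u hc hnat hreal hI
      have h1 := h n (by omega) u hc (fun a ha hr =>
          (hnat a (by simp [natWrites, assign, ha, hr])).trans (State.nat_setNat_ne _ hr _ _ _))
        (by funext a; exact hreal a (by simp [realWrites, assign]))
      rw [range_add_one, filter_insert, State.nat_setNat_ne _ hcr.symm]
      by_cases hT : T n
      · rw [if_pos hT, card_insert_of_notMem (by simp), run_ite, if_pos (h1.2 hT)]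
        simp [State.nat_setNat, hI]
      · rw [if_neg hT, run_ite, if_neg (fun h' => hT (h1.1 h'))]
        exact hI)
  rw [hN₁] at key
  exact key

/-- Overwrite the entries of row `0` of an array. -/
def mapLoop (c : ℕ) (l : Limit) (a : ℕ) (b : Test) (e f : NatExpr) : Bounded :=
  .loop c l (.ite b (store a (.cell c) e) (store a (.cell c) f))

/-- The entry about to be overwritten still has its old value, which allows updates in place that
read this entry. -/
theorem run_mapLoop {c : ℕ} {l : Limit} {a : ℕ} {b : Test} {e f : NatExpr} {s : State} {N : ℕ}
    (hca : c ≠ a) (hN : l.expr.eval s = N) (g : ℕ → ℕ)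
    (h : ∀ n < N, ∀ u : State, u.nat c 0 0 = n → (∀ a', a' ≠ c → a' ≠ a → u.nat a' = s.nat a') →
      u.nat a 0 n = s.nat a 0 n → u.real = s.real →
      (if b.Holds u then e.eval u else f.eval u) = g n) (i : ℕ) :
    ((mapLoop c l a b e f).run O s).nat a 0 i = if i < N then g i else s.nat a 0 i := by
  have key := run_loop_induction (O := O) (c := c) (l := l) (s := s)
    (P := .ite b (store a (.cell c) e) (store a (.cell c) f))
    (fun n u => ∀ i, u.nat a 0 i = if i < n then g i else s.nat a 0 i) (by
      intro i
      rw [loopInit_nat _ _ _ hca.symm]; simp) (by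
      intro n hn u hc hnat hreal hI i
      have h1 := h n (by omega) u hc (fun a' ha ha' => hnat a' (by simp [natWrites, store, ha, ha']))
        (by rw [hI]; simp) (by funext a; exact hreal a (by simp [realWrites, store]))
      rw [State.nat_setNat_ne _ hca.symm]
      have h2 : ((ite b (store a (.cell c) e) (store a (.cell c) f)).run O u).nat a 0 i =
          if i = n then g n else u.nat a 0 i := by
        rw [← h1, run_ite]
        split_ifs with h3 h4 h4 <;> simp [State.nat_setNat, hc, h4]
      rw [h2, hI]
      by_cases h3 : i = n
      · subst h3; simp
      · rw [if_neg h3]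
        by_cases h4 : i < n
        · rw [if_pos h4, if_pos (by omega)]
        · rw [if_neg h4, if_neg (by omega)])
  rw [hN] at key
  exact key i

end Bounded

end RealRAM

/-! ### Greedy selection -/

namespace Config

open Finset Classical

/-- The elements of `S` that are taken, in increasing order, until their total value is `t`. -/
noncomputable def greedy (f : ℕ → ℝ) (t : ℝ) (S : Finset ℕ) : Finset ℕ :=
  {w ∈ S | ∑ i ∈ S with i < w, f i < t}

theorem greedy_subset (f : ℕ → ℝ) (t : ℝ) (S : Finset ℕ) : greedy f t S ⊆ S := filter_subset _ _

/-- If something is left out, then all predecessors of the smallest omitted element are taken, and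
their total has already reached `t`. -/
theorem le_sum_greedy {f : ℕ → ℝ} (hf : ∀ w, 0 ≤ f w) {t : ℝ} {S : Finset ℕ}
    (h : t ≤ ∑ w ∈ S, f w) : t ≤ ∑ w ∈ greedy f t S, f w := by
  by_cases hne : (S \ greedy f t S).Nonempty
  · obtain ⟨w, hw, hmin⟩ := exists_min_image (S \ greedy f t S) id hne
    rw [mem_sdiff, greedy, mem_filter, not_and, not_lt] at hw
    refine (hw.2 hw.1).trans (sum_le_sum_of_subset_of_nonneg ?_ fun i _ _ => hf i)
    intro i hi
    rw [mem_filter] at hi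
    by_contra hni
    exact absurd hi.2 (not_lt.2 (hmin i (mem_sdiff.2 ⟨hi.1, hni⟩)))
  · rw [not_nonempty_iff_eq_empty, sdiff_eq_empty_iff_subset] at hne
    rwa [(greedy_subset f t S).antisymm hne]

/-- All taken elements but the largest have total `f`-value below `t`, hence at most that in `g` by
`hfg`, and the last one adds at most `b`. With `cap` as `f` and `p` as `g`, `hfg` holds because
small collections are not affected by the cut-off. -/
theorem sum_greedy_le {f g : ℕ → ℝ} (hg : ∀ w, 0 ≤ g w) {t b : ℝ}
    {S : Finset ℕ} (ht : 0 ≤ t) (hb : 0 ≤ b) (hS : ∀ w ∈ S, g w ≤ b)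
    (hfg : ∀ R ⊆ S, ∑ w ∈ R, f w < t → ∑ w ∈ R, g w ≤ ∑ w ∈ R, f w) :
    ∑ w ∈ greedy f t S, g w ≤ t + b := by
  rcases (greedy f t S).eq_empty_or_nonempty with he | hne
  · rw [he, sum_empty]; positivity
  · obtain ⟨w, hw, hmax⟩ := exists_max_image (greedy f t S) id hne
    have h1 : greedy f t S ⊆ insert w {i ∈ S | i < w} := by
      intro i hi
      rw [mem_insert, mem_filter]
      rcases (hmax i hi).lt_or_eq with h | h
      · exact Or.inr ⟨greedy_subset _ _ _ hi, h⟩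
      · exact Or.inl h
    rw [greedy, mem_filter] at hw
    calc ∑ w ∈ greedy f t S, g w ≤ ∑ i ∈ insert w {i ∈ S | i < w}, g i :=
          sum_le_sum_of_subset_of_nonneg h1 fun i _ _ => hg i
      _ = g w + ∑ i ∈ S with i < w, g i := sum_insert (by simp)
      _ ≤ t + b := by linarith [hS w hw.1, hfg _ (filter_subset _ _) hw.2]

end Config

/-! ### The local search on the machine -/

namespace Config

open Finset Classical

/-- The machine adds the resources of a hyperedge one at a time. -/
theorem addEdge_addEdge (s : Config) (L x : ℕ) (R R' : Finset ℕ) :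
    (s.addEdge L x R).addEdge L x R' = s.addEdge L x (R ∪ R') := by
  simp only [addEdge, Config.mk.injEq, true_and, and_true]
  refine ⟨funext fun c => ?_, funext fun w => ?_, funext fun w => ?_⟩
  · have h3 : (∃ w ∈ R ∪ R', s.own w = c + 1) ↔
        (∃ w ∈ R, s.own w = c + 1) ∨ ∃ w ∈ R', s.own w = c + 1 := by
      simp only [mem_union, or_and_right, exists_or]
    split_ifs with h1 h2 h4 h4 h2 h4 h4
    · rfl
    · exact absurd ⟨h1.1, h3.2 (Or.inl h1.2)⟩ h4
    · rfl
    · exact absurd ⟨h1.1, h3.2 (Or.inl h1.2)⟩ h4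
    · rfl
    · exact absurd ⟨h2.1, h3.2 (Or.inr h2.2)⟩ h4
    · rcases h3.1 h4.2 with h5 | h5
      · exact absurd ⟨h4.1, h5⟩ h1
      · exact absurd ⟨h4.1, h5⟩ h2
    · rfl
  all_goals
    by_cases h1 : w ∈ R <;> by_cases h2 : w ∈ R' <;> simp [h1, h2]

theorem addEdge_empty (s : Config) (L x : ℕ) : s.addEdge L x ∅ = s := by
  simp [addEdge]

end Config

namespace LocalSearch

open RealRAM RealRAM.Bounded Finset Classical

/-- The memory holds the parameters of the problem. -/
structure Memory (A : Problem) (u : State) : Prop where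
  m : u.nat 0 0 0 = A.m
  k : u.nat 0 0 1 = A.k
  adj : ∀ x < A.m, ∀ w < A.k, u.nat 1 x w ≠ 0 ↔ A.adj x w
  cap : ∀ w < A.k, u.real 5 0 w = A.cap w
  v : u.real 4 0 0 = A.v
  ve : u.real 4 0 1 = A.ve
  thr : u.real 4 0 2 = A.e ^ 2 * A.v
  mu : u.real 4 0 3 = A.mu

/-- The oracle answers correctly. -/
def Answers (A : Problem) (O : Set ℕ → Prop) : Prop :=
  ∀ (S : Set ℕ) (I : Finset ℕ), (∀ i, i ∈ I ↔ i < A.m ∧ i ∈ S) → (O S ↔ A.M.Indep ↑I)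

/-- The set of elements that is stored in an array. -/
noncomputable def chosen (A : Problem) (a : ℕ) (u : State) : Finset ℕ :=
  {x ∈ range A.m | u.nat a 0 x ≠ 0}

/-- The configuration in the memory. -/
noncomputable def conf (A : Problem) (u : State) : Config where
  C := chosen A 2 u
  own := u.nat 3 0
  lay := u.nat 4 0
  aL := u.nat 5 0
  aN := u.nat 6 0
  top := u.nat 7 0 0
  b0 := u.nat 8 0

variable {A : Problem} {O : Set ℕ → Prop} {s u : State}

theorem Memory.congr (h : Memory A s) (h0 : u.nat 0 = s.nat 0) (h1 : u.nat 1 = s.nat 1)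
    (h4 : u.real 4 = s.real 4) (h5 : u.real 5 = s.real 5) : Memory A u :=
  ⟨by rw [h0, h.m], by rw [h0, h.k], by rw [h1]; exact h.adj, by rw [h5]; exact h.cap,
    by rw [h4, h.v], by rw [h4, h.ve], by rw [h4, h.thr], by rw [h4, h.mu]⟩

theorem Memory.run (h : Memory A s) (P : Bounded) (h0 : 0 ∉ P.natWrites) (h1 : 1 ∉ P.natWrites)
    (h4 : 4 ∉ P.realWrites) (h5 : 5 ∉ P.realWrites) : Memory A (P.run O s) :=
  h.congr (run_nat P h0 s) (run_nat P h1 s) (run_real P h4 s) (run_real P h5 s)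

theorem Memory.limit (h : Memory A s) (l : Limit) : l.expr.eval s = l.count A.m A.k :=
  l.eval_expr h.m h.k

theorem mem_chosen {a x : ℕ} : x ∈ chosen A a u ↔ x < A.m ∧ u.nat a 0 x ≠ 0 := by
  simp [chosen]

theorem chosen_congr {a : ℕ} (h : u.nat a = s.nat a) : chosen A a u = chosen A a s := by
  rw [chosen, chosen, h]

theorem conf_congr (h : ∀ a, 2 ≤ a → a ≤ 8 → u.nat a = s.nat a) : conf A u = conf A s := by
  simp only [conf, Config.mk.injEq]
  refine ⟨chosen_congr (h 2 ?_ ?_), ?_, ?_, ?_, ?_, ?_, ?_⟩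
  any_goals (rw [h] <;> omega)
  all_goals omega

theorem filter_lt_succ (T : Finset ℕ) (n : ℕ) : ({w ∈ T | w < n + 1} : Finset ℕ) =
    if n ∈ T then insert n {w ∈ T | w < n} else {w ∈ T | w < n} := by
  ext w
  split_ifs with h
  · simp only [mem_filter, mem_insert]
    constructor
    · rintro ⟨h1, h2⟩
      by_cases h3 : w = n
      · exact Or.inl h3
      · exact Or.inr ⟨h1, by omega⟩
    · rintro (rfl | h1)
      · exact ⟨h, by omega⟩
      · exact ⟨h1.1, by omega⟩
  · simp only [mem_filter]
    constructor
    · rintro ⟨h1, h2⟩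
      have : w ≠ n := fun h3 => h (h3 ▸ h1)
      exact ⟨h1, by omega⟩
    · exact fun h1 => ⟨h1.1, by omega⟩

/-! #### Extending an independent set -/

/-- Add an element to the independent set in array `9` if it remains independent. -/
def tryAdd (c : ℕ) : Bounded :=
  .ite (.isZero (.entry 9 (.cell c)))
    (.seq (store 9 (.cell c) (.lit 1))
      (.seq (.query 11 (.lit 0) (.lit 0) 9 (.lit 0))
        (.ite (.isZero (.cell 11)) (store 9 (.cell c) (.lit 0)) .skip)))
    (assign 11 (.lit 0))

/-- The oracle can only be asked about stored sets, so `n` is entered tentatively and erased upon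
refusal. An element already present counts as refused. -/
theorem run_tryAdd (hO : Answers A O) {c n : ℕ} (h9 : c ≠ 9) (h11 : c ≠ 11)
    (hc : s.nat c 0 0 = n) (hn : n < A.m) :
    (n ∉ chosen A 9 s ∧ A.M.Indep ↑(insert n (chosen A 9 s)) ∧
      chosen A 9 ((tryAdd c).run O s) = insert n (chosen A 9 s) ∧
      ((tryAdd c).run O s).nat 11 0 0 = 1) ∨
    (¬ (n ∉ chosen A 9 s ∧ A.M.Indep ↑(insert n (chosen A 9 s))) ∧
      chosen A 9 ((tryAdd c).run O s) = chosen A 9 s ∧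
      ((tryAdd c).run O s).nat 11 0 0 = 0) := by
  by_cases hz : s.nat 9 0 n = 0
  · have hnot : n ∉ chosen A 9 s := by simp [mem_chosen, hz]
    have hset : ∀ i, i ∈ insert n (chosen A 9 s) ↔
        i < A.m ∧ i ∈ {v | (s.setNat 9 0 n 1).nat 9 0 v ≠ 0} := by
      intro i
      by_cases hi : i = n <;> simp [mem_chosen, State.nat_setNat, hi, hn]
    have hans := hO _ _ hset
    by_cases hind : A.M.Indep ↑(insert n (chosen A 9 s))
    · left
      have hq := hans.2 hind
      have hrun : (tryAdd c).run O s = (s.setNat 9 0 n 1).setNat 11 0 0 1 := by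
        simp only [tryAdd, run_ite, Test.holds_isZero, NatExpr.eval_entry, NatExpr.eval_cell, hc, hz,
          if_true, run_seq, run_store, NatExpr.eval_lit, run_query]
        simp only [hq, if_true]
        simp [State.nat_setNat]
      rw [hrun]
      refine ⟨hnot, hind, ?_, by simp [State.nat_setNat]⟩
      ext i
      rw [hset]
      simp [mem_chosen, State.nat_setNat]
    · right
      have hq : ¬ O {v | (s.setNat 9 0 n 1).nat 9 0 v ≠ 0} := fun h => hind (hans.1 h)
      have hrun : (tryAdd c).run O s =
          ((s.setNat 9 0 n 1).setNat 11 0 0 0).setNat 9 0 n 0 := by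
        simp only [tryAdd, run_ite, Test.holds_isZero, NatExpr.eval_entry, NatExpr.eval_cell, hc, hz,
          if_true, run_seq, run_store, NatExpr.eval_lit, run_query]
        simp only [hq, if_false]
        simp [State.nat_setNat, h11, h9, hc]
      rw [hrun]
      refine ⟨fun h => hind h.2, ?_, by simp [State.nat_setNat]⟩
      ext i
      by_cases hi : i = n <;> simp [mem_chosen, State.nat_setNat, hi, hz]
  · right
    have hnot : n ∈ chosen A 9 s := by simp [mem_chosen, hz, hn]
    have hrun : (tryAdd c).run O s = s.setNat 11 0 0 0 := by
      simp [tryAdd, hc, hz]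
    rw [hrun]
    refine ⟨fun h => h.1 hnot, ?_, by simp [State.nat_setNat]⟩
    ext i
    simp [mem_chosen, State.nat_setNat]

/-- Put the chosen elements outside the first `i` layers into array `9`; the number `i` is in array
`17`. -/
def restLoop : Bounded :=
  mapLoop 29 .elements 9 (.and (.not (.isZero (.entry 2 (.cell 29))))
    (.or (.isZero (.entry 4 (.cell 29)))
      (.not (.natLe (.entry 4 (.cell 29)) (.cell 17))))) (.lit 1) (.lit 0)

theorem run_restLoop (hM : Memory A s) :
    chosen A 9 (restLoop.run O s) = (conf A s).rest (s.nat 17 0 0) := by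
  have key := run_mapLoop (O := O) (c := 29) (l := .elements) (a := 9)
    (b := .and (.not (.isZero (.entry 2 (.cell 29)))) (.or (.isZero (.entry 4 (.cell 29)))
      (.not (.natLe (.entry 4 (.cell 29)) (.cell 17))))) (e := .lit 1) (f := .lit 0) (s := s)
    (N := A.m) (by decide) (hM.limit _)
    (fun n => if s.nat 2 0 n ≠ 0 ∧ (s.nat 4 0 n = 0 ∨ ¬ s.nat 4 0 n ≤ s.nat 17 0 0) then 1 else 0)
    (by
      intro n hn u hc hnat _ _
      simp [hc, hnat 2 (by decide) (by decide), hnat 4 (by decide) (by decide),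
        hnat 17 (by decide) (by decide)])
  ext x
  rw [mem_chosen, restLoop, key, Config.mem_rest]
  change _ ↔ x ∈ chosen A 2 s ∧ (s.nat 4 0 x = 0 ∨ _ < s.nat 4 0 x)
  rw [mem_chosen]
  by_cases hx : x < A.m
  · simp only [hx, if_true, true_and, not_le]
    split_ifs with h <;> simp [h]
  · simp [hx]

/-! #### Construction of a layer -/

/-- The test whether the resource in array `21` is unavailable; array `7` of real numbers holds the
value of those resources of its owner that lie in the tree. -/
def usedTest : Test :=
  .or (.not (.isZero (.entry 5 (.cell 21)))) (.and (.not (.isZero (.entry 3 (.cell 21))))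
    (.and (.not (.isZero (.entry 4 (.sub (.entry 3 (.cell 21)) (.lit 1)))))
      (.or (.not (.natEq (.entry 4 (.sub (.entry 3 (.cell 21)) (.lit 1))) (.cell 16)))
        (.realLe (.entry 4 (.lit 2)) (.entry 7 (.lit 0))))))

/-- Add up the value of the resources in the tree that have the same owner as the one in
array `21`. -/
def touchLoop : Bounded :=
  sumLoop 22 .resources 7 (.and (.natEq (.entry 3 (.cell 22)) (.entry 3 (.cell 21)))
    (.not (.isZero (.entry 5 (.cell 22))))) (.entry 5 (.cell 22))

/-- Mark the resource in array `21` in array `15`, if it is available to the element in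
array `20`. -/
def availBody : Bounded :=
  .seq touchLoop
    (.ite (.and (.not (.isZero (.read 1 (.cell 20) (.cell 21)))) (.not usedTest))
      (.seq (store 15 (.cell 21) (.lit 1))
        (storeReal 6 (.lit 0) (.add (.entry 6 (.lit 0)) (.entry 5 (.cell 21)))))
      (store 15 (.cell 21) (.lit 0)))

/-- Mark the resources available to the element in array `20` in array `15`, and add up their
value. -/
def availLoop : Bounded := .seq (storeReal 6 (.lit 0) (.lit 0)) (.loop 21 .resources availBody)

theorem run_touchLoop (hM : Memory A s) {w c : ℕ} (hw : s.nat 21 0 0 = w)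
    (hc : s.nat 3 0 w = c + 1) : (touchLoop.run O s).real 7 0 0 = (conf A s).touch A c := by
  have key := run_sumLoop (O := O) (c := 22) (l := .resources) (r := 7)
    (b := .and (.natEq (.entry 3 (.cell 22)) (.entry 3 (.cell 21)))
      (.not (.isZero (.entry 5 (.cell 22))))) (e := .entry 5 (.cell 22)) (s := s) (N := A.k)
    (hM.limit _) (fun n => s.nat 3 0 n = c + 1 ∧ s.nat 5 0 n ≠ 0) A.cap (by
      intro n hn u hu hnat hreal
      simp [hu, hnat 3 (by decide), hnat 21 (by decide), hnat 5 (by decide), hw, hc,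
        hreal 5 (by decide), hM.cap n hn])
  rw [touchLoop, key, Config.touch, Config.held, filter_filter]
  refine sum_congr ?_ fun _ _ => rfl
  ext w
  simp only [mem_filter, mem_range]
  rfl

/-- For a resource without owner the accumulated value and the decoded owner are meaningless; the
test that the owner cell is nonzero shields against them, and so `h7` is needed only for owned
resources. -/
theorem holds_usedTest (hM : Memory A s) {w : ℕ} (hw : s.nat 21 0 0 = w)
 {s' : State} (hnat : ∀ a, a ≠ 22 → s'.nat a = s.nat a)
    (hreal : s'.real 4 = s.real 4)
    (h7 : ∀ c, s.nat 3 0 w = c + 1 → s'.real 7 0 0 = (conf A s).touch A c) :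
    usedTest.Holds s' ↔ (conf A s).Used A (s.nat 16 0 0) w := by
  simp only [usedTest, Test.holds_or, Test.holds_not, Test.holds_and, Test.holds_isZero,
    Test.holds_natEq, Test.holds_realLe, NatExpr.eval_entry, NatExpr.eval_cell, NatExpr.eval_sub,
    NatExpr.eval_lit, RealExpr.eval_entry, hnat 3 (by decide), hnat 4 (by decide),
    hnat 5 (by decide), hnat 16 (by decide), hnat 21 (by decide), hreal, hM.thr, hw]
  rw [Config.Used]
  refine or_congr Iff.rfl ?_
  change _ ↔ ∃ c, s.nat 3 0 w = c + 1 ∧ s.nat 4 0 c ≠ 0 ∧ (s.nat 4 0 c ≠ _ ∨ _)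
  constructor
  · rintro ⟨h1, h2, h3⟩
    obtain ⟨c, hc⟩ := Nat.exists_eq_succ_of_ne_zero h1
    rw [hc, Nat.succ_sub_one, h7 c hc] at h3
    rw [hc, Nat.succ_sub_one] at h2
    exact ⟨c, hc, h2, h3⟩
  · rintro ⟨c, hc, h2, h3⟩
    rw [h7 c hc, hc, Nat.add_sub_cancel]
    exact ⟨by omega, h2, h3⟩

/-- Availability is recorded for all resources before any of them enters the hyperedge, since each
entry may change `Used`. -/
theorem run_availLoop (hM : Memory A s) {x : ℕ} (hx : s.nat 20 0 0 = x) (hxm : x < A.m) :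
    (availLoop.run O s).real 6 0 0 = ∑ w ∈ (conf A s).avail A (s.nat 16 0 0) x, A.cap w ∧
    ∀ w < A.k, ((availLoop.run O s).nat 15 0 w ≠ 0 ↔ w ∈ (conf A s).avail A (s.nat 16 0 0) x) := by
  set s₁ := s.setReal 6 0 0 0 with hs₁
  set V := (conf A s).avail A (s.nat 16 0 0) x with hV
  have hM₁ : Memory A s₁ := hM.congr rfl rfl (State.real_setReal_ne _ (by decide) _ _ _)
    (State.real_setReal_ne _ (by decide) _ _ _)
  have key := run_loop_induction (O := O) (c := 21) (l := .resources) (s := s₁) (P := availBody)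
    (fun n u => u.real 6 0 0 = ∑ w ∈ V with w < n, A.cap w ∧
      ∀ w < n, (u.nat 15 0 w ≠ 0 ↔ w ∈ V)) (by
      rw [loopInit_real]; simp [hs₁, State.real_setReal]) (by
      intro n hn u hc hnat hreal hI
      rw [hM₁.limit] at hn
      have hMu : Memory A u := hM₁.congr (hnat 0 (by decide)) (hnat 1 (by decide))
        (hreal 4 (by decide)) (hreal 5 (by decide))
      have hconf : conf A u = conf A s :=
        conf_congr fun a h2 h8 => hnat a (by interval_cases a <;> decide)
      set u₁ := touchLoop.run O u with hu₁
      have hnat₁ : ∀ a, a ≠ 22 → u₁.nat a = u.nat a := fun a ha => run_nat _ (by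
        simp [touchLoop, sumLoop, natWrites, storeReal, ha]) u
      have hreal₁ : ∀ a, a ≠ 7 → u₁.real a = u.real a := fun a ha => run_real _ (by
        simp [touchLoop, sumLoop, realWrites, storeReal, ha]) u
      have hused := holds_usedTest hMu hc hnat₁ (hreal₁ 4 (by decide))
        (fun c h => run_touchLoop hMu hc h)
      rw [hconf, show u.nat 16 0 0 = s.nat 16 0 0 by rw [hnat 16 (by decide)]; rfl] at hused
      have hadj : u₁.nat 1 (u₁.nat 20 0 0) (u₁.nat 21 0 0) ≠ 0 ↔ A.adj x n := by
        rw [hnat₁ 1 (by decide), hnat₁ 20 (by decide), hnat₁ 21 (by decide), hc,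
          hnat 20 (by decide)]
        change u.nat 1 (s.nat 20 0 0) n ≠ 0 ↔ _
        rw [hx]
        exact hMu.adj x hxm n hn
      have htest : (Test.and (.not (.isZero (.read 1 (.cell 20) (.cell 21))))
          (.not usedTest)).Holds u₁ ↔ n ∈ V := by
        rw [Test.holds_and, Test.holds_not, Test.holds_not, hused, hV, Config.mem_avail,
          Test.holds_isZero]
        rw [show (NatExpr.read 1 (.cell 20) (.cell 21)).eval u₁ =
          u₁.nat 1 (u₁.nat 20 0 0) (u₁.nat 21 0 0) from rfl, ← ne_eq, hadj]
        tauto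
      have hc₁ : u₁.nat 21 0 0 = n := by rw [hnat₁ 21 (by decide), hc]
      have hrun : availBody.run O u = if n ∈ V then
          (u₁.setNat 15 0 n 1).setReal 6 0 0 (u.real 6 0 0 + A.cap n) else u₁.setNat 15 0 n 0 := by
        rw [availBody, run_seq, run_ite]
        by_cases h : n ∈ V
        · rw [if_pos h, if_pos (htest.2 h)]
          simp only [run_seq, run_store, run_storeReal, NatExpr.eval_cell, NatExpr.eval_lit,
            RealExpr.eval_add, RealExpr.eval_entry, State.real_setNat]
          rw [← hu₁, hc₁, State.nat_setNat_ne _ (by decide), hc₁, hreal₁ 6 (by decide),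
            hreal₁ 5 (by decide), hMu.cap n hn]
        · rw [if_neg h, if_neg (fun h' => h (htest.1 h'))]
          simp only [run_store, NatExpr.eval_cell, NatExpr.eval_lit]
          rw [← hu₁, hc₁]
      have h15 : u₁.nat 15 = u.nat 15 := hnat₁ 15 (by decide)
      rw [State.real_setNat, hrun, filter_lt_succ, State.nat_setNat_ne _ (show (15 : ℕ) ≠ 21 by decide)]
      by_cases h : n ∈ V
      · rw [if_pos h, if_pos h, sum_insert (by simp), State.nat_setReal]
        refine ⟨by simp [State.real_setReal, hI.1, add_comm], fun w hw => ?_⟩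
        by_cases h3 : w = n
        · subst h3; simp [State.nat_setNat, h]
        · rw [State.nat_setNat, if_neg (by simp [h3]), h15]
          exact hI.2 w (by omega)
      · rw [if_neg h, if_neg h, State.real_setNat, hreal₁ 6 (by decide)]
        refine ⟨hI.1, fun w hw => ?_⟩
        by_cases h3 : w = n
        · subst h3; simp [State.nat_setNat, h]
        · rw [State.nat_setNat, if_neg (by simp [h3]), h15]
          exact hI.2 w (by omega))
  rw [hM₁.limit] at key
  have hrun : availLoop.run O s = (loop 21 .resources availBody).run O s₁ := by
    simp [availLoop, hs₁]
  rw [hrun]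
  refine ⟨?_, key.2⟩
  rw [key.1]
  refine sum_congr ?_ fun _ _ => rfl
  exact filter_true_of_mem fun w hw => (Config.mem_avail.1 hw).1

end LocalSearch

namespace LocalSearch

open RealRAM RealRAM.Bounded Finset Classical

variable {A : Problem} {O : Set ℕ → Prop} {s u : State}

theorem conf_setReal (a i j : ℕ) (v : ℝ) : conf A (u.setReal a i j v) = conf A u := rfl

/-- Put the resource in array `23` into the hyperedge of the element in array `20`. -/
def mark : Bounded :=
  .seq (.ite (.and (.not (.isZero (.entry 3 (.cell 23))))
      (.isZero (.entry 4 (.sub (.entry 3 (.cell 23)) (.lit 1)))))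
    (store 4 (.sub (.entry 3 (.cell 23)) (.lit 1)) (.cell 16)) .skip)
    (.seq (store 5 (.cell 23) (.cell 16)) (store 6 (.cell 23) (.cell 20)))

theorem conf_mark {n : ℕ} (hn : u.nat 23 0 0 = n) :
    conf A (mark.run O u) = (conf A u).addEdge (u.nat 16 0 0) (u.nat 20 0 0) {n} := by
  have hrun : mark.run O u = ((if u.nat 3 0 n ≠ 0 ∧ u.nat 4 0 (u.nat 3 0 n - 1) = 0 then
      u.setNat 4 0 (u.nat 3 0 n - 1) (u.nat 16 0 0) else u).setNat 5 0 n (u.nat 16 0 0)).setNat 6 0 n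
        (u.nat 20 0 0) := by
    simp only [mark, run_seq, run_ite, Test.holds_and, Test.holds_not, Test.holds_isZero,
      NatExpr.eval_entry, NatExpr.eval_cell, hn, NatExpr.eval_sub, NatExpr.eval_lit, run_store,
      run_skip]
    split_ifs <;> simp [State.nat_setNat, hn]
  rw [hrun]
  simp only [conf, Config.addEdge, Config.mk.injEq]
  refine ⟨?_, ?_, ?_, ?_, ?_, ?_, ?_⟩
  · refine chosen_congr ?_
    rw [State.nat_setNat_ne _ (by decide), State.nat_setNat_ne _ (by decide)]
    split_ifs
    · rw [State.nat_setNat_ne _ (by decide)]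
    · rfl
  · rw [State.nat_setNat_ne _ (by decide), State.nat_setNat_ne _ (by decide)]
    split_ifs
    · rw [State.nat_setNat_ne _ (by decide)]
    · rfl
  · funext c
    rw [State.nat_setNat_ne _ (by decide), State.nat_setNat_ne _ (by decide)]
    have h1 : (∃ w ∈ ({n} : Finset ℕ), u.nat 3 0 w = c + 1) ↔ u.nat 3 0 n = c + 1 := by simp
    by_cases h3 : u.nat 4 0 c = 0 ∧ u.nat 3 0 n = c + 1
    · refine Eq.trans ?_ (if_pos ⟨h3.1, h1.2 h3.2⟩).symm
      have h4 : u.nat 3 0 n - 1 = c := by omega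
      rw [if_pos ⟨by omega, by rw [h4]; exact h3.1⟩, State.nat_setNat, if_pos ⟨rfl, rfl, h4.symm⟩]
    · refine Eq.trans ?_ (if_neg fun h => h3 ⟨h.1, h1.1 h.2⟩).symm
      by_cases h : u.nat 3 0 n ≠ 0 ∧ u.nat 4 0 (u.nat 3 0 n - 1) = 0
      · rw [if_pos h, State.nat_setNat, if_neg]
        rintro ⟨-, -, h4⟩
        exact h3 ⟨h4 ▸ h.2, by omega⟩
      · rw [if_neg h]
  · funext w
    rw [State.nat_setNat_ne _ (by decide)]
    by_cases h : w = n
    · simp [State.nat_setNat, h]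
    · rw [State.nat_setNat, if_neg (by simp [h])]
      split_ifs <;> simp_all [State.nat_setNat]
  · funext w
    by_cases h : w = n
    · simp [State.nat_setNat, h]
    · rw [State.nat_setNat, if_neg (by simp [h])]
      split_ifs <;> simp_all [State.nat_setNat]
  · rw [State.nat_setNat_ne _ (by decide), State.nat_setNat_ne _ (by decide)]
    split_ifs
    · rw [State.nat_setNat_ne _ (by decide)]
    · rfl
  · rw [State.nat_setNat_ne _ (by decide), State.nat_setNat_ne _ (by decide)]
    split_ifs
    · rw [State.nat_setNat_ne _ (by decide)]
    · rfl

/-- Consider the resource in array `23` for the hyperedge of the element in array `20`. -/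
def edgeBody : Bounded :=
  .ite (.isZero (.entry 15 (.cell 23))) .skip
    (.seq (.ite (.realLe (.entry 4 (.lit 1)) (.entry 6 (.lit 0))) .skip mark)
      (storeReal 6 (.lit 0) (.add (.entry 6 (.lit 0)) (.entry 5 (.cell 23)))))

/-- Choose a hyperedge among the resources marked in array `15`. -/
def edgeLoop : Bounded := .seq (storeReal 6 (.lit 0) (.lit 0)) (.loop 23 .resources edgeBody)

/-- The running total includes the available resources that are passed over as well. It therefore is
the sum of all predecessors that appears in the definition of `greedy`. -/
theorem conf_edgeLoop (hM : Memory A s) {V : Finset ℕ} (hV : ∀ w ∈ V, w < A.k)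
    (h15 : ∀ w < A.k, s.nat 15 0 w ≠ 0 ↔ w ∈ V) :
    conf A (edgeLoop.run O s) =
      (conf A s).addEdge (s.nat 16 0 0) (s.nat 20 0 0) (Config.greedy A.cap A.ve V) := by
  set s₁ := s.setReal 6 0 0 0 with hs₁
  set G := Config.greedy A.cap A.ve V with hG
  have hM₁ : Memory A s₁ := hM.congr rfl rfl (State.real_setReal_ne _ (by decide) _ _ _)
    (State.real_setReal_ne _ (by decide) _ _ _)
  have key := run_loop_induction (O := O) (c := 23) (l := .resources) (s := s₁) (P := edgeBody)
    (fun n u => u.real 6 0 0 = ∑ w ∈ V with w < n, A.cap w ∧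
      conf A u = (conf A s).addEdge (s.nat 16 0 0) (s.nat 20 0 0) {w ∈ G | w < n}) (by
      refine ⟨by rw [loopInit_real]; simp [hs₁, State.real_setReal], ?_⟩
      rw [show ({w ∈ G | w < 0} : Finset ℕ) = ∅ by simp, Config.addEdge_empty]
      exact conf_congr fun a h2 h8 => loopInit_nat _ _ _ (by omega)) (by
      intro n hn u hc hnat hreal hI
      rw [hM₁.limit] at hn
      have hMu : Memory A u := hM₁.congr (hnat 0 (by decide)) (hnat 1 (by decide))
        (hreal 4 (by decide)) (hreal 5 (by decide))
      have h16 : u.nat 16 = s.nat 16 := hnat 16 (by decide)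
      have h20 : u.nat 20 = s.nat 20 := hnat 20 (by decide)
      have hu15 : u.nat 15 0 n ≠ 0 ↔ n ∈ V := by
        rw [hnat 15 (by decide)]; exact h15 n hn
      have hset : ∀ t : State, conf A (t.setNat 23 0 0 (n + 1)) = conf A t := fun t =>
        conf_congr fun a h2 h8 => State.nat_setNat_ne _ (by omega) _ _ _
      rw [State.real_setNat, hset, filter_lt_succ, filter_lt_succ]
      by_cases h : n ∈ V
      · have hnz := hu15.2 h
        have hGn : n ∈ G ↔ ¬ A.ve ≤ u.real 6 0 0 := by
          rw [hG, Config.greedy, mem_filter, hI.1, not_le]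
          exact and_iff_right h
        have hacc : ∑ w ∈ insert n {w ∈ V | w < n}, A.cap w = u.real 6 0 0 + A.cap n := by
          rw [sum_insert (by simp), hI.1, add_comm]
        have hreal₁ : ∀ a, (mark.run O u).real a = u.real a := fun a => run_real _ (by
          simp [mark, realWrites, store]) u
        have hmark23 : (mark.run O u).nat 23 = u.nat 23 := run_nat _ (by decide) u
        have htest : (Test.realLe (.entry 4 (.lit 1)) (.entry 6 (.lit 0))).Holds u ↔ n ∉ G := by
          rw [hGn, not_not, ← hMu.ve]; rfl
        rw [if_pos h, hacc]
        by_cases hg : n ∈ G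
        · have hrun : edgeBody.run O u = (mark.run O u).setReal 6 0 0 (u.real 6 0 0 + A.cap n) := by
            rw [edgeBody, run_ite, if_neg (by simpa [hc] using hnz), run_seq, run_ite,
              if_neg (fun h' => htest.1 h' hg)]
            simp only [run_storeReal, RealExpr.eval_add, RealExpr.eval_entry, NatExpr.eval_lit,
              NatExpr.eval_cell, hreal₁, hmark23, hc, hMu.cap n hn]
          rw [hrun, if_pos hg]
          refine ⟨by simp [State.real_setReal], ?_⟩
          rw [conf_setReal, conf_mark hc, hI.2, h16, h20,
            Config.addEdge_addEdge]
          congr 1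
          ext w; simp
        · have hrun : edgeBody.run O u = u.setReal 6 0 0 (u.real 6 0 0 + A.cap n) := by
            rw [edgeBody, run_ite, if_neg (by simpa [hc] using hnz), run_seq, run_ite,
              if_pos (htest.2 hg)]
            simp only [run_skip, run_storeReal, RealExpr.eval_add, RealExpr.eval_entry,
              NatExpr.eval_lit, NatExpr.eval_cell, hc, hMu.cap n hn]
          rw [hrun, if_neg hg]
          refine ⟨by simp [State.real_setReal], ?_⟩
          rw [conf_setReal, hI.2]
      · have hz : u.nat 15 0 n = 0 := by
          by_contra h'; exact h (hu15.1 h')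
        have hg : n ∉ G := fun hg => h (Config.greedy_subset _ _ _ hg)
        have hrun : edgeBody.run O u = u := by
          rw [edgeBody, run_ite, if_pos (by simpa [hc] using hz), run_skip]
        rw [hrun, if_neg h, if_neg hg]
        exact hI)
  rw [hM₁.limit] at key
  have hrun : edgeLoop.run O s = (loop 23 .resources edgeBody).run O s₁ := by
    simp [edgeLoop, hs₁]
  rw [hrun, key.2]
  congr 1
  exact filter_true_of_mem fun w hw => hV w (Config.greedy_subset _ _ _ hw)

/-- Consider the element in array `20` as a node of the new layer. -/
def growBody : Bounded :=
  .seq availLoop (.ite (.realLe (.entry 4 (.lit 1)) (.entry 6 (.lit 0)))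
    (.seq (tryAdd 20) (.ite (.isZero (.cell 11)) .skip edgeLoop)) .skip)

theorem building_growBody (hA : A.Valid) (hO : Answers A O) {s₀ : Config} (hC : s₀.Covering A)
    {n : ℕ} (hn : n < A.m) (hM : Memory A u) (hc : u.nat 20 0 0 = n)
    (hL : u.nat 16 0 0 = s₀.top + 1)
    (h : Config.Building A s₀ (conf A u) (chosen A 9 u) n) :
    Config.Building A s₀ (conf A (growBody.run O u)) (chosen A 9 (growBody.run O u)) (n + 1) := by
  obtain ⟨hsum, hflag⟩ := run_availLoop (O := O) hM hc hn
  rw [hL] at hsum hflag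
  set u₁ := availLoop.run O u with hu₁
  set V := (conf A u).avail A (s₀.top + 1) n with hV
  have hM₁ : Memory A u₁ := hM.run _ (by decide) (by decide) (by decide) (by decide)
  have hconf₁ : conf A u₁ = conf A u :=
    conf_congr fun a h2 h8 => run_nat _ (by interval_cases a <;> decide) u
  have hZ₁ : chosen A 9 u₁ = chosen A 9 u := chosen_congr (run_nat _ (by decide) u)
  have hc₁ : u₁.nat 20 0 0 = n := by rw [hu₁, run_nat _ (by decide), hc]
  have hL₁ : u₁.nat 16 0 0 = s₀.top + 1 := by rw [hu₁, run_nat _ (by decide), hL]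
  have htest : (Test.realLe (.entry 4 (.lit 1)) (.entry 6 (.lit 0))).Holds u₁ ↔
      A.ve ≤ ∑ w ∈ V, A.cap w := by
    rw [← hsum, ← hM₁.ve]; rfl
  rw [growBody, run_seq, run_ite]
  by_cases hv : A.ve ≤ ∑ w ∈ V, A.cap w
  · rw [if_pos (htest.2 hv), run_seq]
    set u₂ := (tryAdd 20).run O u₁ with hu₂
    have hM₂ : Memory A u₂ := hM₁.run _ (by decide) (by decide) (by decide) (by decide)
    have hconf₂ : conf A u₂ = conf A u := by
      rw [← hconf₁]
      exact conf_congr fun a h2 h8 => run_nat _ (by interval_cases a <;> decide) u₁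
    rcases run_tryAdd hO (c := 20) (by decide) (by decide) hc₁ hn with
      ⟨h1, h2, h3, h4⟩ | ⟨h1, h3, h4⟩
    · rw [hZ₁] at h1 h2 h3
      rw [run_ite, if_neg (by simp [hu₂, h4])]
      have h15 : ∀ w < A.k, u₂.nat 15 0 w ≠ 0 ↔ w ∈ V := by
        rw [hu₂, run_nat _ (by decide)]; exact hflag
      have hedge := conf_edgeLoop (O := O) hM₂ (V := V)
        (fun w hw => (Config.mem_avail.1 hw).1) h15
      have h16 : u₂.nat 16 0 0 = s₀.top + 1 := by rw [hu₂, run_nat _ (by decide), hL₁]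
      have h20 : u₂.nat 20 0 0 = n := by rw [hu₂, run_nat _ (by decide), hc₁]
      rw [h16, h20, hconf₂] at hedge
      rw [hedge, chosen_congr (run_nat edgeLoop (by decide) u₂), h3]
      refine h.add hA hC hn h1 h2 (Config.greedy_subset _ _ _)
        (Config.le_sum_greedy hA.cap_nonneg hv) ?_ ?_
      -- In capped value the last resource overshoots by at most `ve`, in size by at most `pm`.
      · have := Config.sum_greedy_le (f := A.cap) (g := A.cap) hA.cap_nonneg
          (S := V) hA.ve_nonneg hA.ve_nonneg (fun w _ => Problem.cap_le_ve w)
          (fun R _ _ => le_rfl)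
        linarith
      · exact Config.sum_greedy_le hA.p_nonneg hA.ve_nonneg hA.pm_nonneg
          (fun w hw => hA.p_le w (Config.mem_avail.1 hw).1) (fun R _ hR => (hA.sum_p_eq hR).le)
    · rw [hZ₁] at h1 h3
      rw [run_ite, if_pos (by simpa using h4), run_skip, hconf₂, h3]
      exact h.skip hA hn fun h' => h1 h'.2
  · rw [if_neg (fun h' => hv (htest.1 h')), run_skip, hconf₁, hZ₁]
    exact h.skip hA hn fun h' => hv h'.1

/-- Build a new layer. -/
def grow : Bounded :=
  .seq (assign 16 (.add (.cell 7) (.lit 1))) (.seq (assign 17 (.cell 7)) (.seq restLoop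
    (.seq (.loop 20 .elements growBody)
      (.seq (countLoop 24 .elements 13 (.natEq (.entry 4 (.cell 24)) (.cell 16)))
        (.seq (store 8 (.cell 16) (.cell 13)) (assign 7 (.cell 16)))))))

theorem memory_grow (hM : Memory A s) : Memory A (grow.run O s) :=
  hM.run _ (by decide) (by decide) (by decide) (by decide)

theorem grown_grow (hA : A.Valid) (hO : Answers A O) {x : ℕ → ℝ} {y : ℕ → ℕ → ℝ}
    (hxy : A.Fractional x y) (hM : Memory A s) (hI : (conf A s).Inv A)
    (haug : ∃ x < A.m, x ∉ (conf A s).C ∧ A.M.Indep ↑(insert x (conf A s).C)) :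
    (conf A (grow.run O s)).Grown A ∧ (conf A (grow.run O s)).C = (conf A s).C ∧
      (conf A (grow.run O s)).top = (conf A s).top + 1 ∧
      ∀ j ≤ (conf A s).top, (conf A (grow.run O s)).b0 j = (conf A s).b0 j := by
  set s₀ := conf A s with hs₀
  set s₁ := (s.setNat 16 0 0 (s₀.top + 1)).setNat 17 0 0 s₀.top with hs₁
  have hM₁ : Memory A s₁ := hM.congr
    (by rw [hs₁, State.nat_setNat_ne _ (by decide), State.nat_setNat_ne _ (by decide)])
    (by rw [hs₁, State.nat_setNat_ne _ (by decide), State.nat_setNat_ne _ (by decide)]) rfl rfl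
  have hc₁ : conf A s₁ = s₀ := conf_congr fun a h2 h8 => by
    rw [hs₁, State.nat_setNat_ne _ (by omega), State.nat_setNat_ne _ (by omega)]
  set s₂ := restLoop.run O s₁ with hs₂
  have hM₂ : Memory A s₂ := hM₁.run _ (by decide) (by decide) (by decide) (by decide)
  have hc₂ : conf A s₂ = s₀ := by
    rw [← hc₁]
    exact conf_congr fun a h2 h8 => run_nat _ (by interval_cases a <;> decide) s₁
  have hZ₂ : chosen A 9 s₂ = s₀.rest s₀.top := by
    rw [hs₂, run_restLoop hM₁, hc₁]
    congr 1
  have h16 : s₂.nat 16 0 0 = s₀.top + 1 := by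
    rw [hs₂, run_nat _ (by decide)]; simp [hs₁, State.nat_setNat]
  set s₃ := (loop 20 .elements growBody).run O s₂ with hs₃
  have hM₃ : Memory A s₃ := hM₂.run _ (by decide) (by decide) (by decide) (by decide)
  have hB : Config.Building A s₀ (conf A s₃) (chosen A 9 s₃) A.m := by
    have key := run_loop_induction (O := O) (c := 20) (l := .elements) (s := s₂) (P := growBody)
      (fun n u => Config.Building A s₀ (conf A u) (chosen A 9 u) n) (by
        rw [conf_congr (s := s₂) fun a h2 h8 => loopInit_nat _ _ _ (by omega),
          chosen_congr (loopInit_nat 20 .elements s₂ (a := 9) (by decide)), hc₂, hZ₂]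
        exact Config.Building.init hI) (by
        intro n hn u hc hnat hreal hB
        rw [hM₂.limit] at hn
        have hMu : Memory A u := hM₂.congr (hnat 0 (by decide)) (hnat 1 (by decide))
          (hreal 4 (by decide)) (hreal 5 (by decide))
        have := building_growBody hA hO hI.covering hn hMu hc
          (by rw [hnat 16 (by decide), h16]) hB
        rwa [conf_congr (s := growBody.run O u) fun a h2 h8 => State.nat_setNat_ne _ (by omega) _ _ _,
          chosen_congr (State.nat_setNat_ne (growBody.run O u) (show (9 : ℕ) ≠ 20 by decide) _ _ _)])
    rwa [hM₂.limit] at key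
  have h16₃ : s₃.nat 16 0 0 = s₀.top + 1 := by rw [hs₃, run_nat _ (by decide), h16]
  set P := countLoop 24 .elements 13 (.natEq (.entry 4 (.cell 24)) (.cell 16)) with hP
  have hcount : (P.run O s₃).nat 13 0 0 = ((conf A s₃).layer A (s₀.top + 1)).card := by
    rw [hP, run_countLoop (N := A.m) (by decide) (by decide) (hM₃.limit _)
      (fun n => s₃.nat 4 0 n = s₀.top + 1) (by
        intro n hn u hc hnat hreal
        simp [hc, hnat 4 (by decide) (by decide), hnat 16 (by decide) (by decide), h16₃])]
    congr 1
    ext i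
    simp only [mem_filter, mem_range, Config.mem_layer]
    rfl
  have hrun : grow.run O s =
      ((P.run O s₃).setNat 8 0 (s₀.top + 1) ((conf A s₃).layer A (s₀.top + 1)).card).setNat 7 0 0
        (s₀.top + 1) := by
    rw [grow, run_seq, run_seq, run_seq, run_seq, run_seq, run_seq]
    have e1 : (assign 17 (.cell 7)).run O ((assign 16 (.add (.cell 7) (.lit 1))).run O s) = s₁ := by
      simp [hs₁, hs₀, conf, State.nat_setNat]
    rw [e1, ← hs₂, ← hs₃, ← hP]
    have e2 : (P.run O s₃).nat 16 0 0 = s₀.top + 1 := by rw [run_nat _ (by decide), h16₃]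
    simp [State.nat_setNat, e2, hcount]
  have hfin : conf A (grow.run O s) = (conf A s₃).finish A := by
    have htop : (conf A s₃).top = s₀.top := hB.top
    have hPn : ∀ a, 2 ≤ a → a ≤ 8 → (P.run O s₃).nat a = s₃.nat a := fun a h2 h8 =>
      run_nat _ (by interval_cases a <;> decide) s₃
    rw [hrun, Config.finish, htop]
    simp only [conf, Config.mk.injEq]
    refine ⟨chosen_congr ?_, ?_, ?_, ?_, ?_, ?_, ?_⟩
    · rw [State.nat_setNat_ne _ (by decide), State.nat_setNat_ne _ (by decide), hPn 2] <;> omega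
    · rw [State.nat_setNat_ne _ (by decide), State.nat_setNat_ne _ (by decide), hPn 3] <;> omega
    · rw [State.nat_setNat_ne _ (by decide), State.nat_setNat_ne _ (by decide), hPn 4] <;> omega
    · rw [State.nat_setNat_ne _ (by decide), State.nat_setNat_ne _ (by decide), hPn 5] <;> omega
    · rw [State.nat_setNat_ne _ (by decide), State.nat_setNat_ne _ (by decide), hPn 6] <;> omega
    · simp [State.nat_setNat]
    · funext j
      rw [State.nat_setNat_ne _ (by decide), State.nat_setNat, hPn 8 (by omega) (by omega),
        Function.update_apply]
      simp
  rw [hfin]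
  exact hB.grown hA hxy hI le_rfl haug

end LocalSearch

/-! ### Search for a layer that can be collapsed -/

namespace Config

open Finset Classical

variable {A : Problem} {s : Config}

variable (A s) in
/-- Layer `i` is the first one whose addable hyperedges suffice for a collapse, by virtue of `G`. -/
structure Found (Z G : Finset ℕ) (i : ℕ) : Prop where
  pos : 1 ≤ i
  le_top : i ≤ s.top
  addable : G ⊆ s.addable A i
  disjoint : Disjoint (s.rest (i - 1)) G
  card_ge : A.mu * s.beta (i - 1) ≤ G.card
  eq : Z = s.rest (i - 1) ∪ G
  indep : A.M.Indep ↑Z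
  calm : ∀ t, 1 ≤ t → t < i → s.Calm A t

/-- A maximal `G` is also a largest one, because together with `rest` it spans all competitors.
Hence a single greedy pass decides whether the layer is calm. -/
theorem calm_of_maximal (hC : s.Covering A) {G : Finset ℕ} {i : ℕ}
    (hdis : Disjoint (s.rest (i - 1)) G)
    (hmax : ∀ x ∈ s.addable A i, x ∈ A.M.closure ↑(s.rest (i - 1) ∪ G))
    (hlt : (G.card : ℝ) < A.mu * s.beta (i - 1)) : s.Calm A i := by
  intro G' hG' hdis' hind'
  refine lt_of_le_of_lt ?_ hlt
  have h1 := hind'.card_le_of_subset_closure (I := s.rest (i - 1) ∪ G) (by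
    intro x hx
    rw [mem_coe, mem_union] at hx
    rcases hx with hx | hx
    · exact A.M.mem_closure_of_mem' (by rw [mem_coe]; exact mem_union_left _ hx)
        ((hC.rest_indep (i - 1)).subset_ground (by exact_mod_cast hx))
    · exact hmax x (hG' hx))
  rw [card_union_of_disjoint hdis, card_union_of_disjoint hdis'] at h1
  exact_mod_cast (by omega : G'.card ≤ G.card)

end Config

namespace LocalSearch

open RealRAM RealRAM.Bounded Finset Classical

variable {A : Problem} {O : Set ℕ → Prop} {s u : State}

/-- Add up the value of the resources without owner in the hyperedge of the element in array `24`
in the layer in array `18`. -/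
def freeLoop : Bounded :=
  sumLoop 22 .resources 6 (.and (.natEq (.entry 5 (.cell 22)) (.cell 18))
    (.and (.natEq (.entry 6 (.cell 22)) (.cell 24)) (.isZero (.entry 3 (.cell 22)))))
    (.entry 5 (.cell 22))

theorem run_freeLoop (hM : Memory A s) : (freeLoop.run O s).real 6 0 0 =
    ∑ w ∈ (conf A s).freePart A (s.nat 18 0 0) (s.nat 24 0 0), A.cap w := by
  rw [freeLoop, run_sumLoop (N := A.k) (hM.limit _) (fun n => (s.nat 5 0 n = s.nat 18 0 0 ∧
    s.nat 6 0 n = s.nat 24 0 0) ∧ s.nat 3 0 n = 0) A.cap (by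
      intro n hn u hu hnat hreal
      simp [hu, hnat 3 (by decide), hnat 5 (by decide), hnat 6 (by decide), hnat 18 (by decide),
        hnat 24 (by decide), hreal 5 (by decide), hM.cap n hn, and_assoc])]
  refine sum_congr ?_ fun _ _ => rfl
  ext w
  rw [Config.mem_freePart]
  simp only [mem_filter, mem_range]
  exact and_assoc.symm

/-- Consider the element in array `24` as a candidate. -/
def candidateBody : Bounded :=
  .seq (store 10 (.cell 24) (.lit 0)) (.seq freeLoop
    (.ite (.realLe (.entry 4 (.lit 0)) (.entry 6 (.lit 0)))
      (.seq (tryAdd 24) (.ite (.isZero (.cell 11)) .skip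
        (.seq (store 10 (.cell 24) (.lit 1)) (assign 13 (.add (.cell 13) (.lit 1))))))
      .skip))

/-- Select addable hyperedges in the layer in array `18`. -/
def candidateLoop : Bounded :=
  .seq (assign 17 (.sub (.cell 18) (.lit 1))) (.seq restLoop
    (.seq (assign 13 (.lit 0)) (.loop 24 .elements candidateBody)))

theorem run_candidateLoop (hA : A.Valid) (hO : Answers A O) (hM : Memory A s)
    (hC : (conf A s).Covering A) {i : ℕ} (hi : s.nat 18 0 0 = i) {s' : State}
    (hs' : s' = candidateLoop.run O s) :
    chosen A 10 s' ⊆ (conf A s).addable A i ∧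
    Disjoint ((conf A s).rest (i - 1)) (chosen A 10 s') ∧
    chosen A 9 s' = (conf A s).rest (i - 1) ∪ chosen A 10 s' ∧ A.M.Indep ↑(chosen A 9 s') ∧
    s'.nat 13 0 0 = (chosen A 10 s').card ∧
    ∀ x ∈ (conf A s).addable A i, x ∈ A.M.closure ↑(chosen A 9 s') := by
  set K := (conf A s).rest (i - 1) with hK
  set D := (conf A s).addable A i with hD
  set s₁ := s.setNat 17 0 0 (i - 1) with hs₁
  have hM₁ : Memory A s₁ := hM.congr (State.nat_setNat_ne _ (by decide) _ _ _)
    (State.nat_setNat_ne _ (by decide) _ _ _) rfl rfl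
  have hc₁ : conf A s₁ = conf A s :=
    conf_congr fun a h2 h8 => State.nat_setNat_ne _ (by omega) _ _ _
  set s₂ := (restLoop.run O s₁).setNat 13 0 0 0 with hs₂
  have hM₂ : Memory A s₂ :=
    (hM₁.run (O := O) restLoop (by decide) (by decide) (by decide) (by decide)).congr
      (State.nat_setNat_ne _ (by decide) _ _ _) (State.nat_setNat_ne _ (by decide) _ _ _) rfl rfl
  have hc₂ : conf A s₂ = conf A s := by
    rw [← hc₁]
    exact conf_congr fun a h2 h8 => (State.nat_setNat_ne _ (by omega) _ _ _).trans
      (run_nat restLoop (by interval_cases a <;> decide) s₁)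
  have h18₂ : s₂.nat 18 0 0 = i := by
    rw [hs₂, State.nat_setNat_ne _ (by decide), run_nat _ (by decide), hs₁,
      State.nat_setNat_ne _ (by decide), hi]
  have hZ₂ : chosen A 9 s₂ = K := by
    rw [chosen_congr (s := restLoop.run O s₁) (State.nat_setNat_ne _ (by decide) _ _ _),
      run_restLoop hM₁, hc₁]
    simp [hs₁, State.nat_setNat, hK]
  have hKi : A.M.Indep ↑K := hC.rest_indep _
  -- Array `10` may hold stale entries at positions not yet visited, so the invariant refers to the
  -- marks below `n` only.
  have key := run_loop_induction (O := O) (c := 24) (l := .elements) (s := s₂) (P := candidateBody)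
    (fun n u => ∃ G : Finset ℕ, (∀ x, x ∈ G ↔ x ∈ chosen A 10 u ∧ x < n) ∧ G ⊆ D ∧ Disjoint K G ∧
      chosen A 9 u = K ∪ G ∧ A.M.Indep ↑(chosen A 9 u) ∧ u.nat 13 0 0 = G.card ∧
      ∀ x ∈ D, x < n → x ∈ A.M.closure ↑(chosen A 9 u)) (by
      refine ⟨∅, by simp, by simp, by simp, ?_⟩
      rw [chosen_congr (loopInit_nat 24 .elements s₂ (a := 9) (by decide)), hZ₂,
        loopInit_nat _ _ _ (by decide)]
      exact ⟨by simp, hKi, by simp [hs₂, State.nat_setNat], by simp⟩) (by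
      rintro n hn u hc hnat hreal ⟨G, hG, hGD, hKG, hZ, hind, hcard, hmax⟩
      rw [hM₂.limit] at hn
      have hMu : Memory A u := hM₂.congr (hnat 0 (by decide)) (hnat 1 (by decide))
        (hreal 4 (by decide)) (hreal 5 (by decide))
      have hcu : conf A u = conf A s := by
        rw [← hc₂]
        exact conf_congr fun a h2 h8 => hnat a (by interval_cases a <;> decide)
      set u₁ := u.setNat 10 0 n 0 with hu₁
      have hMu₁ : Memory A u₁ := hMu.congr (State.nat_setNat_ne _ (by decide) _ _ _)
        (State.nat_setNat_ne _ (by decide) _ _ _) rfl rfl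
      have hcu₁ : conf A u₁ = conf A s := by
        rw [← hcu]; exact conf_congr fun a h2 h8 => State.nat_setNat_ne _ (by omega) _ _ _
      have h18 : u₁.nat 18 0 0 = i := by
        rw [hu₁, State.nat_setNat_ne _ (by decide), hnat 18 (by decide), h18₂]
      have h24 : u₁.nat 24 0 0 = n := by rw [hu₁, State.nat_setNat_ne _ (by decide), hc]
      have hsum := run_freeLoop (O := O) hMu₁
      rw [h18, h24, hcu₁] at hsum
      set u₂ := freeLoop.run O u₁ with hu₂
      have hn₂ : ∀ a, a ≠ 22 → u₂.nat a = u₁.nat a := fun a ha => run_nat _ (by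
        simp [freeLoop, sumLoop, natWrites, storeReal, ha]) u₁
      have h4 : u₂.real 4 0 0 = A.v := by rw [hu₂, run_real _ (by decide), hMu₁.v]
      have hZ₁ : chosen A 9 u₂ = chosen A 9 u := chosen_congr ((hn₂ 9 (by decide)).trans
        (State.nat_setNat_ne _ (by decide) _ _ _))
      have h10 : ∀ x, u₂.nat 10 0 x = if x = n then 0 else u.nat 10 0 x := fun x => by
        rw [hn₂ 10 (by decide)]; simp [hu₁, State.nat_setNat]
      have h13 : u₂.nat 13 0 0 = G.card := by
        rw [hn₂ 13 (by decide), hu₁, State.nat_setNat_ne _ (by decide), hcard]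
      have h24' : u₂.nat 24 0 0 = n := by rw [hn₂ 24 (by decide), h24]
      have htest : (Test.realLe (.entry 4 (.lit 0)) (.entry 6 (.lit 0))).Holds u₂ ↔ n ∈ D := by
        rw [hD, Config.mem_addable, ← hsum, ← h4]
        exact (and_iff_right hn).symm
      have hrun : candidateBody.run O u = (Bounded.ite
          (.realLe (.entry 4 (.lit 0)) (.entry 6 (.lit 0)))
          (.seq (tryAdd 24) (.ite (.isZero (.cell 11)) .skip
            (.seq (store 10 (.cell 24) (.lit 1)) (assign 13 (.add (.cell 13) (.lit 1))))))
          .skip).run O u₂ := by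
        rw [candidateBody, run_seq, run_seq, run_store]
        simp only [NatExpr.eval_cell, NatExpr.eval_lit, hc]
        rfl
      have hset : ∀ (t : State) a, a ≠ 24 → chosen A a (t.setNat 24 0 0 (n + 1)) = chosen A a t :=
        fun t a ha => chosen_congr (State.nat_setNat_ne _ ha _ _ _)
      rw [hset _ 10 (by decide), hset _ 9 (by decide), State.nat_setNat_ne _ (by decide), hrun,
        run_ite]
      have hsame : ∀ t : State, t.nat 10 = u₂.nat 10 →
          ∀ x, x ∈ G ↔ x ∈ chosen A 10 t ∧ x < n + 1 := by
        intro t ht x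
        rw [hG, mem_chosen, mem_chosen, ht, h10]
        by_cases hx : x = n
        · subst hx; simp
        · rw [if_neg hx]
          refine and_congr_right fun _ => ?_
          omega
      by_cases hnD : n ∈ D
      · rw [if_pos (htest.2 hnD), run_seq]
        set u₃ := (tryAdd 24).run O u₂ with hu₃
        have hn₃ : ∀ a, a ≠ 9 → a ≠ 11 → u₃.nat a = u₂.nat a := fun a h9 h11 => run_nat _ (by
          simp [tryAdd, natWrites, store, assign, h9, h11]) u₂
        rcases run_tryAdd hO (c := 24) (by decide) (by decide) h24' hn with
          ⟨h1, h2, h3, h5⟩ | ⟨h1, h3, h5⟩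
        · rw [hZ₁] at h1 h2 h3
          have hrun₃ : (Bounded.ite (.isZero (.cell 11)) .skip
            (.seq (store 10 (.cell 24) (.lit 1)) (assign 13 (.add (.cell 13) (.lit 1))))).run O u₃ =
            (u₃.setNat 10 0 n 1).setNat 13 0 0 (G.card + 1) := by
            rw [run_ite, if_neg (by simp [hu₃, h5])]
            simp [hn₃, State.nat_setNat, h24', h13]
          rw [hrun₃, chosen_congr (u := (u₃.setNat 10 0 n 1).setNat 13 0 0 (G.card + 1)) (a := 9)
            (s := u₃) (by rw [State.nat_setNat_ne _ (by decide), State.nat_setNat_ne _ (by decide)]),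
            h3]
          have hnG : n ∉ G := fun h => by have := (hG n).1 h; omega
          have hnK : n ∉ K := fun h => h1 (by rw [hZ]; exact mem_union_left _ h)
          refine ⟨insert n G, ?_, insert_subset hnD hGD, ?_, ?_, h2, ?_, ?_⟩
          · intro x
            rw [mem_insert, hG, mem_chosen, mem_chosen, State.nat_setNat_ne _ (by decide),
              State.nat_setNat, hn₃ 10 (by decide) (by decide), h10]
            by_cases hx : x = n
            · subst hx; simp; exact hn
            · simp only [hx, false_or, and_false, if_false]
              refine and_congr_right fun _ => ?_
              omega
          · rw [disjoint_insert_right]; exact ⟨hnK, hKG⟩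
          · rw [hZ, union_insert]
          · rw [card_insert_of_notMem hnG]; simp [State.nat_setNat]
          · intro x hx hxn
            by_cases h : x = n
            · subst h
              exact A.M.mem_closure_of_mem' (by simp) (hA.mem_ground.2 hn)
            · exact A.M.closure_subset_closure (by exact_mod_cast subset_insert _ _)
                (hmax x hx (by omega))
        · rw [hZ₁] at h1 h3
          rw [run_ite, if_pos (by simpa using h5), run_skip, h3]
          refine ⟨G, hsame _ (hn₃ 10 (by decide) (by decide)), hGD, hKG, hZ, hind, ?_, ?_⟩
          · rw [hn₃ 13 (by decide) (by decide), h13]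
          · intro x hx hxn
            by_cases h : x = n
            · subst h
              exact Matroid.mem_closure_of_not_indep_insert hind (hA.mem_ground.2 hn) h1
            · exact hmax x hx (by omega)
      · rw [if_neg (fun h => hnD (htest.1 h)), run_skip, hZ₁]
        refine ⟨G, hsame _ rfl, hGD, hKG, hZ, hind, h13, fun x hx hxn => hmax x hx ?_⟩
        have : x ≠ n := fun h => hnD (h ▸ hx)
        omega)
  rw [hM₂.limit] at key
  have hrun : candidateLoop.run O s = (loop 24 .elements candidateBody).run O s₂ := by
    rw [candidateLoop, run_seq, run_seq, run_seq, run_assign, run_assign]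
    simp only [NatExpr.eval_sub, NatExpr.eval_cell, NatExpr.eval_lit, hi]
    rfl
  rw [← hrun, ← hs'] at key
  obtain ⟨G, hG, h1, h2, h3, h4, h5, h6⟩ := key
  obtain rfl : G = chosen A 10 s' := by
    ext x
    rw [hG]
    exact ⟨fun h => h.1, fun h => ⟨h, (mem_chosen.1 h).1⟩⟩
  exact ⟨h1, h2, h3, h4, h5, fun x hx => h6 x hx (Config.mem_addable.1 hx).1⟩

/-- Consider the layer in array `23` for a collapse. -/
def searchBody : Bounded :=
  .ite (.and (.isZero (.cell 12)) (.and (.natLe (.lit 1) (.cell 23)) (.natLe (.cell 23) (.cell 7))))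
    (.seq (assign 18 (.cell 23)) (.seq candidateLoop
      (.ite (.realLe (.mul (.entry 4 (.lit 3)) (.ofNat (.cell 14))) (.ofNat (.cell 13)))
        (assign 12 (.cell 23)) (assign 14 (.add (.cell 14) (.entry 8 (.cell 23)))))))
    .skip

/-- Search for a layer with enough addable hyperedges; array `12` is the first one, or zero. -/
def search : Bounded :=
  .seq (assign 12 (.lit 0)) (.seq (assign 14 (.lit 1)) (.loop 23 .layers searchBody))

theorem memory_search (hM : Memory A s) : Memory A (search.run O s) :=
  hM.run _ (by decide) (by decide) (by decide) (by decide)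

theorem conf_search : conf A (search.run O s) = conf A s :=
  conf_congr fun a h2 h8 => run_nat _ (by interval_cases a <;> decide) s

/-- The layers are tried from below, so those before the one found are calm. This calmness is needed
to see that the layer to which the tree is cut back was large. -/
theorem run_search (hA : A.Valid) (hO : Answers A O) (hM : Memory A s)
    (hC : (conf A s).Covering A) (htop : (conf A s).top ≤ A.m + 1) {s' : State}
    (hs' : s' = search.run O s) :
    (s'.nat 12 0 0 = 0 ∧ ∀ j, 1 ≤ j → j ≤ (conf A s).top → (conf A s).Calm A j) ∨
      (conf A s).Found A (chosen A 9 s') (chosen A 10 s') (s'.nat 12 0 0) := by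
  set c := conf A s with hcdef
  set s₁ := (s.setNat 12 0 0 0).setNat 14 0 0 1 with hs₁
  have hM₁ : Memory A s₁ := hM.congr
    (by rw [hs₁, State.nat_setNat_ne _ (by decide), State.nat_setNat_ne _ (by decide)])
    (by rw [hs₁, State.nat_setNat_ne _ (by decide), State.nat_setNat_ne _ (by decide)]) rfl rfl
  have hc₁ : conf A s₁ = c := conf_congr fun a h2 h8 => by
    rw [hs₁, State.nat_setNat_ne _ (by omega), State.nat_setNat_ne _ (by omega)]
  have key := run_loop_induction (O := O) (c := 23) (l := .layers) (s := s₁) (P := searchBody)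
    -- The counter starts at `0` but layers start at `1`, whence `n - 1`; the minimum accounts for
    -- the iterations beyond the last layer, which are idle.
    (fun n u => (u.nat 12 0 0 = 0 ∧ u.nat 14 0 0 = c.beta (min (n - 1) c.top) ∧
        ∀ j, 1 ≤ j → j < n → j ≤ c.top → c.Calm A j) ∨
      c.Found A (chosen A 9 u) (chosen A 10 u) (u.nat 12 0 0)) (by
      left
      rw [loopInit_nat _ _ _ (by decide), loopInit_nat _ _ _ (by decide)]
      refine ⟨by simp [hs₁, State.nat_setNat], by simp [hs₁, State.nat_setNat, Config.beta], ?_⟩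
      intro j h1 h2
      omega) (by
      intro n hn u hc hnat hreal hI
      have hMu : Memory A u := hM₁.congr (hnat 0 (by decide)) (hnat 1 (by decide))
        (hreal 4 (by decide)) (hreal 5 (by decide))
      have hcu : conf A u = c := by
        rw [← hc₁]
        exact conf_congr fun a h2 h8 => hnat a (by interval_cases a <;> decide)
      have hset : ∀ (t : State) a, a ≠ 23 → chosen A a (t.setNat 23 0 0 (n + 1)) = chosen A a t :=
        fun t a ha => chosen_congr (State.nat_setNat_ne _ ha _ _ _)
      rw [hset _ 10 (by decide), hset _ 9 (by decide), State.nat_setNat_ne _ (by decide),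
        State.nat_setNat_ne _ (by decide)]
      have h7 : u.nat 7 0 0 = c.top := by rw [← hcu]; rfl
      rcases hI with ⟨h12, h14, hcalm⟩ | hF
      · by_cases ht : 1 ≤ n ∧ n ≤ c.top
        · set u₁ := u.setNat 18 0 0 n with hu₁
          have hMu₁ : Memory A u₁ := hMu.congr (State.nat_setNat_ne _ (by decide) _ _ _)
            (State.nat_setNat_ne _ (by decide) _ _ _) rfl rfl
          have hcu₁ : conf A u₁ = c := by
            rw [← hcu]; exact conf_congr fun a h2 h8 => State.nat_setNat_ne _ (by omega) _ _ _
          obtain ⟨h1, h2, h3, h4, h5, h6⟩ := run_candidateLoop hA hO hMu₁ (by rw [hcu₁]; exact hC)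
            (i := n) (by simp [hu₁, State.nat_setNat]) (s' := candidateLoop.run O u₁) rfl
          rw [hcu₁] at h1 h2 h3 h6
          set u₂ := candidateLoop.run O u₁ with hu₂
          have hn₂ : ∀ a, a = 7 ∨ a = 8 ∨ a = 12 ∨ a = 14 ∨ a = 23 → u₂.nat a = u.nat a := by
            intro a ha
            rw [hu₂, run_nat _ (by rcases ha with rfl | rfl | rfl | rfl | rfl <;> decide), hu₁,
              State.nat_setNat_ne _ (by omega)]
          have hmu : u₂.real 4 0 3 = A.mu := by rw [hu₂, run_real _ (by decide), hMu₁.mu]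
          have hbeta : u₂.nat 14 0 0 = c.beta (n - 1) := by
            rw [hn₂ 14 (by simp), h14, min_eq_left (by omega)]
          have htest : (Test.realLe (.mul (.entry 4 (.lit 3)) (.ofNat (.cell 14)))
              (.ofNat (.cell 13))).Holds u₂ ↔
              A.mu * c.beta (n - 1) ≤ (chosen A 10 u₂).card := by
            rw [← h5, ← hbeta, ← hmu]; rfl
          have hrun : searchBody.run O u = (Bounded.ite
              (.realLe (.mul (.entry 4 (.lit 3)) (.ofNat (.cell 14))) (.ofNat (.cell 13)))
              (assign 12 (.cell 23)) (assign 14 (.add (.cell 14) (.entry 8 (.cell 23))))).run O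
              u₂ := by
            rw [searchBody, run_ite, if_pos (by simp [h12, hc, h7, ht]), run_seq, run_seq,
              run_assign]
            simp only [NatExpr.eval_cell, hc]
            rfl
          rw [hrun, run_ite]
          have h23 : u₂.nat 23 0 0 = n := by rw [hn₂ 23 (by simp), hc]
          by_cases hcard : A.mu * c.beta (n - 1) ≤ (chosen A 10 u₂).card
          · right
            rw [if_pos (htest.2 hcard), run_assign,
              chosen_congr (State.nat_setNat_ne u₂ (show (9 : ℕ) ≠ 12 by decide) _ _ _),
              chosen_congr (State.nat_setNat_ne u₂ (show (10 : ℕ) ≠ 12 by decide) _ _ _)]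
            have e1 : (u₂.setNat 12 0 0 ((NatExpr.cell 23).eval u₂)).nat 12 0 0 = n := by
              simp [State.nat_setNat, h23]
            rw [e1]
            exact ⟨ht.1, ht.2, h1, h2, hcard, h3, h4, fun t h8 h9 => hcalm t h8 h9 (by omega)⟩
          · left
            rw [if_neg (fun h => hcard (htest.1 h)), run_assign]
            refine ⟨?_, ?_, ?_⟩
            · rw [State.nat_setNat_ne _ (by decide), hn₂ 12 (by simp), h12]
            · rw [State.nat_setNat, if_pos ⟨rfl, rfl, rfl⟩]
              simp only [NatExpr.eval_add, NatExpr.eval_cell, NatExpr.eval_entry, hbeta, h23,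
                hn₂ 8 (by simp)]
              rw [show u.nat 8 0 n = c.b0 n by rw [← hcu]; rfl, min_eq_left (by omega),
                Nat.add_sub_cancel]
              obtain ⟨n, rfl⟩ := Nat.exists_eq_add_of_le' ht.1
              rw [Config.beta_succ, Nat.add_sub_cancel]
            · intro j h7 h8 h9
              by_cases hj : j = n
              · subst hj
                exact Config.calm_of_maximal hC h2 (h3 ▸ h6) (not_le.1 hcard)
              · exact hcalm j h7 (by omega) h9
        · left
          have hrun : searchBody.run O u = u := by
            rw [searchBody, run_ite, if_neg (by simp [h12, hc, h7]; omega), run_skip]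
          rw [hrun]
          refine ⟨h12, ?_, fun j h1 h2 h3 => hcalm j h1 (by omega) h3⟩
          rw [h14]
          congr 1
          omega
      -- After a success the body does nothing, so arrays `9` and `10` still describe the layer
      -- found.
      · right
        have hrun : searchBody.run O u = u := by
          rw [searchBody, run_ite, if_neg (by have := hF.pos; simp; omega), run_skip]
        rw [hrun]
        exact hF)
  rw [hM₁.limit] at key
  have hrun : search.run O s = (loop 23 .layers searchBody).run O s₁ := rfl
  rw [← hrun, ← hs'] at key
  refine key.imp_left fun h => ⟨h.1, fun j h1 h2 => h.2.2 j h1 ?_ h2⟩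
  rw [Limit.count]
  omega

end LocalSearch

/-! ### Retaining elements of the lower layers in a collapse -/

namespace Config

open Finset Classical

variable {A : Problem} {s : Config}

theorem rest_antitone {i j : ℕ} (h : i ≤ j) : s.rest j ⊆ s.rest i := by
  intro c hc
  rw [mem_rest] at hc ⊢
  exact ⟨hc.1, by have := hc.2; omega⟩

variable (A s) in
/-- The situation when the layers from `i - 1` down to `j + 1`, and the elements below `n` of
layer `j`, have been added to `Z` as far as possible. -/
structure Refill (G : Finset ℕ) (i j n : ℕ) (Z : Finset ℕ) : Prop where
  indep : A.M.Indep ↑Z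
  rest_subset : s.rest (i - 1) ⊆ Z
  G_subset : G ⊆ Z
  subset : ∀ z ∈ Z, z ∈ G ∨ z ∈ s.rest (j - 1)
  closure : ∀ c, 1 ≤ s.lay c → s.lay c < i → j < s.lay c ∨ s.lay c = j ∧ c < n → c ∉ Z →
    c ∈ A.M.closure ↑({z ∈ Z | z ∈ G ∨ z ∈ s.rest (s.lay c - 1)} : Finset ℕ)

theorem Found.refill {Z G : Finset ℕ} {i : ℕ} (h : s.Found A Z G i) :
    s.Refill A G i (i - 1) 0 Z where
  indep := h.indep
  rest_subset := by rw [h.eq]; exact subset_union_left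
  G_subset := by rw [h.eq]; exact subset_union_right
  subset z hz := by
    rw [h.eq, mem_union] at hz
    rcases hz with hz | hz
    · exact Or.inr (rest_antitone (by omega) hz)
    · exact Or.inl hz
  closure c h1 h2 h3 := by omega

theorem Refill.next {Z G : Finset ℕ} {i j : ℕ} (hm : ∀ c, s.lay c ≠ 0 → c < A.m)
    (h : s.Refill A G i j A.m Z) : s.Refill A G i (j - 1) 0 Z where
  indep := h.indep
  rest_subset := h.rest_subset
  G_subset := h.G_subset
  subset z hz := (h.subset z hz).imp_right fun h' => rest_antitone (by omega) h'
  closure c h1 h2 h3 := h.closure c h1 h2 (by have := hm c (by omega); omega)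

theorem Refill.skip {Z G : Finset ℕ} {i j n : ℕ} (h : s.Refill A G i j n Z) (hn : s.lay n ≠ j) :
    s.Refill A G i j (n + 1) Z where
  indep := h.indep
  rest_subset := h.rest_subset
  G_subset := h.G_subset
  subset := h.subset
  closure c h1 h2 h3 := h.closure c h1 h2 (by
    rcases h3 with h3 | ⟨h3, h4⟩
    · exact Or.inl h3
    · have : c ≠ n := fun h' => hn (h' ▸ h3)
      exact Or.inr ⟨h3, by omega⟩)

/-- While layer `j` is processed, `Z` contains nothing from the layers below `j`, so a rejection is
caused by `G` and elements of layer `j` or later. Additions from lower layers are made afterwards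
and do not affect this. Here the order from top to bottom is indispensable. -/
theorem Refill.reject {Z G : Finset ℕ} {i j n : ℕ} (h : s.Refill A G i j n Z) (hlay : s.lay n = j)
    (hnE : n ∈ A.M.E) (hn : ¬ (n ∉ Z ∧ A.M.Indep ↑(insert n Z))) :
    s.Refill A G i j (n + 1) Z where
  indep := h.indep
  rest_subset := h.rest_subset
  G_subset := h.G_subset
  subset := h.subset
  closure c h1 h2 h3 hc := by
    by_cases hcn : c = n
    · subst hcn
      rw [hlay, filter_true_of_mem h.subset]
      exact Matroid.mem_closure_of_not_indep_insert h.indep hnE hn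
    · exact h.closure c h1 h2 (by omega) hc

theorem Refill.accept {Z G : Finset ℕ} {i j n : ℕ} (h : s.Refill A G i j n Z) (hj : 1 ≤ j)
    (hlay : s.lay n = j) (hnC : n ∈ s.C) (hn : A.M.Indep ↑(insert n Z)) :
    s.Refill A G i j (n + 1) (insert n Z) where
  indep := hn
  rest_subset := h.rest_subset.trans (subset_insert _ _)
  G_subset := h.G_subset.trans (subset_insert _ _)
  subset z hz := by
    rw [mem_insert] at hz
    rcases hz with rfl | hz
    · exact Or.inr (mem_rest.2 ⟨hnC, by omega⟩)
    · exact h.subset z hz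
  closure c h1 h2 h3 hc := by
    rw [mem_insert, not_or] at hc
    exact A.M.closure_subset_closure
      (by exact_mod_cast filter_subset_filter _ (subset_insert _ _))
      (h.closure c h1 h2 (by have := hc.1; omega) hc.2)

theorem Refill.exchange {Z Z₀ G : Finset ℕ} {i n : ℕ} (hF : s.Found A Z₀ G i)
    (h : s.Refill A G i 0 n Z) : s.Exchange A Z G i where
  pos := hF.pos
  le_top := hF.le_top
  addable := hF.addable
  disjoint := hF.disjoint
  card_ge := hF.card_ge
  indep := h.indep
  rest_subset := h.rest_subset
  G_subset := h.G_subset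
  subset z hz := by
    rw [mem_union]
    rcases h.subset z hz with h' | h'
    · exact Or.inr h'
    · exact Or.inl (mem_rest.1 h').1
  closure c h1 h2 := h.closure c h1 h2 (by omega)

end Config

namespace LocalSearch

open RealRAM RealRAM.Bounded Finset Classical

variable {A : Problem} {O : Set ℕ → Prop} {s u : State}

/-- Try to keep the element in array `26` if it belongs to the layer in array `18`. -/
def refillBody : Bounded := .ite (.natEq (.entry 4 (.cell 26)) (.cell 18)) (tryAdd 26) .skip

/-- Try to keep the elements of the layers below the one in array `12`, beginning with the last
layer. -/
def refill : Bounded :=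
  .loop 25 .layers (.seq (assign 18 (.sub (.sub (.cell 12) (.lit 1)) (.cell 25)))
    (.ite (.isZero (.cell 18)) .skip (.loop 26 .elements refillBody)))

theorem run_refillLayer (hA : A.Valid) (hO : Answers A O) (hM : Memory A s)
    (hF : (conf A s).Forest A (conf A s).top) {G : Finset ℕ} {i j : ℕ} (hj : 1 ≤ j)
    (h18 : s.nat 18 0 0 = j) (h : (conf A s).Refill A G i j 0 (chosen A 9 s)) :
    (conf A s).Refill A G i j A.m (chosen A 9 ((loop 26 .elements refillBody).run O s)) := by
  have key := run_loop_induction (O := O) (c := 26) (l := .elements) (s := s) (P := refillBody)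
    (fun n u => (conf A s).Refill A G i j n (chosen A 9 u)) (by
      rwa [chosen_congr (loopInit_nat 26 .elements s (a := 9) (by decide))]) (by
      intro n hn u hc hnat hreal hI
      rw [hM.limit] at hn
      rw [chosen_congr (State.nat_setNat_ne (refillBody.run O u) (show (9 : ℕ) ≠ 26 by decide) _ _ _)]
      have h4 : u.nat 4 0 n = (conf A s).lay n := by rw [hnat 4 (by decide)]; rfl
      have h18u : u.nat 18 0 0 = j := by rw [hnat 18 (by decide), h18]
      rw [refillBody, run_ite]
      by_cases hl : (conf A s).lay n = j
      · rw [if_pos (by simp [hc, h4, h18u, hl])]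
        rcases run_tryAdd hO (c := 26) (by decide) (by decide) hc hn with
          ⟨h1, h2, h3, h5⟩ | ⟨h1, h3, h5⟩
        · rw [h3]
          exact hI.accept hj hl (hF.lay n (by omega)).1 h2
        · rw [h3]
          exact hI.reject hl (hA.mem_ground.2 hn) h1
      · rw [if_neg (by simp [hc, h4, h18u, hl]), run_skip]
        exact hI.skip hl)
  rwa [hM.limit] at key

theorem run_refill (hA : A.Valid) (hO : Answers A O) (hM : Memory A s)
    (hC : (conf A s).Covering A) (hF : (conf A s).Forest A (conf A s).top)
    (htop : (conf A s).top ≤ A.m + 1) {i : ℕ} (h12 : s.nat 12 0 0 = i)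
    (h : (conf A s).Found A (chosen A 9 s) (chosen A 10 s) i) :
    (conf A s).Exchange A (chosen A 9 (refill.run O s)) (chosen A 10 s) i := by
  set c := conf A s with hcdef
  have hm : ∀ x, c.lay x ≠ 0 → x < A.m := fun x hx =>
    mem_range.1 (hA.subset_range hC.indep (hF.lay x hx).1)
  have key := run_loop_induction (O := O) (c := 25) (l := .layers) (s := s)
    (P := .seq (assign 18 (.sub (.sub (.cell 12) (.lit 1)) (.cell 25)))
      (.ite (.isZero (.cell 18)) .skip (.loop 26 .elements refillBody)))
    (fun n u => c.Refill A (chosen A 10 s) i (i - 1 - n) 0 (chosen A 9 u)) (by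
      rw [chosen_congr (loopInit_nat 25 .layers s (a := 9) (by decide))]
      exact h.refill) (by
      intro n hn u hc hnat hreal hI
      have hMu : Memory A u := hM.congr (hnat 0 (by decide)) (hnat 1 (by decide))
        (hreal 4 (by decide)) (hreal 5 (by decide))
      have hcu : conf A u = c :=
        conf_congr fun a h2 h8 => hnat a (by interval_cases a <;> decide)
      set u₁ := u.setNat 18 0 0 (i - 1 - n) with hu₁
      have hMu₁ : Memory A u₁ := hMu.congr (State.nat_setNat_ne _ (by decide) _ _ _)
        (State.nat_setNat_ne _ (by decide) _ _ _) rfl rfl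
      have hcu₁ : conf A u₁ = c := by
        rw [← hcu]; exact conf_congr fun a h2 h8 => State.nat_setNat_ne _ (by omega) _ _ _
      have hZ₁ : chosen A 9 u₁ = chosen A 9 u :=
        chosen_congr (State.nat_setNat_ne _ (by decide) _ _ _)
      have h18 : u₁.nat 18 0 0 = i - 1 - n := by simp [hu₁, State.nat_setNat]
      have hrun : (Bounded.seq (assign 18 (.sub (.sub (.cell 12) (.lit 1)) (.cell 25)))
          (.ite (.isZero (.cell 18)) .skip (.loop 26 .elements refillBody))).run O u =
          (Bounded.ite (.isZero (.cell 18)) .skip (.loop 26 .elements refillBody)).run O u₁ := by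
        rw [run_seq, run_assign]
        simp only [NatExpr.eval_sub, NatExpr.eval_cell, NatExpr.eval_lit, hc, hnat 12 (by decide), h12]
        rfl
      rw [chosen_congr (State.nat_setNat_ne _ (show (9 : ℕ) ≠ 25 by decide) _ _ _), hrun, run_ite]
      by_cases hz : i - 1 - n = 0
      · rw [if_pos (by simpa [h18] using hz), run_skip, hZ₁]
        rw [hz] at hI
        rwa [show i - 1 - (n + 1) = 0 by omega]
      · rw [if_neg (by simpa [h18] using hz)]
        have := run_refillLayer hA hO hMu₁ (by rw [hcu₁]; exact hF) (by omega) h18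
          (G := chosen A 10 s) (i := i) (by rw [hcu₁, hZ₁]; exact hI)
        rw [hcu₁] at this
        exact this.next hm)
  -- Since `i ≤ m + 1`, the loop has enough iterations; truncated subtraction gives `0` in the
  -- superfluous ones, and these are skipped.
  rw [hM.limit, Limit.count, show i - 1 - (A.m + 2) = 0 by have := h.le_top; omega] at key
  exact key.exchange h

/-- Mark the elements that give up their resources in array `28`. -/
def hits : Bounded :=
  mapLoop 29 .elements 28 (.and (.not (.isZero (.entry 4 (.cell 29))))
    (.and (.not (.natLe (.cell 12) (.entry 4 (.cell 29))))
      (.or (.isZero (.entry 9 (.cell 29))) (.not (.isZero (.entry 10 (.cell 29)))))))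
    (.lit 1) (.lit 0)

theorem run_hits (hM : Memory A s) {x : ℕ} (hx : x < A.m) : (hits.run O s).nat 28 0 x ≠ 0 ↔
    (conf A s).Hit (chosen A 9 s) (chosen A 10 s) (s.nat 12 0 0) x := by
  rw [hits, run_mapLoop (N := A.m) (by decide) (hM.limit _)
    (fun n => if s.nat 4 0 n ≠ 0 ∧ ¬ s.nat 12 0 0 ≤ s.nat 4 0 n ∧
      (s.nat 9 0 n = 0 ∨ s.nat 10 0 n ≠ 0) then 1 else 0) (by
      intro n hn u hc hnat _ _
      simp [hc, hnat 4 (by decide) (by decide), hnat 9 (by decide) (by decide),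
        hnat 10 (by decide) (by decide), hnat 12 (by decide) (by decide)]), if_pos hx]
  rw [Config.Hit, mem_chosen, mem_chosen, Nat.one_le_iff_ne_zero]
  simp only [hx, true_and, not_not, not_le]
  split_ifs with h
  · exact ⟨fun _ => h, fun _ => one_ne_zero⟩
  · exact ⟨fun h' => absurd rfl h', fun h' => absurd h' h⟩

/-- Determine in array `19` the layer that becomes the last one, and record its size. -/
def selectBody : Bounded :=
  .ite (.and (.natLe (.cell 32) (.cell 33)) (.and (.isZero (.cell 19))
      (.and (.natLe (.lit 1) (.cell 23)) (.not (.natLe (.cell 12) (.cell 23))))))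
    (.seq (countLoop 29 .elements 13 (.and (.natEq (.entry 4 (.cell 29)) (.cell 23))
        (.and (.not (.isZero (.entry 9 (.cell 29)))) (.isZero (.entry 10 (.cell 29))))))
      (.ite (.realLe (.sub (.ofNat (.entry 8 (.cell 23))) (.ofNat (.cell 13)))
        (.mul (.entry 4 (.lit 3)) (.ofNat (.entry 8 (.cell 23))))) .skip
        (.seq (assign 19 (.cell 23)) (store 8 (.cell 23) (.cell 13)))))
    .skip

/-- Select the first layer that is hit hard, if the number of chosen elements does not increase. -/
def select : Bounded :=
  .seq (countLoop 29 .elements 32 (.not (.isZero (.entry 9 (.cell 29)))))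
    (.seq (countLoop 29 .elements 33 (.not (.isZero (.entry 2 (.cell 29)))))
      (.seq (assign 19 (.lit 0)) (.loop 23 .layers selectBody)))

theorem run_chosenCount (hM : Memory A s) {a r : ℕ} (ha : a ≠ 29) (hr : r ≠ 29) (har : a ≠ r)
    (hr0 : r ≠ 0) :
    ((countLoop 29 .elements r (.not (.isZero (.entry a (.cell 29))))).run O s).nat r 0 0 =
      (chosen A a s).card := by
  rw [run_countLoop (N := A.m) hr.symm hr0 (hM.limit _) (fun n => s.nat a 0 n ≠ 0) (by
    intro n hn u hc hnat hreal
    simp [hc, hnat a ha har])]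
  congr 1
  ext x
  simp only [mem_filter, mem_range, mem_chosen]

/-- The value `j = 0` covers two cases, a larger chosen set and the absence of a layer that is hit
hard. The latter is ruled out later by `Exchange.exists_layer`. -/
theorem run_select (hM : Memory A s) {i : ℕ} (h12 : s.nat 12 0 0 = i) (hi : i ≤ A.m + 2)
    {Z G : Finset ℕ} (hZ : chosen A 9 s = Z) (hG : chosen A 10 s = G)
    {s' : State} (hs' : s' = select.run O s) :
    ∃ j, s'.nat 19 0 0 = j ∧ (∀ t, s'.nat 8 0 t = if j = 0 then s.nat 8 0 t else
      Function.update (s.nat 8 0) j ((conf A s).kept A Z G j).card t) ∧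
    (j = 0 ∧ ((conf A s).C.card < Z.card ∨ ∀ t, 1 ≤ t → t < i →
      ((conf A s).b0 t : ℝ) - ((conf A s).kept A Z G t).card ≤ A.mu * (conf A s).b0 t) ∨
    Z.card ≤ (conf A s).C.card ∧ 1 ≤ j ∧ j < i ∧
      A.mu * (conf A s).b0 j < (conf A s).b0 j - ((conf A s).kept A Z G j).card ∧
      ∀ t, 1 ≤ t → t < j →
        ((conf A s).b0 t : ℝ) - ((conf A s).kept A Z G t).card ≤ A.mu * (conf A s).b0 t) := by
  set c := conf A s with hcdef
  set P₁ := countLoop 29 .elements 32 (.not (.isZero (.entry 9 (.cell 29)))) with hP₁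
  set P₂ := countLoop 29 .elements 33 (.not (.isZero (.entry 2 (.cell 29)))) with hP₂
  have e1 : (P₁.run O s).nat 32 0 0 = Z.card := by
    rw [← hZ]; exact run_chosenCount hM (by decide) (by decide) (by decide) (by decide)
  have hM₁ : Memory A (P₁.run O s) := hM.run _ (by decide) (by decide) (by decide) (by decide)
  have e2 : (P₂.run O (P₁.run O s)).nat 33 0 0 = c.C.card := by
    rw [hP₂, run_chosenCount hM₁ (by decide) (by decide) (by decide) (by decide),
      chosen_congr (run_nat P₁ (by decide) s)]
    rfl
  set s₁ := (P₂.run O (P₁.run O s)).setNat 19 0 0 0 with hs₁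
  have hn₁ : ∀ a, a ≠ 29 → a ≠ 32 → a ≠ 33 → a ≠ 19 → s₁.nat a = s.nat a := by
    intro a h29 h32 h33 h19
    rw [hs₁, State.nat_setNat_ne _ h19, run_nat _ (by
      simp [hP₂, countLoop, natWrites, assign, h29, h33]), run_nat _ (by
      simp [hP₁, countLoop, natWrites, assign, h29, h32])]
  have hM₂ : Memory A s₁ := by
    refine hM.congr (hn₁ 0 (by decide) (by decide) (by decide) (by decide))
      (hn₁ 1 (by decide) (by decide) (by decide) (by decide)) ?_ ?_
    · rw [hs₁, State.real_setNat, run_real _ (by decide), run_real _ (by decide)]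
    · rw [hs₁, State.real_setNat, run_real _ (by decide), run_real _ (by decide)]
  have h32 : s₁.nat 32 0 0 = Z.card := by
    rw [hs₁, State.nat_setNat_ne _ (by decide), run_nat _ (by decide), e1]
  have h33 : s₁.nat 33 0 0 = c.C.card := by
    rw [hs₁, State.nat_setNat_ne _ (by decide), e2]
  have key := run_loop_induction (O := O) (c := 23) (l := .layers) (s := s₁) (P := selectBody)
    (fun n u => ∃ j, u.nat 19 0 0 = j ∧ (∀ t, u.nat 8 0 t = if j = 0 then s.nat 8 0 t else
      Function.update (s.nat 8 0) j (c.kept A Z G j).card t) ∧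
    (j = 0 ∧ (c.C.card < Z.card ∨ ∀ t, 1 ≤ t → t < i → t < n →
      (c.b0 t : ℝ) - (c.kept A Z G t).card ≤ A.mu * c.b0 t) ∨
    Z.card ≤ c.C.card ∧ 1 ≤ j ∧ j < i ∧ A.mu * c.b0 j < c.b0 j - (c.kept A Z G j).card ∧
      ∀ t, 1 ≤ t → t < j → (c.b0 t : ℝ) - (c.kept A Z G t).card ≤ A.mu * c.b0 t)) (by
      refine ⟨0, ?_, ?_, Or.inl ⟨rfl, Or.inr fun t h1 h2 h3 => by omega⟩⟩
      · rw [loopInit_nat _ _ _ (by decide)]; simp [hs₁, State.nat_setNat]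
      · intro t
        rw [loopInit_nat _ _ _ (by decide), hn₁ 8 (by decide) (by decide) (by decide) (by decide),
          if_pos rfl]) (by
      rintro n hn u hc hnat hreal ⟨j, hj, hb, hI⟩
      have hMu : Memory A u := hM₂.congr (hnat 0 (by decide)) (hnat 1 (by decide))
        (hreal 4 (by decide)) (hreal 5 (by decide))
      have hnu : ∀ a, a = 4 ∨ a = 9 ∨ a = 10 ∨ a = 12 → u.nat a = s.nat a := by
        intro a ha
        rw [hnat a (by rcases ha with rfl | rfl | rfl | rfl <;> decide), hn₁] <;> omega
      have hu32 : u.nat 32 0 0 = Z.card := by rw [hnat 32 (by decide), h32]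
      have hu33 : u.nat 33 0 0 = c.C.card := by rw [hnat 33 (by decide), h33]
      have hu12 : u.nat 12 0 0 = i := by rw [hnu 12 (by simp), h12]
      simp only [State.nat_setNat_ne _ (show (19 : ℕ) ≠ 23 by decide),
        State.nat_setNat_ne _ (show (8 : ℕ) ≠ 23 by decide)]
      by_cases ht : Z.card ≤ c.C.card ∧ j = 0 ∧ 1 ≤ n ∧ ¬ i ≤ n
      · obtain ⟨ht1, rfl, ht3, ht4⟩ := ht
        set P := countLoop 29 .elements 13 (.and (.natEq (.entry 4 (.cell 29)) (.cell 23))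
          (.and (.not (.isZero (.entry 9 (.cell 29)))) (.isZero (.entry 10 (.cell 29))))) with hP
        have hcount : (P.run O u).nat 13 0 0 = (c.kept A Z G n).card := by
          rw [hP, run_countLoop (N := A.m) (by decide) (by decide) (hMu.limit _)
            (fun x => s.nat 4 0 x = n ∧ s.nat 9 0 x ≠ 0 ∧ s.nat 10 0 x = 0) (by
            intro x hx t htc hnt hrt
            simp [htc, hnt 4 (by decide) (by decide), hnt 9 (by decide) (by decide),
              hnt 10 (by decide) (by decide), hnt 23 (by decide) (by decide), hc, hnu])]
          congr 1
          ext x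
          rw [Config.mem_kept, ← hZ, ← hG, mem_chosen, mem_chosen]
          simp only [mem_filter, mem_range]
          change _ ↔ (x < A.m ∧ s.nat 4 0 x = n) ∧ _
          tauto
        set u₁ := P.run O u with hu₁
        have h8 : u₁.nat 8 = u.nat 8 := by rw [hu₁, run_nat _ (by decide)]
        have h23 : u₁.nat 23 0 0 = n := by rw [hu₁, run_nat _ (by decide), hc]
        have hmu : u₁.real 4 0 3 = A.mu := by rw [hu₁, run_real _ (by decide), hMu.mu]
        have hbn : u.nat 8 0 n = c.b0 n := by rw [hb, if_pos rfl]; rfl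
        have htest : (Test.realLe (.sub (.ofNat (.entry 8 (.cell 23))) (.ofNat (.cell 13)))
            (.mul (.entry 4 (.lit 3)) (.ofNat (.entry 8 (.cell 23))))).Holds u₁ ↔
            (c.b0 n : ℝ) - (c.kept A Z G n).card ≤ A.mu * c.b0 n := by
          simp only [Test.holds_realLe, RealExpr.eval_sub, RealExpr.eval_ofNat, NatExpr.eval_entry,
            NatExpr.eval_cell, h8, h23, hbn, hcount, RealExpr.eval_mul, RealExpr.eval_entry,
            NatExpr.eval_lit, hmu]
        have hsmall : ∀ t, 1 ≤ t → t < n →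
            (c.b0 t : ℝ) - (c.kept A Z G t).card ≤ A.mu * c.b0 t := by
          intro t h1 h2
          rcases hI with ⟨-, h3 | h3⟩ | h3
          · omega
          · exact h3 t h1 (by omega) h2
          · have := h3.2.1; omega
        have hrun : selectBody.run O u = (Bounded.ite
            (.realLe (.sub (.ofNat (.entry 8 (.cell 23))) (.ofNat (.cell 13)))
              (.mul (.entry 4 (.lit 3)) (.ofNat (.entry 8 (.cell 23))))) .skip
            (.seq (assign 19 (.cell 23)) (store 8 (.cell 23) (.cell 13)))).run O u₁ := by
          rw [selectBody, run_ite, if_pos (by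
            simp only [Test.holds_and, Test.holds_natLe, Test.holds_isZero, Test.holds_not,
              NatExpr.eval_cell, NatExpr.eval_lit, hu32, hu33, hj, hc, hu12]
            exact ⟨ht1, trivial, ht3, ht4⟩), run_seq]
        rw [hrun, run_ite]
        by_cases hle : (c.b0 n : ℝ) - (c.kept A Z G n).card ≤ A.mu * c.b0 n
        · rw [if_pos (htest.2 hle), run_skip]
          refine ⟨0, ?_, ?_, Or.inl ⟨rfl, Or.inr ?_⟩⟩
          · rw [hu₁, run_nat _ (by decide), hj]
          · intro t; rw [h8, hb]
          · intro t h1 h2 h3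
            by_cases htn : t = n
            · subst htn; exact hle
            · exact hsmall t h1 (by omega)
        · rw [if_neg (fun h => hle (htest.1 h))]
          have hrun' : (Bounded.seq (assign 19 (.cell 23)) (store 8 (.cell 23) (.cell 13))).run O
              u₁ = (u₁.setNat 19 0 0 n).setNat 8 0 n (c.kept A Z G n).card := by
            simp [State.nat_setNat, h23, hcount]
          rw [hrun']
          refine ⟨n, by simp [State.nat_setNat], ?_,
            Or.inr ⟨ht1, ht3, by omega, not_le.1 hle, hsmall⟩⟩
          intro t
          rw [if_neg (by omega), State.nat_setNat, Function.update_apply]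
          by_cases htn : t = n
          · simp [htn]
          · rw [if_neg (by simp [htn]), if_neg htn, State.nat_setNat_ne _ (by decide), h8, hb,
              if_pos rfl]
      · have hrun : selectBody.run O u = u := by
          rw [selectBody, run_ite, if_neg, run_skip]
          simp only [Test.holds_and, Test.holds_natLe, Test.holds_isZero, Test.holds_not,
              NatExpr.eval_cell, NatExpr.eval_lit, hu32, hu33, hj, hc, hu12]
          exact ht
        rw [hrun]
        refine ⟨j, hj, hb, hI.imp_left fun h => ⟨h.1, ?_⟩⟩
        rcases h.2 with h2 | h2
        · exact Or.inl h2
        · by_cases hlt : c.C.card < Z.card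
          · exact Or.inl hlt
          · exact Or.inr fun t h3 h4 h5 => h2 t h3 h4 (by omega))
  rw [hM₂.limit] at key
  have hrun : select.run O s = (loop 23 .layers selectBody).run O s₁ := rfl
  rw [← hrun, ← hs'] at key
  obtain ⟨j, hj, hb, hI⟩ := key
  refine ⟨j, hj, hb, hI.imp_left fun h => ⟨h.1, h.2.imp_right fun h' t h1 h2 => h' t h1 h2 ?_⟩⟩
  rw [Limit.count]
  omega

end LocalSearch

/-! ### Carrying out a collapse -/

namespace LocalSearch

open RealRAM RealRAM.Bounded Finset Classical

variable {A : Problem} {O : Set ℕ → Prop} {s u : State}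

/-- Update the owner of the resource in array `23`. -/
def ownBody : Bounded :=
  .ite (.isZero (.entry 3 (.cell 23)))
    (.ite (.and (.natEq (.entry 5 (.cell 23)) (.cell 12))
        (.not (.isZero (.entry 10 (.entry 6 (.cell 23))))))
      (.seq (.ite (.realLe (.entry 4 (.lit 0)) (.entry 8 (.entry 6 (.cell 23)))) .skip
          (store 3 (.cell 23) (.add (.entry 6 (.cell 23)) (.lit 1))))
        (storeReal 8 (.entry 6 (.cell 23))
          (.add (.entry 8 (.entry 6 (.cell 23))) (.entry 5 (.cell 23)))))
      .skip)
    (.ite (.isZero (.entry 28 (.sub (.entry 3 (.cell 23)) (.lit 1)))) .skip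
      (store 3 (.cell 23) (.lit 0)))

/-- Update the owners of all resources. -/
def ownLoop : Bounded :=
  .seq (.loop 29 .elements (storeReal 8 (.cell 29) (.lit 0))) (.loop 23 .resources ownBody)

theorem run_clear (hM : Memory A s) {x : ℕ} (hx : x < A.m) :
    ((loop 29 .elements (storeReal 8 (.cell 29) (.lit 0))).run O s).real 8 0 x = 0 := by
  have key := run_loop_induction (O := O) (c := 29) (l := .elements) (s := s)
    (P := storeReal 8 (.cell 29) (.lit 0)) (fun n u => ∀ x < n, u.real 8 0 x = 0)
    (fun x hx => absurd hx (Nat.not_lt_zero x)) (by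
      intro n hn u hc hnat hreal hI x hx
      rw [State.real_setNat, run_storeReal, State.real_setReal]
      split_ifs with h
      · simp
      · refine hI x ?_
        have : x ≠ n := fun h' => h ⟨rfl, rfl, by simp [hc, h']⟩
        omega)
  rw [hM.limit] at key
  exact key x hx

/-- One sweep through the resources performs the greedy selections of all elements of `G`
simultaneously, each with its own accumulator in array `8` of real numbers. The update is in place:
the owner of a resource is only consulted in the iteration that may change it. -/
theorem run_ownLoop (hM : Memory A s) {i j : ℕ} (hi : 1 ≤ i) (h12 : s.nat 12 0 0 = i)
    {Z G : Finset ℕ} (hG : chosen A 10 s = G) (c : Config) (hC : c.Covering A)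
    (hm : ∀ x ∈ c.C, x < A.m) (hF : c.Forest A c.top) (h3 : s.nat 3 0 = c.own)
    (h5 : s.nat 5 0 = c.aL) (h6 : s.nat 6 0 = c.aN)
    (h28 : ∀ x < A.m, s.nat 28 0 x ≠ 0 ↔ c.Hit Z G i x) (w : ℕ) :
    (ownLoop.run O s).nat 3 0 w = (c.collapse A Z G
      (fun x => Config.greedy A.cap A.v (c.freePart A i x)) i j).own w := by
  set R := fun x => Config.greedy A.cap A.v (c.freePart A i x) with hR
  have hRsub : ∀ x, R x ⊆ c.freePart A i x := fun x => Config.greedy_subset _ _ _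
  set g := (c.collapse A Z G R i j).own with hg
  have hgdef : ∀ w, g w = if c.own w ≠ 0 then (if c.Hit Z G i (c.own w - 1) then 0 else c.own w)
    else if c.aN w ∈ G ∧ w ∈ R (c.aN w) then c.aN w + 1 else 0 := fun w => rfl
  set P := loop 29 .elements (storeReal 8 (.cell 29) (.lit 0)) with hP
  set s₁ := P.run O s with hs₁
  have hM₁ : Memory A s₁ := hM.run _ (by decide) (by decide) (by decide) (by decide)
  have hn₁ : ∀ a, a ≠ 29 → s₁.nat a = s.nat a := fun a ha => run_nat _ (by
    simp [hP, natWrites, storeReal, ha]) s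
  have key := run_loop_induction (O := O) (c := 23) (l := .resources) (s := s₁) (P := ownBody)
    (fun n u => (∀ w, u.nat 3 0 w = if w < n then g w else c.own w) ∧
      ∀ x ∈ G, u.real 8 0 x = ∑ w ∈ c.freePart A i x with w < n, A.cap w) (by
      refine ⟨fun w => ?_, fun x hx => ?_⟩
      · rw [loopInit_nat _ _ _ (by decide), hn₁ 3 (by decide), h3]; simp
      · rw [loopInit_real, hs₁, run_clear hM (mem_chosen.1 (hG ▸ hx : x ∈ chosen A 10 s)).1]
        simp) (by
      rintro n hn u hc hnat hreal ⟨hown, hacc⟩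
      rw [hM₁.limit] at hn
      have hMu : Memory A u := hM₁.congr (hnat 0 (by decide)) (hnat 1 (by decide))
        (hreal 4 (by decide)) (hreal 5 (by decide))
      have hnu : ∀ a, a = 5 ∨ a = 6 ∨ a = 10 ∨ a = 12 ∨ a = 28 → u.nat a = s.nat a := by
        intro a ha
        rw [hnat a (by rcases ha with rfl | rfl | rfl | rfl | rfl <;> decide), hn₁]
        omega
      have u5 : u.nat 5 0 n = c.aL n := by rw [hnu 5 (by simp), h5]
      have u6 : u.nat 6 0 n = c.aN n := by rw [hnu 6 (by simp), h6]
      have u12 : u.nat 12 0 0 = i := by rw [hnu 12 (by simp), h12]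
      have u3 : u.nat 3 0 n = c.own n := by rw [hown, if_neg (lt_irrefl n)]
      have hrest : ∀ (t : State) (b : ℕ), (∀ w, t.nat 3 0 w = if w = n then b else u.nat 3 0 w) →
          b = g n → ∀ w, t.nat 3 0 w = if w < n + 1 then g w else c.own w := by
        intro t b ht hb w
        rw [ht, hown]
        by_cases h : w = n
        · rw [if_pos h, if_pos (by omega), hb, h]
        · rw [if_neg h]
          by_cases h' : w < n
          · rw [if_pos h', if_pos (by omega)]
          · rw [if_neg h', if_neg (by omega)]
      rw [State.nat_setNat_ne _ (show (3 : ℕ) ≠ 23 by decide), State.real_setNat]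
      by_cases h0 : c.own n = 0
      · have hfree : ∀ x, n ∈ c.freePart A i x ↔ c.aL n = i ∧ c.aN n = x := by
          intro x
          rw [Config.mem_freePart]
          exact ⟨fun h => h.1.2, fun h => ⟨⟨hn, h⟩, h0⟩⟩
        by_cases hin : c.aL n = i ∧ c.aN n ∈ G
        · have h10 : u.nat 10 0 (c.aN n) ≠ 0 := by
            rw [hnu 10 (by simp)]
            exact (mem_chosen.1 (hG ▸ hin.2 : c.aN n ∈ chosen A 10 s)).2
          have hnf : n ∈ c.freePart A i (c.aN n) := (hfree _).2 ⟨hin.1, rfl⟩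
          -- The accumulator holds the value of all preceding unowned resources of this hyperedge,
          -- whether they were given away or not.
          have hnR : n ∈ R (c.aN n) ↔ ¬ A.v ≤ u.real 8 0 (c.aN n) := by
            rw [hR, hacc _ hin.2]
            simp only [Config.greedy, mem_filter, not_le]
            exact and_iff_right hnf
          have hgn : g n = if A.v ≤ u.real 8 0 (c.aN n) then 0 else c.aN n + 1 := by
            rw [hgdef, if_neg (not_not.2 h0)]
            by_cases hv : A.v ≤ u.real 8 0 (c.aN n)
            · rw [if_neg (fun h => hnR.1 h.2 hv), if_pos hv]
            · rw [if_pos ⟨hin.2, hnR.2 hv⟩, if_neg hv]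
          have hrun : ownBody.run O u = (if A.v ≤ u.real 8 0 (c.aN n) then u else
              u.setNat 3 0 n (c.aN n + 1)).setReal 8 0 (c.aN n)
                (u.real 8 0 (c.aN n) + A.cap n) := by
            rw [ownBody, run_ite, if_pos (by simp [hc, u3, h0]), run_ite,
              if_pos (by simp [hc, u5, u6, u12, hin.1, h10]), run_seq, run_ite]
            have htest : (Test.realLe (.entry 4 (.lit 0)) (.entry 8 (.entry 6 (.cell 23)))).Holds u ↔
                A.v ≤ u.real 8 0 (c.aN n) := by
              simp [hc, u6, hMu.v]
            by_cases hv : A.v ≤ u.real 8 0 (c.aN n)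
            · rw [if_pos (htest.2 hv), if_pos hv]
              simp [hc, u6, hMu.cap n hn]
            · rw [if_neg (fun h => hv (htest.1 h)), if_neg hv]
              simp [hc, u6, hMu.cap n hn, State.nat_setNat, State.real_setNat]
          rw [hrun, State.nat_setReal]
          refine ⟨hrest _ (g n) (fun w => ?_) rfl, fun x hx => ?_⟩
          · rw [hgn]
            by_cases hv : A.v ≤ u.real 8 0 (c.aN n)
            · rw [if_pos hv, if_pos hv]
              split_ifs with h
              · rw [h, u3, h0]
              · rfl
            · rw [if_neg hv, if_neg hv, State.nat_setNat]
              simp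
          · have hreal' : (if A.v ≤ u.real 8 0 (c.aN n) then u else
              u.setNat 3 0 n (c.aN n + 1)).real = u.real := by split_ifs <;> rfl
            rw [State.real_setReal, hreal', filter_lt_succ]
            by_cases hxn : x = c.aN n
            · subst hxn
              rw [if_pos ⟨rfl, rfl, rfl⟩, if_pos hnf, sum_insert (by simp), hacc _ hx, add_comm]
            · rw [if_neg (by simp [hxn]), if_neg (fun h => hxn ((hfree x).1 h).2.symm), hacc x hx]
        · have hrun : ownBody.run O u = u := by
            rw [ownBody, run_ite, if_pos (by simp [hc, u3, h0]), run_ite, if_neg, run_skip]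
            simp only [Test.holds_and, Test.holds_natEq, Test.holds_not, Test.holds_isZero,
              NatExpr.eval_entry, NatExpr.eval_cell, hc, u5, u6, u12]
            rintro ⟨h1, h2⟩
            refine hin ⟨h1, ?_⟩
            rw [← hG, mem_chosen, ← hnu 10 (by simp)]
            exact ⟨(hF.aL n (by omega)).2.1, h2⟩
          have hgn : g n = 0 := by
            rw [hgdef, if_neg (not_not.2 h0), if_neg]
            rintro ⟨h1, h2⟩
            exact hin ⟨((hfree _).1 (hRsub _ h2)).1, h1⟩
          rw [hrun]
          refine ⟨hrest _ (g n) (fun w => ?_) rfl, fun x hx => ?_⟩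
          · split_ifs with h
            · rw [h, u3, h0, hgn]
            · rfl
          · rw [hacc x hx, filter_lt_succ, if_neg]
            intro h
            obtain ⟨h1, h2⟩ := (hfree x).1 h
            exact hin ⟨h1, h2 ▸ hx⟩
      · have hfree : ∀ x, n ∉ c.freePart A i x := fun x h => h0 (Config.mem_freePart.1 h).2
        obtain ⟨b, hb⟩ := Nat.exists_eq_succ_of_ne_zero h0
        have hbm : b < A.m := hm b (hC.own n b hb).2.1
        have u28 : u.nat 28 0 (c.own n - 1) ≠ 0 ↔ c.Hit Z G i (c.own n - 1) := by
          rw [hnu 28 (by simp)]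
          exact h28 _ (by rw [hb, Nat.succ_sub_one]; exact hbm)
        have hgn : g n = if c.Hit Z G i (c.own n - 1) then 0 else c.own n := by
          rw [hgdef, if_pos h0]
        have hrun : ownBody.run O u = if c.Hit Z G i (c.own n - 1) then u.setNat 3 0 n 0 else u := by
          rw [ownBody, run_ite, if_neg (by simp [hc, u3, h0]), run_ite]
          by_cases hh : c.Hit Z G i (c.own n - 1)
          · rw [if_pos hh, if_neg (by simpa [hc, u3] using u28.2 hh)]
            simp [hc]
          · have : u.nat 28 0 (c.own n - 1) = 0 := by
              by_contra h; exact hh (u28.1 h)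
            rw [if_neg hh, if_pos (by simpa [hc, u3] using this), run_skip]
        rw [hrun]
        refine ⟨hrest _ (g n) (fun w => ?_) rfl, fun x hx => ?_⟩
        · rw [hgn]
          by_cases hh : c.Hit Z G i (c.own n - 1)
          · rw [if_pos hh, if_pos hh, State.nat_setNat]; simp
          · rw [if_neg hh, if_neg hh]
            split_ifs with h
            · rw [h, u3]
            · rfl
        · rw [filter_lt_succ, if_neg (hfree x), ← hacc x hx]
          split_ifs <;> rfl)
  rw [hM₁.limit] at key
  have hrun : ownLoop.run O s = (loop 23 .resources ownBody).run O s₁ := rfl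
  rw [hrun, key.1]
  split_ifs with h
  · rfl
  · have h0 : c.own w = 0 := by
      by_contra h0
      obtain ⟨b, hb⟩ := Nat.exists_eq_succ_of_ne_zero h0
      exact h (hC.own w b hb).1
    rw [h0, hgdef, if_neg (not_not.2 h0), if_neg]
    rintro ⟨-, h2⟩
    exact h (Config.mem_freePart.1 (hRsub _ h2)).1.1

/-- The new layers of the elements. -/
def layLoop : Bounded :=
  mapLoop 29 .elements 4 (.or (.not (.isZero (.entry 28 (.cell 29))))
    (.not (.natLe (.entry 4 (.cell 29)) (.cell 19)))) (.lit 0) (.entry 4 (.cell 29))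

/-- The new set of chosen elements. -/
def chooseLoop : Bounded :=
  mapLoop 29 .elements 2 (.isZero (.entry 9 (.cell 29))) (.lit 0) (.lit 1)

/-- The new layers of the resources. -/
def discardLoop : Bounded :=
  mapLoop 29 .resources 5 (.not (.natLe (.entry 5 (.cell 29)) (.cell 19))) (.lit 0)
    (.entry 5 (.cell 29))

theorem run_layLoop (hM : Memory A s) (x : ℕ) : (layLoop.run O s).nat 4 0 x =
    if x < A.m then (if s.nat 28 0 x ≠ 0 ∨ s.nat 19 0 0 < s.nat 4 0 x then 0 else s.nat 4 0 x)
    else s.nat 4 0 x := by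
  rw [layLoop, run_mapLoop (N := A.m) (by decide) (hM.limit _)
    (fun x => if s.nat 28 0 x ≠ 0 ∨ s.nat 19 0 0 < s.nat 4 0 x then 0 else s.nat 4 0 x)]
  intro n hn u hc hnat h4 _
  simp [hc, hnat 28 (by decide) (by decide), hnat 19 (by decide) (by decide), h4]

theorem run_chooseLoop (hM : Memory A s) : chosen A 2 (chooseLoop.run O s) = chosen A 9 s := by
  ext x
  rw [mem_chosen, mem_chosen, chooseLoop, run_mapLoop (N := A.m) (by decide) (hM.limit _)
    (fun x => if s.nat 9 0 x = 0 then 0 else 1)]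
  · refine and_congr_right fun hx => ?_
    rw [if_pos hx]
    split_ifs with h <;> simp [h]
  · intro n hn u hc hnat h4 _
    simp [hc, hnat 9 (by decide) (by decide)]

theorem run_discardLoop (hM : Memory A s) (w : ℕ) : (discardLoop.run O s).nat 5 0 w =
    if w < A.k then (if s.nat 19 0 0 < s.nat 5 0 w then 0 else s.nat 5 0 w)
    else s.nat 5 0 w := by
  rw [discardLoop, run_mapLoop (N := A.k) (by decide) (hM.limit _)
    (fun x => if s.nat 19 0 0 < s.nat 5 0 x then 0 else s.nat 5 0 x)]
  intro n hn u hc hnat h4 _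
  simp [hc, hnat 19 (by decide) (by decide), h4]

/-- Collapse the layers below the one in array `12`. -/
def exchange : Bounded :=
  .seq refill (.seq hits (.seq select (.seq ownLoop (.seq layLoop (.seq chooseLoop
    (.seq discardLoop (assign 7 (.cell 19))))))))

/-- The hits are stored in array `28` before the data on which they depend are overwritten, so the
updates of owners, layers and chosen elements all refer to the old configuration. -/
theorem run_exchange (hA : A.Valid) (hO : Answers A O) (hM : Memory A s)
    (hC : (conf A s).Covering A) (hF : (conf A s).Forest A (conf A s).top)
    (htop : (conf A s).top ≤ A.m + 1) {i : ℕ} (h12 : s.nat 12 0 0 = i) {G : Finset ℕ}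
    (hG : chosen A 10 s = G) (h : (conf A s).Found A (chosen A 9 s) G i) :
    ∃ Z j, (conf A s).Exchange A Z G i ∧ conf A (exchange.run O s) = (conf A s).collapse A Z G
      (fun x => Config.greedy A.cap A.v ((conf A s).freePart A i x)) i j ∧
      (j = 0 ∧ ((conf A s).C.card < Z.card ∨ ∀ t, 1 ≤ t → t < i →
        ((conf A s).b0 t : ℝ) - ((conf A s).kept A Z G t).card ≤ A.mu * (conf A s).b0 t) ∨
      Z.card ≤ (conf A s).C.card ∧ 1 ≤ j ∧ j < i ∧
        A.mu * (conf A s).b0 j < (conf A s).b0 j - ((conf A s).kept A Z G j).card ∧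
        ∀ t, 1 ≤ t → t < j →
          ((conf A s).b0 t : ℝ) - ((conf A s).kept A Z G t).card ≤ A.mu * (conf A s).b0 t) := by
  subst hG
  have hE := run_refill hA hO hM hC hF htop h12 h
  set c := conf A s with hcdef
  set G := chosen A 10 s with hG
  set s₁ := refill.run O s with hs₁
  set Z := chosen A 9 s₁ with hZ
  have hM₁ : Memory A s₁ := hM.run _ (by decide) (by decide) (by decide) (by decide)
  have hc₁ : conf A s₁ = c := conf_congr fun a h2 h8 => run_nat _ (by interval_cases a <;> decide) s
  have hG₁ : chosen A 10 s₁ = G := chosen_congr (run_nat _ (by decide) s)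
  have h12₁ : s₁.nat 12 0 0 = i := by rw [hs₁, run_nat _ (by decide), h12]
  set s₂ := hits.run O s₁ with hs₂
  have hM₂ : Memory A s₂ := hM₁.run _ (by decide) (by decide) (by decide) (by decide)
  have hc₂ : conf A s₂ = c := by
    rw [← hc₁]; exact conf_congr fun a h2 h8 => run_nat _ (by interval_cases a <;> decide) s₁
  have hhit : ∀ x < A.m, s₂.nat 28 0 x ≠ 0 ↔ c.Hit Z G i x := by
    intro x hx
    rw [hs₂, run_hits hM₁ hx, hc₁, hG₁, h12₁]
  have h12₂ : s₂.nat 12 0 0 = i := by rw [hs₂, run_nat _ (by decide), h12₁]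
  have hZ₂ : chosen A 9 s₂ = Z := chosen_congr (run_nat _ (by decide) s₁)
  have hG₂ : chosen A 10 s₂ = G := by rw [← hG₁]; exact chosen_congr (run_nat _ (by decide) s₁)
  obtain ⟨j, hj, hb, hsel⟩ := run_select (O := O) hM₂ h12₂ (by have := h.le_top; omega) hZ₂ hG₂
    (s' := select.run O s₂) rfl
  rw [hc₂] at hb hsel
  refine ⟨Z, j, hE, ?_, hsel⟩
  set s₃ := select.run O s₂ with hs₃
  have hM₃ : Memory A s₃ := hM₂.run _ (by decide) (by decide) (by decide) (by decide)
  have hn₃ : ∀ a, a ∉ [8, 13, 19, 23, 29, 32, 33] → s₃.nat a = s₂.nat a := fun a ha => run_nat _ (by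
    simp only [List.mem_cons, List.not_mem_nil, or_false, not_or] at ha
    simp [select, selectBody, countLoop, natWrites, assign, store, ha]) s₂
  have hm : ∀ x ∈ c.C, x < A.m := fun x hx => mem_range.1 (hA.subset_range hC.indep hx)
  have hown := run_ownLoop (O := O) (j := j) hM₃ h.pos (by rw [hn₃ 12 (by decide), h12₂])
    (Z := Z) (G := G) (by rw [← hG₂]; exact chosen_congr (hn₃ 10 (by decide))) c hC hm hF
    (by rw [hn₃ 3 (by decide), ← hc₂]; rfl) (by rw [hn₃ 5 (by decide), ← hc₂]; rfl)
    (by rw [hn₃ 6 (by decide), ← hc₂]; rfl) (by rw [hn₃ 28 (by decide)]; exact hhit)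
  set s₄ := ownLoop.run O s₃ with hs₄
  have hM₄ : Memory A s₄ := hM₃.run _ (by decide) (by decide) (by decide) (by decide)
  have hn₄ : ∀ a, a ∉ [3, 23, 29] → s₄.nat a = s₃.nat a := fun a ha => run_nat _ (by
    simp only [List.mem_cons, List.not_mem_nil, or_false, not_or] at ha
    simp [ownLoop, ownBody, natWrites, store, storeReal, ha]) s₃
  have hlay := run_layLoop (O := O) hM₄
  set s₅ := layLoop.run O s₄ with hs₅
  have hM₅ : Memory A s₅ := hM₄.run _ (by decide) (by decide) (by decide) (by decide)
  have hn₅ : ∀ a, a ∉ [4, 29] → s₅.nat a = s₄.nat a := fun a ha => run_nat _ (by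
    simp only [List.mem_cons, List.not_mem_nil, or_false, not_or] at ha
    simp [layLoop, mapLoop, natWrites, store, ha]) s₄
  have hchoose := run_chooseLoop (O := O) hM₅
  set s₆ := chooseLoop.run O s₅ with hs₆
  have hM₆ : Memory A s₆ := hM₅.run _ (by decide) (by decide) (by decide) (by decide)
  have hn₆ : ∀ a, a ∉ [2, 29] → s₆.nat a = s₅.nat a := fun a ha => run_nat _ (by
    simp only [List.mem_cons, List.not_mem_nil, or_false, not_or] at ha
    simp [chooseLoop, mapLoop, natWrites, store, ha]) s₅
  have hdisc := run_discardLoop (O := O) hM₆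
  set s₇ := discardLoop.run O s₆ with hs₇
  have hn₇ : ∀ a, a ∉ [5, 29] → s₇.nat a = s₆.nat a := fun a ha => run_nat _ (by
    simp only [List.mem_cons, List.not_mem_nil, or_false, not_or] at ha
    simp [discardLoop, mapLoop, natWrites, store, ha]) s₆
  have h19 : s₇.nat 19 0 0 = j := by
    rw [hn₇ 19 (by decide), hn₆ 19 (by decide), hn₅ 19 (by decide), hn₄ 19 (by decide), hj]
  have hrun : exchange.run O s = s₇.setNat 7 0 0 j := by
    rw [exchange, run_seq, run_seq, run_seq, run_seq, run_seq, run_seq, run_seq, run_assign]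
    rw [← h19]
    rfl
  rw [hrun]
  simp only [conf, Config.collapse, Config.mk.injEq]
  refine ⟨?_, ?_, ?_, ?_, ?_, ?_, ?_⟩
  · rw [chosen_congr (State.nat_setNat_ne s₇ (show (2 : ℕ) ≠ 7 by decide) _ _ _),
      chosen_congr (hn₇ 2 (by decide)), hchoose, chosen_congr (hn₅ 9 (by decide)),
      chosen_congr (hn₄ 9 (by decide)), chosen_congr (hn₃ 9 (by decide)), hZ₂]
  · funext w
    rw [State.nat_setNat_ne s₇ (show (3 : ℕ) ≠ 7 by decide), hn₇ 3 (by decide), hn₆ 3 (by decide),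
      hn₅ 3 (by decide), hown w]
    rfl
  · funext x
    rw [State.nat_setNat_ne s₇ (show (4 : ℕ) ≠ 7 by decide), hn₇ 4 (by decide), hn₆ 4 (by decide),
      hlay x, hn₄ 19 (by decide), hj, hn₄ 28 (by decide), hn₃ 28 (by decide), hn₄ 4 (by decide),
      hn₃ 4 (by decide)]
    have e4 : s₂.nat 4 0 x = c.lay x := by rw [← hc₂]; rfl
    rw [e4]
    by_cases hx : x < A.m
    · rw [if_pos hx]
      simp only [hhit x hx]
    · have h0 : c.lay x = 0 := by
        by_contra h0
        exact hx (hm x (hF.lay x h0).1)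
      rw [if_neg hx, h0]
      simp
  · funext w
    rw [State.nat_setNat_ne s₇ (show (5 : ℕ) ≠ 7 by decide), hdisc w, hn₆ 19 (by decide),
      hn₅ 19 (by decide), hn₄ 19 (by decide), hj, hn₆ 5 (by decide), hn₅ 5 (by decide),
      hn₄ 5 (by decide), hn₃ 5 (by decide)]
    have e5 : s₂.nat 5 0 w = c.aL w := by rw [← hc₂]; rfl
    rw [e5]
    by_cases hw : w < A.k
    · rw [if_pos hw]
    · have h0 : c.aL w = 0 := by
        by_contra h0
        exact hw (hF.aL w h0).1
      rw [if_neg hw, h0]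
      simp
  · rw [State.nat_setNat_ne s₇ (show (6 : ℕ) ≠ 7 by decide), hn₇ 6 (by decide), hn₆ 6 (by decide),
      hn₅ 6 (by decide), hn₄ 6 (by decide), hn₃ 6 (by decide), ← hc₂]
    rfl
  · simp [State.nat_setNat]
  · funext t
    rw [State.nat_setNat_ne s₇ (show (8 : ℕ) ≠ 7 by decide), hn₇ 8 (by decide), hn₆ 8 (by decide),
      hn₅ 8 (by decide), hn₄ 8 (by decide), hb t]
    have e8 : s₂.nat 8 0 = c.b0 := by rw [← hc₂]; rfl
    rw [e8]
    split_ifs <;> rfl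

end LocalSearch

/-! ### One iteration of the search, initialization and output -/

namespace LocalSearch

open RealRAM RealRAM.Bounded Finset Classical

variable {A : Problem} {O : Set ℕ → Prop} {s u : State}

/-- Some element can be added to the chosen ones. -/
def Augmentable (A : Problem) (c : Config) : Prop :=
  ∃ x < A.m, x ∉ c.C ∧ A.M.Indep ↑(insert x c.C)

/-- Determine in array `27` whether the chosen elements can be augmented. -/
def augment : Bounded :=
  .seq (mapLoop 29 .elements 9 (.isZero (.entry 2 (.cell 29))) (.lit 0) (.lit 1))
    (.seq (assign 27 (.lit 0)) (.loop 20 .elements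
      (.seq (tryAdd 20) (assign 27 (.add (.cell 27) (.cell 11))))))

theorem conf_augment : conf A (augment.run O s) = conf A s :=
  conf_congr fun a h2 h8 => run_nat _ (by interval_cases a <;> decide) s

/-- Until the first acceptance array `9` equals `C`, so the first element accepted augments `C`
itself. What follows can only increase the count in array `27`. -/
theorem run_augment (hO : Answers A O) (hM : Memory A s) :
    (augment.run O s).nat 27 0 0 ≠ 0 ↔ Augmentable A (conf A s) := by
  set P := mapLoop 29 .elements 9 (.isZero (.entry 2 (.cell 29))) (.lit 0) (.lit 1) with hP
  set s₁ := (P.run O s).setNat 27 0 0 0 with hs₁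
  have hM₁ : Memory A s₁ :=
    (hM.run (O := O) P (by decide) (by decide) (by decide) (by decide)).congr
      (State.nat_setNat_ne _ (by decide) _ _ _) (State.nat_setNat_ne _ (by decide) _ _ _) rfl rfl
  have hZ₁ : chosen A 9 s₁ = (conf A s).C := by
    rw [chosen_congr (State.nat_setNat_ne (P.run O s) (show (9 : ℕ) ≠ 27 by decide) _ _ _)]
    ext x
    rw [mem_chosen, hP, run_mapLoop (N := A.m) (by decide) (hM.limit _)
      (fun x => if s.nat 2 0 x = 0 then 0 else 1)]
    · change _ ↔ x ∈ chosen A 2 s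
      rw [mem_chosen]
      refine and_congr_right fun hx => ?_
      rw [if_pos hx]
      split_ifs with h <;> simp [h]
    · intro n hn u hc hnat _ _
      simp [hc, hnat 2 (by decide) (by decide)]
  have key := run_loop_induction (O := O) (c := 20) (l := .elements) (s := s₁)
    (P := .seq (tryAdd 20) (assign 27 (.add (.cell 27) (.cell 11))))
    (fun n u => (u.nat 27 0 0 = 0 ∧ chosen A 9 u = (conf A s).C ∧
      ∀ x < n, ¬ (x ∉ (conf A s).C ∧ A.M.Indep ↑(insert x (conf A s).C))) ∨
      (u.nat 27 0 0 ≠ 0 ∧ Augmentable A (conf A s))) (by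
      left
      rw [loopInit_nat _ _ _ (by decide), chosen_congr (loopInit_nat 20 .elements s₁ (a := 9)
        (by decide)), hZ₁]
      exact ⟨by simp [hs₁, State.nat_setNat], rfl, fun x hx => absurd hx (Nat.not_lt_zero x)⟩) (by
      intro n hn u hc hnat hreal hI
      rw [hM₁.limit] at hn
      rw [State.nat_setNat_ne _ (by decide),
        chosen_congr (State.nat_setNat_ne _ (show (9 : ℕ) ≠ 20 by decide) _ _ _), run_seq, run_assign,
        chosen_congr (State.nat_setNat_ne _ (show (9 : ℕ) ≠ 27 by decide) _ _ _)]
      have h27 : ((tryAdd 20).run O u).nat 27 = u.nat 27 := run_nat _ (by decide) u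
      have e1 : (((tryAdd 20).run O u).setNat 27 0 0 (((NatExpr.cell 27).add (.cell 11)).eval
          ((tryAdd 20).run O u))).nat 27 0 0 = u.nat 27 0 0 + ((tryAdd 20).run O u).nat 11 0 0 := by
        simp [State.nat_setNat, h27]
      rw [e1]
      rcases hI with ⟨h0, hZ, hno⟩ | ⟨h0, haug⟩
      · rcases run_tryAdd hO (c := 20) (by decide) (by decide) hc hn with
          ⟨h1, h2, h3, h5⟩ | ⟨h1, h3, h5⟩
        · rw [hZ] at h1 h2
          right
          exact ⟨by omega, n, hn, h1, h2⟩
        · rw [hZ] at h1 h3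
          left
          refine ⟨by omega, h3, fun x hx => ?_⟩
          by_cases hxn : x = n
          · rwa [hxn]
          · exact hno x (by omega)
      · exact Or.inr ⟨by omega, haug⟩)
  rw [hM₁.limit] at key
  have hrun : augment.run O s = (loop 20 .elements
      (.seq (tryAdd 20) (assign 27 (.add (.cell 27) (.cell 11))))).run O s₁ := rfl
  rw [hrun]
  rcases key with ⟨h0, -, hno⟩ | ⟨h0, haug⟩
  · refine ⟨fun h => absurd h0 h, ?_⟩
    rintro ⟨x, hx, h⟩
    exact absurd h (hno x hx)
  · exact ⟨fun _ => haug, fun _ => h0⟩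

/-- One iteration of the local search. -/
def body : Bounded :=
  .seq grow (.seq search (.seq (.ite (.isZero (.cell 12)) .skip exchange) augment))

/-- The state at the beginning of an iteration. -/
structure Ready (A : Problem) (u : State) : Prop where
  memory : Memory A u
  inv : (conf A u).Inv A
  flag : u.nat 27 0 0 ≠ 0 ↔ Augmentable A (conf A u)
  outX : ∀ i j, u.real 2 i j = 0
  outY : ∀ i j, u.real 3 i j = 0

theorem ready_body (hA : A.Valid) (hO : Answers A O) {x : ℕ → ℝ} {y : ℕ → ℕ → ℝ}
    (hxy : A.Fractional x y) (h : Ready A s) (hflag : s.nat 27 0 0 ≠ 0) :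
    Ready A (body.run O s) ∧
      (conf A s).progress A + A.gain ≤ (conf A (body.run O s)).progress A := by
  have haug := h.flag.1 hflag
  set s₁ := grow.run O s with hs₁
  have hM₁ : Memory A s₁ := memory_grow h.memory
  obtain ⟨hG, hC, htop, hb⟩ := grown_grow hA hO hxy h.memory h.inv haug
  rw [← hs₁] at hG hC htop hb
  -- Before the growth there are at most `|C| + 1` layers, and `|C| + 1 ≤ m` because `C` can be
  -- augmented. So the counters `0, …, m + 1` reach every layer.
  have htop' : (conf A s₁).top ≤ A.m + 1 := by
    have h1 := h.inv.top_le hA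
    obtain ⟨x, hx, hxC, hi⟩ := haug
    have h2 := card_le_card (hA.subset_range hi)
    rw [card_insert_of_notMem hxC, card_range] at h2
    omega
  set s₂ := search.run O s₁ with hs₂
  have hM₂ : Memory A s₂ := memory_search hM₁
  have hc₂ : conf A s₂ = conf A s₁ := conf_search
  have key : ∃ s₃, s₃ = (Bounded.ite (.isZero (.cell 12)) .skip exchange).run O s₂ ∧ Memory A s₃ ∧
      (conf A s₃).Inv A ∧ (conf A s).progress A + A.gain ≤ (conf A s₃).progress A := by
    refine ⟨_, rfl, hM₂.run _ (by decide) (by decide) (by decide) (by decide), ?_⟩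
    rw [run_ite]
    rcases run_search hA hO hM₁ hG.covering htop' (s' := s₂) rfl with ⟨h0, hcalm⟩ | hF
    · rw [if_pos (by simpa using h0), run_skip, hc₂]
      exact hG.progress_of_calm hA h.inv hC htop hb hcalm
    · rw [if_neg (by have := hF.pos; simp; omega)]
      rw [← hc₂] at hF
      obtain ⟨Z, j, hE, hconf, hj⟩ := run_exchange hA hO hM₂ (by rw [hc₂]; exact hG.covering)
        (by rw [hc₂]; exact hG.forest) (by rw [hc₂]; exact htop') rfl rfl hF
      rw [hconf]
      rw [hc₂] at hE hj hF ⊢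
      refine hE.progress hA h.inv hG hC htop hb (fun x hx => ⟨Config.greedy_subset _ _ _,
        Config.le_sum_greedy hA.cap_nonneg (Config.mem_addable.1 (hE.addable hx)).2,
        Config.sum_greedy_le hA.p_nonneg Problem.v_nonneg hA.pm_nonneg
          (fun w hw => hA.p_le w (Config.mem_freePart.1 hw).1.1)
          (fun R _ hR => (hA.sum_p_eq (hR.trans_le hA.v_le_ve)).le)⟩) hF.calm ?_
      -- If `Z` is not larger than `C`, some layer is hit hard, and the selection cannot have come
      -- out empty.
      refine hj.imp_left fun hj => ⟨hj.1, ?_⟩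
      rcases hj.2 with hlt | hno
      · exact hlt
      · by_contra hle
        obtain ⟨t, h1, h2, h3⟩ := hE.exists_layer hA hG (not_lt.1 hle)
        exact absurd (hno t h1 h2) (not_le.2 h3)
  obtain ⟨s₃, hs₃, hM₃, hI₃, hprog⟩ := key
  have hrun : body.run O s = augment.run O s₃ := by rw [hs₃]; rfl
  have h2 : (body.run O s).real 2 = s.real 2 := run_real _ (by decide) s
  have h3 : (body.run O s).real 3 = s.real 3 := run_real _ (by decide) s
  have hconf : conf A (body.run O s) = conf A s₃ := by rw [hrun, conf_augment]
  refine ⟨⟨h.memory.run _ (by decide) (by decide) (by decide) (by decide), ?_, ?_, ?_, ?_⟩, ?_⟩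
  · rw [hconf]; exact hI₃
  · rw [hconf, hrun]; exact run_augment hO hM₃
  · rw [h2]; exact h.outX
  · rw [h3]; exact h.outY
  · rw [hconf]; exact hprog

/-! #### Initialization and output -/

/-- The largest size. -/
def maxLoop : Bounded :=
  .seq (storeReal 10 (.lit 0) (.lit 0)) (.loop 23 .resources
    (.ite (.realLe (.entry 1 (.cell 23)) (.entry 10 (.lit 0))) .skip
      (storeReal 10 (.lit 0) (.entry 1 (.cell 23)))))

/-- The sizes, cut off. -/
def capLoop : Bounded :=
  .loop 23 .resources (.ite (.realLe (.entry 1 (.cell 23)) (.entry 4 (.lit 1)))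
    (storeReal 5 (.cell 23) (.entry 1 (.cell 23))) (storeReal 5 (.cell 23) (.entry 4 (.lit 1))))

/-- Compute the parameters from `ε`, `T` and the largest size. -/
def setup : Bounded :=
  .seq (.ite (.realLe (.entry 0 (.lit 1)) (.lit (1 / 3))) (storeReal 9 (.lit 0) (.entry 0 (.lit 1)))
    (storeReal 9 (.lit 0) (.lit (1 / 3))))
  (.seq (storeReal 9 (.lit 1) (.sub (.mul (.sub (.lit (1 / 3)) (.entry 9 (.lit 0)))
      (.entry 0 (.lit 0))) (.div (.entry 10 (.lit 0)) (.lit 3))))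
  (.seq (.ite (.realLe (.entry 9 (.lit 1)) (.lit 0)) (storeReal 4 (.lit 0) (.lit 0))
    (storeReal 4 (.lit 0) (.entry 9 (.lit 1))))
  (.seq (storeReal 4 (.lit 1) (.mul (.add (.lit 1) (.entry 9 (.lit 0))) (.entry 4 (.lit 0))))
  (.seq (storeReal 9 (.lit 2) (.mul (.entry 9 (.lit 0)) (.entry 9 (.lit 0))))
  (.seq (storeReal 4 (.lit 2) (.mul (.entry 9 (.lit 2)) (.entry 4 (.lit 0))))
  (storeReal 4 (.lit 3) (.div (.mul (.entry 9 (.lit 2)) (.entry 9 (.lit 2))) (.lit 256))))))))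

/-- Initialization. -/
def init : Bounded := .seq maxLoop (.seq setup (.seq capLoop augment))

/-- The input is in the memory, and the rest of the memory is empty. -/
structure Input (A : Problem) (ε : ℝ) (s : State) : Prop where
  m : s.nat 0 0 0 = A.m
  k : s.nat 0 0 1 = A.k
  adj : ∀ x < A.m, ∀ w < A.k, s.nat 1 x w ≠ 0 ↔ A.adj x w
  T : s.real 0 0 0 = A.T
  eps : s.real 0 0 1 = ε
  e : A.e = min ε (1 / 3)
  p : ∀ w < A.k, s.real 1 0 w = A.p w
  pm : ∀ r, 0 ≤ r → (∀ w < A.k, A.p w ≤ r) → (r = 0 ∨ ∃ w < A.k, r = A.p w) → r = A.pm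
  nat : ∀ a i j, 2 ≤ a → s.nat a i j = 0
  outX : ∀ i j, s.real 2 i j = 0
  outY : ∀ i j, s.real 3 i j = 0

/-- `Input.pm` characterizes the maximum so that the value `0` is correct when there are no
resources. -/
theorem run_maxLoop {ε : ℝ} (h : Input A ε s) : (maxLoop.run O s).real 10 0 0 = A.pm := by
  set s₁ := s.setReal 10 0 0 0 with hs₁
  have hlim : Limit.resources.expr.eval s₁ = A.k := h.k
  have key := run_loop_induction (O := O) (c := 23) (l := .resources) (s := s₁)
    (P := .ite (.realLe (.entry 1 (.cell 23)) (.entry 10 (.lit 0))) .skip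
      (storeReal 10 (.lit 0) (.entry 1 (.cell 23))))
    (fun n u => 0 ≤ u.real 10 0 0 ∧ (∀ w < n, A.p w ≤ u.real 10 0 0) ∧
      (u.real 10 0 0 = 0 ∨ ∃ w < n, u.real 10 0 0 = A.p w)) (by
      rw [loopInit_real]
      have : s₁.real 10 0 0 = 0 := by simp [hs₁, State.real_setReal]
      rw [this]
      exact ⟨le_rfl, fun w hw => absurd hw (Nat.not_lt_zero w), Or.inl rfl⟩) (by
      rintro n hn u hc hnat hreal ⟨h1, h2, h3⟩
      rw [hlim] at hn
      have hp : u.real 1 0 n = A.p n := by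
        rw [hreal 1 (by decide), hs₁, State.real_setReal_ne _ (by decide), h.p n hn]
      rw [State.real_setNat, run_ite]
      have htest : (Test.realLe (.entry 1 (.cell 23)) (.entry 10 (.lit 0))).Holds u ↔
          A.p n ≤ u.real 10 0 0 := by simp [hc, hp]
      by_cases hle : A.p n ≤ u.real 10 0 0
      · rw [if_pos (htest.2 hle), run_skip]
        refine ⟨h1, fun w hw => ?_, h3.imp_right fun ⟨w, hw, e⟩ => ⟨w, by omega, e⟩⟩
        by_cases hwn : w = n
        · rwa [hwn]
        · exact h2 w (by omega)
      · rw [if_neg (fun h => hle (htest.1 h))]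
        have e1 : ((storeReal 10 (.lit 0) (.entry 1 (.cell 23))).run O u).real 10 0 0 = A.p n := by
          simp [State.real_setReal, hc, hp]
        rw [e1]
        rw [not_le] at hle
        refine ⟨h1.trans hle.le, fun w hw => ?_, Or.inr ⟨n, by omega, rfl⟩⟩
        by_cases hwn : w = n
        · rw [hwn]
        · exact (h2 w (by omega)).trans hle.le)
  rw [hlim] at key
  have hrun : (maxLoop.run O s) = (loop 23 .resources (.ite (.realLe (.entry 1 (.cell 23))
      (.entry 10 (.lit 0))) .skip (storeReal 10 (.lit 0) (.entry 1 (.cell 23))))).run O s₁ := by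
    rw [maxLoop, run_seq]
    simp [hs₁]
  rw [hrun]
  exact h.pm _ key.1 key.2.1 key.2.2

theorem run_setup {ε : ℝ} (h0 : s.real 0 0 0 = A.T) (h1 : s.real 0 0 1 = ε)
    (he : A.e = min ε (1 / 3)) (h10 : s.real 10 0 0 = A.pm) :
    (setup.run O s).real 4 0 0 = A.v ∧ (setup.run O s).real 4 0 1 = A.ve ∧
      (setup.run O s).real 4 0 2 = A.e ^ 2 * A.v ∧ (setup.run O s).real 4 0 3 = A.mu := by
  have e1 : (if ε ≤ 1 / 3 then s.setReal 9 0 0 ε else s.setReal 9 0 0 (1 / 3)) =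
      s.setReal 9 0 0 A.e := by
    split_ifs with h
    · rw [he, min_eq_left h]
    · rw [he, min_eq_right (not_le.1 h).le]
  have e2 : ∀ t : State, (if (1 / 3 - A.e) * A.T - A.pm / 3 ≤ 0 then t.setReal 4 0 0 0 else
      t.setReal 4 0 0 ((1 / 3 - A.e) * A.T - A.pm / 3)) = t.setReal 4 0 0 A.v := by
    intro t
    split_ifs with h
    · rw [Problem.v, max_eq_left h]
    · rw [Problem.v, max_eq_right (not_le.1 h).le]
  have hrun : setup.run O s = ((((((s.setReal 9 0 0 A.e).setReal 9 0 1
      ((1 / 3 - A.e) * A.T - A.pm / 3)).setReal 4 0 0 A.v).setReal 4 0 1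
      ((1 + A.e) * A.v)).setReal 9 0 2 (A.e * A.e)).setReal 4 0 2 (A.e * A.e * A.v)).setReal 4 0 3
      (A.e * A.e * (A.e * A.e) / 256) := by
    have e3 : (Bounded.ite (.realLe (.entry 0 (.lit 1)) (.lit (1 / 3)))
        (storeReal 9 (.lit 0) (.entry 0 (.lit 1))) (storeReal 9 (.lit 0) (.lit (1 / 3)))).run O s =
        s.setReal 9 0 0 A.e := by
      rw [← e1, run_ite]
      simp [h1]
    have e4 : ∀ t : State, t.real 9 0 1 = (1 / 3 - A.e) * A.T - A.pm / 3 →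
        (Bounded.ite (.realLe (.entry 9 (.lit 1)) (.lit 0)) (storeReal 4 (.lit 0) (.lit 0))
          (storeReal 4 (.lit 0) (.entry 9 (.lit 1)))).run O t = t.setReal 4 0 0 A.v := by
      intro t ht
      rw [← e2, run_ite]
      simp [ht]
    rw [setup, run_seq, e3, run_seq, run_seq, e4]
    · simp [State.real_setReal, h0, h10]
    · simp [State.real_setReal, h0, h10]
  rw [hrun]
  refine ⟨?_, ?_, ?_, ?_⟩
  · simp [State.real_setReal]
  · simp [State.real_setReal, Problem.ve]
  · simp [State.real_setReal, pow_two]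
  · simp only [State.real_setReal, Problem.mu]
    norm_num
    ring

theorem run_capLoop (hk : s.nat 0 0 1 = A.k) (hp : ∀ w < A.k, s.real 1 0 w = A.p w)
    (h4 : s.real 4 0 1 = A.ve) : ∀ w < A.k, (capLoop.run O s).real 5 0 w = A.cap w := by
  have hlim : Limit.resources.expr.eval s = A.k := hk
  have key := run_loop_induction (O := O) (c := 23) (l := .resources) (s := s)
    (P := .ite (.realLe (.entry 1 (.cell 23)) (.entry 4 (.lit 1)))
      (storeReal 5 (.cell 23) (.entry 1 (.cell 23))) (storeReal 5 (.cell 23) (.entry 4 (.lit 1))))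
    (fun n u => ∀ w < n, u.real 5 0 w = A.cap w) (fun w hw => absurd hw (Nat.not_lt_zero w)) (by
      intro n hn u hc hnat hreal hI w hw
      rw [hlim] at hn
      have h1 : u.real 1 0 n = A.p n := by rw [hreal 1 (by decide), hp n hn]
      have h2 : u.real 4 0 1 = A.ve := by rw [hreal 4 (by decide), h4]
      have hrun : (Bounded.ite (.realLe (.entry 1 (.cell 23)) (.entry 4 (.lit 1)))
          (storeReal 5 (.cell 23) (.entry 1 (.cell 23)))
          (storeReal 5 (.cell 23) (.entry 4 (.lit 1)))).run O u = u.setReal 5 0 n (A.cap n) := by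
        rw [run_ite]
        simp only [Test.holds_realLe, RealExpr.eval_entry, NatExpr.eval_cell, NatExpr.eval_lit, hc,
          h1, h2, run_storeReal]
        split_ifs with h
        · rw [Problem.cap, min_eq_left h]
        · rw [Problem.cap, min_eq_right (not_le.1 h).le]
      rw [State.real_setNat, hrun, State.real_setReal]
      by_cases hwn : w = n
      · simp [hwn]
      · rw [if_neg (by simp [hwn])]
        exact hI w (by omega))
  rw [hlim] at key
  exact key

theorem inv_of_zero (hA : A.Valid) (h : ∀ a i j, 2 ≤ a → s.nat a i j = 0) : (conf A s).Inv A := by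
  have hC : (conf A s).C = ∅ := by
    rw [eq_empty_iff_forall_notMem]
    intro x hx
    exact (mem_chosen.1 hx).2 (h 2 0 x le_rfl)
  have hown : ∀ w, (conf A s).own w = 0 := fun w => h 3 0 w (by decide)
  have hlay : ∀ w, (conf A s).lay w = 0 := fun w => h 4 0 w (by decide)
  have haL : ∀ w, (conf A s).aL w = 0 := fun w => h 5 0 w (by decide)
  have htop : (conf A s).top = 0 := h 7 0 0 (by decide)
  have hedge : ∀ j x, (conf A s).edge A (j + 1) x = ∅ := fun j x => by
    rw [eq_empty_iff_forall_notMem]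
    intro w hw
    rw [Config.mem_edge, haL] at hw
    omega
  have hve := hA.ve_nonneg
  have hpm := hA.pm_nonneg
  refine ⟨⟨?_, ?_, ?_, ?_⟩, ⟨?_, ?_, ?_, ?_, ?_, ?_, ?_⟩, ?_, ?_, ?_, ?_⟩
  · rw [hC, coe_empty]; exact A.M.empty_indep
  · intro w c hw; rw [hown] at hw; omega
  · rw [hC]; exact fun c hc => absurd hc (notMem_empty c)
  · rw [hC]; exact fun c hc => absurd hc (notMem_empty c)
  · exact fun c hc => absurd (hlay c) hc
  · exact fun w hw => absurd (haL w) hw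
  · exact fun w _ hw => absurd (haL w) hw
  · intro j x hj hx
    rw [Config.mem_nodes] at hx
    obtain ⟨-, w, -, hw, -⟩ := hx
    rw [haL] at hw
    exact absurd hw.symm hj
  · intro j x; rw [hedge, sum_empty]; linarith
  · intro j x; rw [hedge, sum_empty]; linarith
  · exact fun c hc => absurd (hlay c) hc
  all_goals intro j h1 h2; omega

theorem ready_init {ε : ℝ} (hA : A.Valid) (hO : Answers A O) (h : Input A ε s) :
    Ready A (init.run O s) := by
  set s₁ := maxLoop.run O s with hs₁
  obtain ⟨e1, e2, e3, e4⟩ := run_setup (O := O) (s := s₁) (A := A) (ε := ε)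
    (by rw [hs₁, run_real _ (by decide), h.T]) (by rw [hs₁, run_real _ (by decide), h.eps]) h.e
    (run_maxLoop h)
  set s₂ := setup.run O s₁ with hs₂
  have hcap := run_capLoop (O := O) (A := A) (s := s₂)
    (by rw [hs₂, run_nat _ (by decide), hs₁, run_nat _ (by decide), h.k])
    (by rw [hs₂, run_real _ (by decide), hs₁, run_real _ (by decide)]; exact h.p) e2
  set s₃ := capLoop.run O s₂ with hs₃
  have hnat : ∀ a, a ≠ 23 → s₃.nat a = s.nat a := by
    intro a ha
    rw [hs₃, run_nat _ (by simp [capLoop, natWrites, storeReal, ha]), hs₂,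
      run_nat _ (by simp [setup, natWrites, storeReal]), hs₁,
      run_nat _ (by simp [maxLoop, natWrites, storeReal, ha])]
  have h4 : s₃.real 4 = s₂.real 4 := run_real _ (by decide) s₂
  have hM : Memory A s₃ := ⟨by rw [hnat 0 (by decide), h.m], by rw [hnat 0 (by decide), h.k],
    by rw [hnat 1 (by decide)]; exact h.adj, hcap, by rw [h4, e1], by rw [h4, e2], by rw [h4, e3],
    by rw [h4, e4]⟩
  have hconf : conf A s₃ = conf A s := conf_congr fun a h2 h8 => hnat a (by omega)
  have hrun : init.run O s = augment.run O s₃ := rfl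
  refine ⟨?_, ?_, ?_, ?_, ?_⟩
  · rw [hrun]; exact hM.run _ (by decide) (by decide) (by decide) (by decide)
  · rw [hrun, conf_augment, hconf]; exact inv_of_zero hA h.nat
  · rw [hrun, conf_augment]; exact run_augment hO hM
  · rw [run_real _ (by decide)]; exact h.outX
  · rw [run_real _ (by decide)]; exact h.outY

/-- Write the result into the output arrays. -/
def output : Bounded :=
  .seq (.loop 29 .elements (.ite (.isZero (.entry 2 (.cell 29))) .skip
      (storeReal 2 (.cell 29) (.lit 1))))
    (.loop 23 .resources (.ite (.isZero (.entry 3 (.cell 23))) .skip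
      (setReal 3 (.sub (.entry 3 (.cell 23)) (.lit 1)) (.cell 23) (.lit 1))))

theorem run_output (h : Ready A s) :
    (∀ x < A.m, (output.run O s).real 2 0 x = if x ∈ (conf A s).C then 1 else 0) ∧
    ∀ x, ∀ w < A.k, (output.run O s).real 3 x w = if (conf A s).own w = x + 1 then 1 else 0 := by
  have key := run_loop_induction (O := O) (c := 29) (l := .elements) (s := s)
    (P := .ite (.isZero (.entry 2 (.cell 29))) .skip (storeReal 2 (.cell 29) (.lit 1)))
    (fun n u => ∀ x, u.real 2 0 x = if x < n ∧ s.nat 2 0 x ≠ 0 then 1 else 0) (by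
      intro x; rw [loopInit_real, h.outX]; simp) (by
      intro n hn u hc hnat hreal hI x
      rw [State.real_setNat, run_ite]
      have h2 : u.nat 2 = s.nat 2 := hnat 2 (by decide)
      by_cases h0 : s.nat 2 0 n = 0
      · rw [if_pos (by simp [hc, h2, h0]), run_skip, hI]
        refine if_congr ⟨fun h => ⟨by omega, h.2⟩, fun h => ⟨?_, h.2⟩⟩ rfl rfl
        have : x ≠ n := fun h' => h.2 (h' ▸ h0)
        omega
      · rw [if_neg (by simp [hc, h2, h0]), run_storeReal, State.real_setReal]
        by_cases hx : x = n
        · rw [if_pos ⟨rfl, rfl, by simp [hc, hx]⟩, if_pos ⟨by omega, hx ▸ h0⟩]; simp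
        · rw [if_neg (by simp [hc, hx]), hI]
          exact if_congr ⟨fun h => ⟨by omega, h.2⟩, fun h => ⟨by omega, h.2⟩⟩ rfl rfl)
  rw [h.memory.limit] at key
  set P := loop 29 .elements (.ite (.isZero (.entry 2 (.cell 29))) .skip
      (storeReal 2 (.cell 29) (.lit 1))) with hP
  set s₁ := P.run O s with hs₁
  have hM₁ : Memory A s₁ := h.memory.run _ (by decide) (by decide) (by decide) (by decide)
  have h3 : s₁.nat 3 = s.nat 3 := run_nat _ (by decide) s
  have key' := run_loop_induction (O := O) (c := 23) (l := .resources) (s := s₁)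
    (P := .ite (.isZero (.entry 3 (.cell 23))) .skip
      (setReal 3 (.sub (.entry 3 (.cell 23)) (.lit 1)) (.cell 23) (.lit 1)))
    (fun n u => ∀ x w, u.real 3 x w = if w < n ∧ s.nat 3 0 w = x + 1 then 1 else 0) (by
      intro x w
      rw [loopInit_real, hs₁, run_real _ (by decide), h.outY]; simp) (by
      intro n hn u hc hnat hreal hI x w
      rw [State.real_setNat, run_ite]
      have h2 : u.nat 3 = s.nat 3 := by rw [hnat 3 (by decide), h3]
      by_cases h0 : s.nat 3 0 n = 0
      · rw [if_pos (by simp [hc, h2, h0]), run_skip, hI]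
        refine if_congr ⟨fun h => ⟨by omega, h.2⟩, fun h => ⟨?_, h.2⟩⟩ rfl rfl
        have : w ≠ n := by
          rintro rfl
          omega
        omega
      · rw [if_neg (by simp [hc, h2, h0]), run_setReal, State.real_setReal]
        simp only [NatExpr.eval_sub, NatExpr.eval_entry, NatExpr.eval_cell, NatExpr.eval_lit, hc, h2,
          RealExpr.eval_lit, true_and]
        by_cases hx : x = s.nat 3 0 n - 1 ∧ w = n
        · rw [if_pos hx, if_pos ⟨by omega, by rw [hx.2]; omega⟩]; simp
        · rw [if_neg hx, hI]
          refine if_congr ⟨fun h => ⟨by omega, h.2⟩, fun h => ⟨?_, h.2⟩⟩ rfl rfl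
          have : w ≠ n := by
            rintro rfl
            exact hx ⟨by omega, rfl⟩
          omega)
  rw [hM₁.limit] at key'
  refine ⟨fun x hx => ?_, fun x w hw => ?_⟩
  · have : (output.run O s).real 2 = s₁.real 2 := run_real _ (by decide) s₁
    rw [this, key]
    exact if_congr (mem_chosen (a := 2)).symm rfl rfl
  · have : output.run O s = (loop 23 .resources (.ite (.isZero (.entry 3 (.cell 23))) .skip
      (setReal 3 (.sub (.entry 3 (.cell 23)) (.lit 1)) (.cell 23) (.lit 1)))).run O s₁ := rfl
    rw [this, key']
    exact if_congr (and_iff_right hw) rfl rfl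

end LocalSearch

/-! ### The whole program and its running time -/

namespace LocalSearch

open RealRAM RealRAM.Bounded Finset Classical

variable {A : Problem} {O : Set ℕ → Prop} {s u : State}

/-- The local search. -/
def program : Program :=
  .seq init.compile (.seq (.while (.not (.isZero (.cell 27))) body.compile) output.compile)

theorem wellformed_init : init.Wellformed := by
  repeat' trivial

theorem wellformed_body : body.Wellformed := by
  repeat' trivial

theorem wellformed_output : output.Wellformed := by
  repeat' trivial

/-- The measure starts nonnegative, gains at least `gain` in each iteration and never exceeds the
left side of `hn`; hence `n` iterations suffice. All bounded loops have at most `m + k + 2`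
iterations. -/
theorem exec_program (hA : A.Valid) (hO : Answers A O) {x : ℕ → ℝ} {y : ℕ → ℕ → ℝ}
    (hxy : A.Fractional x y) {ε : ℝ} (h : Input A ε s) (q n : ℕ)
    (hn : A.m * (2 / A.sigma + A.gain) + 2 / A.sigma < n * A.gain) :
    ∃ t ≤ init.cost (A.m + A.k + 2) q + (n * (body.cost (A.m + A.k + 2) q +
        (Test.not (.isZero (.cell 27))).cost + 1) + output.cost (A.m + A.k + 2) q),
      ∃ u, Exec O q program s t (output.run O u) ∧ Ready A u ∧ ¬ Augmentable A (conf A u) := by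
  have hB : ∀ u : State, u.nat 0 0 0 = A.m → u.nat 0 0 1 = A.k → ∀ l : Limit,
      l.expr.eval u ≤ A.m + A.k + 2 := by
    intro u hm hk l
    rw [l.eval_expr hm hk]
    cases l <;> simp only [Limit.count] <;> omega
  obtain ⟨t₁, ht₁, hex₁⟩ := exec_compile (O := O) q _ init wellformed_init s (hB s h.m h.k)
    (by decide)
  have hready := ready_init (O := O) hA hO h
  obtain ⟨t₂, ht₂, u, hex₂, hu, hflag⟩ := exec_while (O := O) (q := q)
    (b := .not (.isZero (.cell 27))) (P := body.compile) (Ready A)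
    (fun u => (conf A u).progress A) (η := A.gain) (body.cost (A.m + A.k + 2) q)
    (fun u hu => Config.progress_le hA hu.inv.covering) (by
      intro u hu hflag
      obtain ⟨t, ht, hex⟩ := exec_compile (O := O) q _ body wellformed_body u
        (hB u hu.memory.m hu.memory.k) (by decide)
      obtain ⟨h1, h2⟩ := ready_body hA hO hxy hu (by simpa [Test.Holds] using hflag)
      exact ⟨t, ht, _, hex, h1, h2⟩) n _ hready (by
      have := Config.progress_nonneg (s := conf A (init.run O s)) hA
      linarith)
  obtain ⟨t₃, ht₃, hex₃⟩ := exec_compile (O := O) q _ output wellformed_output u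
    (hB u hu.memory.m hu.memory.k) (by decide)
  refine ⟨_, Nat.add_le_add ht₁ (Nat.add_le_add ht₂ ht₃), u, .seq hex₁ (.seq hex₂ hex₃), hu, ?_⟩
  rw [← hu.flag]
  simpa [Test.Holds] using hflag

/-- The constants `sigma`, `mu`, `rate` and `degree` depend on `e` alone. The upper bound for the
measure is linear in `m`, up to a multiple of `gain`, and `1 / gain` is a polynomial in `m` of
degree `degree + 1`. -/
theorem exists_iterations {e : ℝ} (h0 : 0 < e) :
    ∃ c b : ℕ, ∀ A : Problem, A.Valid → A.e = e → ∃ n ≤ c * (A.m + 1) ^ b,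
      A.m * (2 / A.sigma + A.gain) + 2 / A.sigma < n * A.gain := by
  set σ : ℝ := e ^ 3 / 32 with hσ
  set μ : ℝ := e ^ 4 / 256 with hμ
  set r : ℝ := 1 + 4 / (σ * μ) with hr
  set d : ℕ := sInf {n | r ≤ (1 + σ) ^ n} with hd
  set c : ℕ := ⌈2 / σ * (2 * r ^ 2 * 2 ^ (d + 1)) / μ⌉₊ with hc
  refine ⟨c + 1, d + 2, fun A hA hAe => ?_⟩
  have eσ : A.sigma = σ := by rw [Problem.sigma, hAe]
  have eμ : A.mu = μ := by rw [Problem.mu, hAe]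
  have er : A.rate = r := by rw [Problem.rate, eσ, eμ]
  have ed : A.degree = d := by rw [Problem.degree, er, eσ]
  have σ0 : 0 < σ := by positivity
  have μ0 : 0 < μ := by positivity
  have r0 : 0 < r := by positivity
  -- The summand `m + 1` beats the part `m * gain` of the upper bound strictly; the other one covers
  -- `2 / sigma * (m + 1)`.
  refine ⟨A.m + 1 + c * (A.m + 1) ^ (d + 2), ?_, ?_⟩
  · have : A.m + 1 ≤ (A.m + 1) ^ (d + 2) := Nat.le_self_pow (by omega) _
    rw [add_mul, one_mul]
    omega
  · have hg := Config.gain_pos hA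
    have key : 2 / σ * (A.m + 1) ≤ c * (A.m + 1) ^ (d + 2) * A.gain := by
      have e1 : A.gain = μ / (2 * r ^ 2 * 2 ^ (d + 1) * (A.m + 1) ^ (d + 1)) := by
        rw [Problem.gain, eμ, er, ed, show (2 * A.m + 2 : ℝ) = 2 * (A.m + 1) by ring, mul_pow]
        field_simp
      have e2 : 2 / σ * (2 * r ^ 2 * 2 ^ (d + 1)) / μ ≤ c := Nat.le_ceil _
      have e3 : 2 / σ * (A.m + 1) = 2 / σ * (2 * r ^ 2 * 2 ^ (d + 1)) / μ *
          (A.m + 1) ^ (d + 2) * A.gain := by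
        rw [e1]
        field_simp
        ring
      rw [e3]
      gcongr
    rw [eσ]
    push_cast
    linarith

/-- Everything is a polynomial in `m + k + q`, and `q` is a polynomial in the size of the input; a
single `K`, determined by `e` and `d`, serves as factor and as exponent. -/
theorem exists_time {e : ℝ} (h0 : 0 < e) (d : ℕ) :
    ∃ K : ℕ, ∀ A : Problem, A.Valid → A.e = e → ∀ q ≤ d * (A.m + A.k + 1) ^ d, ∃ n : ℕ,
      A.m * (2 / A.sigma + A.gain) + 2 / A.sigma < n * A.gain ∧
      init.cost (A.m + A.k + 2) q + (n * (body.cost (A.m + A.k + 2) q +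
        (Test.not (.isZero (.cell 27))).cost + 1) + output.cost (A.m + A.k + 2) q) ≤
          K * (A.m + A.k + 1) ^ K := by
  obtain ⟨c, b, hn⟩ := exists_iterations h0
  obtain ⟨a₁, b₁, h₁⟩ := exists_cost_le init
  obtain ⟨a₂, b₂, h₂⟩ := exists_cost_le body
  obtain ⟨a₃, b₃, h₃⟩ := exists_cost_le output
  set r := (Test.not (.isZero (.cell 27))).cost + 1 with hr
  set a := a₁ + (c * (a₂ + r) + a₃) with ha
  set f := b₁ + (b + b₂) + b₃ with hf
  refine ⟨a * (d + 3) ^ f + (d + 1) * f, fun A hA hAe q hq => ?_⟩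
  obtain ⟨n, hn, hlt⟩ := hn A hA hAe
  refine ⟨n, hlt, ?_⟩
  set N := A.m + A.k + 1 with hN
  set X := A.m + A.k + 2 + q + 1 with hX
  have hN1 : 1 ≤ N := by omega
  have hX1 : 1 ≤ X := by omega
  have hXN : X ≤ (d + 3) * N ^ (d + 1) := by
    have e1 : N ≤ N ^ (d + 1) := Nat.le_self_pow (by omega) _
    have e2 : N ^ d ≤ N ^ (d + 1) := Nat.pow_le_pow_right hN1 (by omega)
    have e3 := Nat.mul_le_mul_left d e2
    rw [add_mul]
    omega
  have hpow : ∀ {g}, g ≤ f → X ^ g ≤ X ^ f := fun hg => Nat.pow_le_pow_right hX1 hg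
  have i1 : init.cost (A.m + A.k + 2) q ≤ a₁ * X ^ f :=
    (h₁ _ _).trans (Nat.mul_le_mul_left _ (hpow (by omega)))
  have i3 : output.cost (A.m + A.k + 2) q ≤ a₃ * X ^ f :=
    (h₃ _ _).trans (Nat.mul_le_mul_left _ (hpow (by omega)))
  have i2 : n * (body.cost (A.m + A.k + 2) q + r) ≤ c * (a₂ + r) * X ^ f := by
    have j1 : n ≤ c * X ^ b :=
      hn.trans (Nat.mul_le_mul_left _ (Nat.pow_le_pow_left (by omega) _))
    have j2 : body.cost (A.m + A.k + 2) q + r ≤ (a₂ + r) * X ^ b₂ := by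
      rw [add_mul]
      exact Nat.add_le_add (h₂ _ _) (Nat.le_mul_of_pos_right _ (Nat.pow_pos hX1))
    calc n * (body.cost (A.m + A.k + 2) q + r) ≤ c * X ^ b * ((a₂ + r) * X ^ b₂) :=
          Nat.mul_le_mul j1 j2
      _ = c * (a₂ + r) * X ^ (b + b₂) := by rw [pow_add]; ring
      _ ≤ _ := Nat.mul_le_mul_left _ (hpow (by omega))
  have i4 : X ^ f ≤ (d + 3) ^ f * N ^ ((d + 1) * f) := by
    rw [pow_mul, ← mul_pow]
    exact Nat.pow_le_pow_left hXN _
  rw [add_assoc (body.cost _ _)]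
  calc _ ≤ a₁ * X ^ f + (c * (a₂ + r) * X ^ f + a₃ * X ^ f) :=
        Nat.add_le_add i1 (Nat.add_le_add i2 i3)
    _ = a * X ^ f := by rw [ha]; ring
    _ ≤ a * ((d + 3) ^ f * N ^ ((d + 1) * f)) := Nat.mul_le_mul_left _ i4
    _ = a * (d + 3) ^ f * N ^ ((d + 1) * f) := by ring
    _ ≤ _ := Nat.mul_le_mul (by omega) (Nat.pow_le_pow_right hN1 (by omega))

end LocalSearch

/-! ### The allocation problem on `Fin m` and `Fin k` -/

namespace Problem

open Finset Classical

variable {m k : ℕ} (M : Matroid (Fin m)) (E : Finset (Fin m × Fin k)) (p : Fin k → ℝ) (T ε : ℝ)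

/-- The problem on the natural numbers that belongs to an allocation problem. -/
noncomputable def ofFin : Problem where
  m := m
  k := k
  M := M.mapEmbedding Fin.valEmbedding
  adj x w := ∃ e ∈ E, (e.1 : ℕ) = x ∧ (e.2 : ℕ) = w
  p w := if h : w < k then p ⟨w, h⟩ else 0
  T := T
  e := min ε (1 / 3)
  pm := ⨆ w, p w

variable {M E p T ε}

theorem ofFin_adj {x : Fin m} {w : Fin k} : (ofFin M E p T ε).adj x w ↔ (x, w) ∈ E := by
  constructor
  · rintro ⟨⟨x', w'⟩, he, h1, h2⟩
    obtain rfl : x' = x := Fin.ext h1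
    obtain rfl : w' = w := Fin.ext h2
    exact he
  · exact fun h => ⟨_, h, rfl, rfl⟩

theorem ofFin_p (w : Fin k) : (ofFin M E p T ε).p w = p w := by
  change (if h : (w : ℕ) < k then p ⟨w, h⟩ else 0) = p w
  rw [dif_pos w.2]

theorem le_ofFin_pm (w : Fin k) : p w ≤ (ofFin M E p T ε).pm :=
  le_ciSup (Set.finite_range p).bddAbove w

theorem valid_ofFin (hM : M.E = Set.univ) (hp : ∀ w, 0 ≤ p w) (hT : 0 ≤ T) (hε : 0 < ε) :
    (ofFin M E p T ε).Valid where
  ground := by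
    ext i
    simp only [ofFin, Matroid.mapEmbedding_ground_eq, hM, Set.image_univ, Set.mem_range,
      Fin.valEmbedding_apply, Set.mem_ofPred_eq]
    exact ⟨fun ⟨j, hj⟩ => hj ▸ j.2, fun h => ⟨⟨i, h⟩, rfl⟩⟩
  p_nonneg w := by
    change 0 ≤ (if h : w < k then p ⟨w, h⟩ else 0)
    split_ifs
    · exact hp _
    · exact le_rfl
  p_le w hw := by
    lift w to Fin k using hw
    rw [ofFin_p]
    exact le_ofFin_pm w
  pm_nonneg := Real.iSup_nonneg hp
  e_pos := lt_min hε (by norm_num)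
  e_le := min_le_right _ _
  T_nonneg := hT

theorem ofFin_indep {I : Finset ℕ} :
    (ofFin M E p T ε).M.Indep ↑I ↔ M.Indep {i : Fin m | (i : ℕ) ∈ I} ∧ ∀ i ∈ I, i < m := by
  simp only [ofFin, Matroid.mapEmbedding_indep_iff]
  refine and_congr Iff.rfl ⟨fun h i hi => ?_, fun h i hi => ⟨⟨i, h i hi⟩, rfl⟩⟩
  obtain ⟨j, rfl⟩ := h hi
  exact j.2

/-- The inequality is linear in `x`, so it suffices to verify it at the characteristic vectors of
bases. A basis has at least as many elements as `I`, and at most `|Z|` of them lie in the closure of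
`Z`. -/
theorem rank_ofFin {x : Fin m → ℝ} (hx : x ∈ basePolytope M)
    {Z I : Finset ℕ} (hI : (ofFin M E p T ε).M.Indep ↑I) :
    (I.card : ℝ) ≤ Z.card + ∑ i with (Fin.val i) ∉ (ofFin M E p T ε).M.closure ↑Z, x i := by
  set A := ofFin M E p T ε with hA
  have hlin : IsLinearMap ℝ fun x : Fin m → ℝ =>
      ∑ i with (Fin.val i) ∉ A.M.closure ↑Z, x i :=
    ⟨fun x y => by simp [sum_add_distrib], fun c x => by simp [mul_sum]⟩
  have key : basePolytope M ⊆
      {x | (I.card : ℝ) - Z.card ≤ ∑ i with (Fin.val i) ∉ A.M.closure ↑Z, x i} := by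
    refine convexHull_min ?_ (convex_halfSpace_ge hlin _)
    rintro _ ⟨S, hS, rfl⟩
    set J : Finset ℕ := ({i | i ∈ S} : Finset (Fin m)).map Fin.valEmbedding with hJ
    have hJS : A.M.IsBase ↑J := by
      have := hS.mapEmbedding Fin.valEmbedding
      rw [hJ, coe_map, coe_filter]
      simpa [hA, ofFin] using this
    have h1 : I.card ≤ J.card := hI.card_le_of_subset_closure (by
      rw [hJS.closure_eq]; exact hI.subset_ground)
    have h2 : ({i ∈ J | i ∈ A.M.closure ↑Z} : Finset ℕ).card ≤ Z.card := by
      refine Matroid.Indep.card_le_of_subset_closure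
        (hJS.indep.subset (by exact_mod_cast filter_subset _ _)) fun i hi => ?_
      exact (mem_filter.1 (mem_coe.1 hi)).2
    have h3 := card_filter_add_card_filter_not (s := J) fun i => i ∈ A.M.closure ↑Z
    have h4 : ∑ i with (Fin.val i) ∉ A.M.closure ↑Z, S.indicator (fun _ => (1 : ℝ)) i =
        ({i ∈ J | i ∉ A.M.closure ↑Z} : Finset ℕ).card := by
      rw [hJ, filter_map, card_map, filter_filter, card_eq_sum_ones, Nat.cast_sum, sum_filter,
        sum_filter]
      refine sum_congr rfl fun i _ => ?_
      by_cases h5 : i ∈ S <;> by_cases h6 : (i : ℕ) ∈ A.M.closure ↑Z <;> simp [h5, h6]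
    rw [Set.mem_ofPred_eq, h4, ← sub_nonneg]
    have h5 : (I.card : ℝ) ≤ Z.card + ({i ∈ J | i ∉ A.M.closure ↑Z} : Finset ℕ).card := by
      exact_mod_cast (by omega)
    linarith
  have := key hx
  rw [Set.mem_ofPred_eq] at this
  linarith

theorem exists_fractional_ofFin (h : (lpRelaxation M E p T).Nonempty) :
    ∃ x y, (ofFin M E p T ε).Fractional x y := by
  obtain ⟨⟨x, y⟩, hx, hy, hyE, hbase, hval, hload, hyx⟩ := h
  simp only at hx hy hyE hbase hval hload hyx
  set A := ofFin M E p T ε with hA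
  set X : ℕ → ℝ := fun i => if h : i < m then x ⟨i, h⟩ else 0 with hX
  set Y : ℕ → ℕ → ℝ := fun i w => if h : i < m ∧ w < k then y ⟨i, h.1⟩ ⟨w, h.2⟩ else 0 with hY
  have eX : ∀ i : Fin m, X i = x i := fun i => dif_pos i.2
  have eY : ∀ (i : Fin m) (w : Fin k), Y i w = y i w := fun i w => dif_pos ⟨i.2, w.2⟩
  refine ⟨X, Y, ?_, ?_, ?_, ?_, ?_, ?_, ?_⟩
  · intro i
    simp only [hX]
    split_ifs
    · exact hx _
    · exact le_rfl
  · intro i w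
    simp only [hY]
    split_ifs
    · exact hy _ _
    · exact le_rfl
  · intro i w
    by_cases h : i < m ∧ w < k
    · simp only [hX, hY]
      rw [dif_pos h, dif_pos h.1]
      by_cases hE : (⟨i, h.1⟩, ⟨w, h.2⟩) ∈ E
      · exact hyx _ _ hE
      · rw [hyE _ _ hE]; exact hx _
    · simp only [hX, hY]
      rw [dif_neg h]
      split_ifs
      · exact hx _
      · exact le_rfl
  · intro i w hadj
    simp only [hY]
    split_ifs with h
    · exact hyE _ _ fun hE => hadj ⟨_, hE, rfl, rfl⟩
    · rfl
  · intro i hi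
    lift i to Fin m using hi
    rw [eX, sum_range]
    refine (hval i).trans (le_of_eq ?_)
    rw [sum_filter_of_ne fun w _ hne => by
      by_contra hE
      exact hne (by rw [hyE _ _ hE, mul_zero])]
    exact sum_congr rfl fun w _ => by rw [eY, ofFin_p]
  · intro w hw
    lift w to Fin k using hw
    rw [sum_range]
    refine le_trans (le_of_eq ?_) (hload w)
    rw [sum_filter_of_ne fun i _ hne => by
      by_contra hE
      exact hne (hyE _ _ hE)]
    exact sum_congr rfl fun i _ => eY i w
  · intro Z I _ hI
    refine (rank_ofFin (E := E) (p := p) (T := T) (ε := ε) (Z := Z) hbase hI).trans (le_of_eq ?_)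
    congr 1
    rw [sum_filter, sum_filter, sum_range]
    exact sum_congr rfl fun i _ => by rw [eX]

end Problem

namespace LocalSearch

open RealRAM Finset Classical

variable {m k : ℕ} {M : Matroid (Fin m)} {E : Finset (Fin m × Fin k)} {p : Fin k → ℝ} {T ε : ℝ}

/-- The oracle ignores cells beyond the ground set, so it only matters that the two sets agree below
`m`. -/
theorem answers_indepOracle : Answers (.ofFin M E p T ε) (indepOracle M) := by
  intro S I h
  have hI : ∀ i ∈ I, i < m := fun i hi => ((h i).1 hi).1
  rw [Problem.ofFin_indep, indepOracle, and_iff_left hI]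
  have : {i : Fin m | (i : ℕ) ∈ S} = {i : Fin m | (i : ℕ) ∈ I} := by
    ext i
    exact ⟨fun hi => (h i).2 ⟨i.2, hi⟩, fun hi => ((h i).1 hi).2⟩
  rw [this]

theorem input_inputState (hp : ∀ w, 0 ≤ p w) :
    Input (.ofFin M E p T ε) ε (inputState E p T ε) where
  m := rfl
  k := rfl
  adj x _ w _ := by
    change (if ∃ e ∈ E, (e.1 : ℕ) = x ∧ (e.2 : ℕ) = w then 1 else 0) ≠ 0 ↔
      ∃ e ∈ E, (e.1 : ℕ) = x ∧ (e.2 : ℕ) = w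
    split_ifs with h <;> simp [h]
  T := rfl
  eps := rfl
  e := rfl
  p _ _ := rfl
  pm r h0 h1 h2 := by
    change r = ⨆ w, p w
    refine le_antisymm ?_ (Real.iSup_le (fun w => ?_) h0)
    · rcases h2 with rfl | ⟨w, hw, rfl⟩
      · exact Real.iSup_nonneg hp
      · lift w to Fin k using hw
        rw [Problem.ofFin_p]
        exact Problem.le_ofFin_pm (M := M) (E := E) (T := T) (ε := ε) w
    · have := h1 w w.2
      rwa [Problem.ofFin_p] at this
  nat a i j ha := by
    obtain ⟨a, rfl⟩ := Nat.exists_eq_add_of_le' ha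
    rfl
  outX _ _ := rfl
  outY _ _ := rfl

/-- The value suffices because `e ≤ ε` makes `v` at least the required bound, and capped values are
at most the sizes. -/
theorem isAllocation_of_ready {u : State} (hp : ∀ w, 0 ≤ p w)
    (hT : 0 ≤ T) (h : Ready (.ofFin M E p T ε) u)
    (hmax : ¬ Augmentable (.ofFin M E p T ε) (conf (.ofFin M E p T ε) u)) :
    IsAllocation M E p ((1 / 3 - ε) * T - 1 / 3 * ⨆ w, p w)
      {i : Fin m | (i : ℕ) ∈ (conf (.ofFin M E p T ε) u).C}
      (fun w => if h : ∃ i : Fin m, (conf (.ofFin M E p T ε) u).own w = i + 1 then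
        some h.choose else none) := by
  set A : Problem := .ofFin M E p T ε with hA
  set c := conf A u with hc
  have hσ : ∀ (w : Fin k) (i : Fin m), (if h : ∃ i : Fin m, c.own w = i + 1 then
      some h.choose else none) = some i ↔ c.own w = i + 1 := by
    intro w i
    constructor
    · intro h
      split_ifs at h with h'
      · rw [← Option.some_inj.1 h]; exact h'.choose_spec
    · intro h
      have h' : ∃ i : Fin m, c.own w = i + 1 := ⟨i, h⟩
      rw [dif_pos h', Option.some_inj]
      have := h'.choose_spec
      exact Fin.ext (by omega)
  have hcov := h.inv.covering
  have hind := Problem.ofFin_indep.1 hcov.indep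
  refine ⟨?_, ?_, ?_⟩
  -- Any further element of a larger independent set would augment the chosen ones.
  · refine hind.1.isBase_of_maximal fun J hJ hle => hle.antisymm fun i hi => ?_
    by_contra hic
    refine hmax ⟨i, i.2, hic, Problem.ofFin_indep.2 ⟨hJ.subset fun j hj => ?_, fun j hj => ?_⟩⟩
    · rcases mem_insert.1 (show (j : ℕ) ∈ insert (i : ℕ) c.C from hj) with hj | hj
      · rwa [Fin.ext hj]
      · exact hle hj
    · rcases mem_insert.1 hj with rfl | hj
      · exact i.2
      · exact hind.2 j hj
  · intro w i hi
    rw [hσ] at hi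
    obtain ⟨-, h2, h3⟩ := hcov.own w i hi
    exact ⟨h2, Problem.ofFin_adj.1 h3⟩
  · intro i hi
    have hpm : 0 ≤ ⨆ w, p w := Real.iSup_nonneg hp
    have h1 : (1 / 3 - ε) * T - 1 / 3 * ⨆ w, p w ≤ A.v := by
      refine le_trans ?_ (le_max_right _ _)
      have : A.e ≤ ε := min_le_left _ _
      change _ ≤ (1 / 3 - A.e) * T - (⨆ w, p w) / 3
      nlinarith
    refine h1.trans ((hcov.ge i hi).trans ((sum_le_sum fun w _ => Problem.cap_le w).trans
      (le_of_eq ?_)))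
    rw [Config.held, sum_filter, sum_filter]
    change ∑ w ∈ range k, _ = _
    rw [sum_range]
    refine sum_congr rfl fun w _ => ?_
    rw [Problem.ofFin_p]
    exact if_congr (hσ w i).symm rfl rfl

end LocalSearch

open Classical in
theorem IsAllocation.mem_lpRelaxation {X W : Type*} [Fintype X] [Fintype W]
    [DecidableEq X] [DecidableEq W] {M : Matroid X} {E : Finset (X × W)} {p : W → ℝ} {v : ℝ}
    {S : Set X} {σ : W → Option X} (h : IsAllocation M E p v S σ) :
    (S.indicator (fun _ => (1 : ℝ)), fun i w => if σ w = some i then (1 : ℝ) else 0) ∈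
      lpRelaxation M E p v := by
  obtain ⟨hS, hσ, hv⟩ := h
  refine ⟨fun i => Set.indicator_nonneg (fun _ _ => zero_le_one) i, fun i w => ?_,
    fun i w hE => if_neg fun h => hE (hσ w i h).2, subset_convexHull ℝ _ ⟨S, hS, rfl⟩,
    fun i => ?_, fun w => ?_, fun i w _ => ?_⟩
  · change (0 : ℝ) ≤ if σ w = some i then 1 else 0
    split_ifs <;> norm_num
  · change v * S.indicator (fun _ => (1 : ℝ)) i ≤
      ∑ w with (i, w) ∈ E, p w * if σ w = some i then 1 else 0
    have h1 : ∑ w with (i, w) ∈ E, (p w * if σ w = some i then 1 else 0) =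
        ∑ w with σ w = some i, p w := by
      rw [Finset.sum_filter, Finset.sum_filter]
      refine Finset.sum_congr rfl fun w _ => ?_
      by_cases h : σ w = some i
      · simp [h, (hσ w i h).2]
      · simp [h]
    rw [h1]
    by_cases hi : i ∈ S
    · rw [Set.indicator_of_mem hi, mul_one]; exact hv i hi
    · rw [Set.indicator_of_notMem hi, mul_zero]
      refine le_of_eq (Finset.sum_eq_zero fun w hw => ?_).symm
      exact absurd (hσ w i (Finset.mem_filter.1 hw).2).1 hi
  · change ∑ i with (i, w) ∈ E, (if σ w = some i then (1 : ℝ) else 0) ≤ 1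
    refine (Finset.sum_le_sum_of_subset_of_nonneg (Finset.filter_subset _ _)
      fun i _ _ => by split_ifs <;> norm_num).trans ?_
    rcases h : σ w with - | i
    · simp
    · simp
  · change (if σ w = some i then (1 : ℝ) else 0) ≤ S.indicator (fun _ => (1 : ℝ)) i
    split_ifs with h
    · rw [Set.indicator_of_mem (hσ w i h).1]
    · exact Set.indicator_nonneg (fun _ _ => zero_le_one) i

theorem theorem1 :
    ∃ P : RealRAM.Program, ∀ ε : ℝ, 0 < ε → ∀ d : ℕ, ∃ K : ℕ,
      ∀ (m k : ℕ) (M : Matroid (Fin m)) (E : Finset (Fin m × Fin k)) (p : Fin k → ℝ) (T : ℝ)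
        (q : ℕ), M.E = Set.univ → (∀ w, 0 ≤ p w) → 0 ≤ T → (lpRelaxation M E p T).Nonempty →
        q ≤ d * (m + k + 1) ^ d →
        ∃ (t : ℕ) (s : RealRAM.State),
          RealRAM.Exec (indepOracle M) q P (inputState E p T ε) t s ∧
          t ≤ K * (m + k + 1) ^ K ∧
          (outputX m s, outputY m k s) ∈
            lpRelaxation M E p ((1 / 3 - ε) * T - 1 / 3 * ⨆ w, p w) ∧
          (∀ i, ∃ z : ℤ, outputX m s i = z) ∧
          (∀ i w, ∃ z : ℤ, outputY m k s i w = z) ∧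
          ∃ (S : Set (Fin m)) (σ : Fin k → Option (Fin m)),
            IsAllocation M E p ((1 / 3 - ε) * T - 1 / 3 * ⨆ w, p w) S σ ∧
            outputX m s = S.indicator (fun _ => (1 : ℝ)) ∧
            outputY m k s = fun i w => if σ w = some i then 1 else 0 := by
  -- One program serves for all `ε`: the number is read from the memory and replaced by `min ε
  -- (1/3)`. Only the time bound depends on it.
  refine ⟨LocalSearch.program, fun ε hε d => ?_⟩
  obtain ⟨K, hK⟩ := LocalSearch.exists_time (lt_min hε (by norm_num : (0 : ℝ) < 1 / 3)) d
  refine ⟨K, fun m k M E p T q hM hp hT hne hq => ?_⟩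
  have hA := Problem.valid_ofFin (E := E) hM hp hT hε
  obtain ⟨x, y, hxy⟩ := Problem.exists_fractional_ofFin (ε := ε) hne
  obtain ⟨n, hn, hcost⟩ := hK (.ofFin M E p T ε) hA rfl q hq
  obtain ⟨t, ht, u, hex, hu, hmax⟩ := LocalSearch.exec_program hA LocalSearch.answers_indepOracle
    hxy (LocalSearch.input_inputState hp) q n hn
  obtain ⟨hX, hY⟩ := LocalSearch.run_output (O := indepOracle M) hu
  have hall := LocalSearch.isAllocation_of_ready hp hT hu hmax
  set S := {i : Fin m | (i : ℕ) ∈ (LocalSearch.conf (.ofFin M E p T ε) u).C} with hS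
  set σ : Fin k → Option (Fin m) := fun w =>
    if h : ∃ i : Fin m, (LocalSearch.conf (.ofFin M E p T ε) u).own w = i + 1 then
      some h.choose else none with hσ
  have eX : outputX m (LocalSearch.output.run (indepOracle M) u) =
      S.indicator (fun _ => (1 : ℝ)) := by
    funext i
    rw [outputX, hX i i.2, Set.indicator_apply]
    exact if_congr Iff.rfl rfl rfl
  have eY : outputY m k (LocalSearch.output.run (indepOracle M) u) =
      fun i w => if σ w = some i then 1 else 0 := by
    funext i w
    rw [outputY, hY i w w.2]
    refine if_congr ⟨fun h => ?_, fun h => ?_⟩ rfl rfl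
    · have h' : ∃ i : Fin m, (LocalSearch.conf (.ofFin M E p T ε) u).own w = i + 1 := ⟨i, h⟩
      simp only [hσ]
      rw [dif_pos h', Option.some_inj]
      have := h'.choose_spec
      exact Fin.ext (by omega)
    · simp only [hσ] at h
      split_ifs at h with h'
      rw [← Option.some_inj.1 h]; exact h'.choose_spec
  refine ⟨t, _, hex, ht.trans hcost, ?_, fun i => ?_, fun i w => ?_, S, σ, hall, eX, eY⟩
  · rw [eX, eY]
    convert hall.mem_lpRelaxation
  · rw [eX, Set.indicator_apply]
    split_ifs
    · exact ⟨1, by simp⟩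
    · exact ⟨0, by simp⟩
  · rw [eY]
    dsimp only
    split_ifs
    · exact ⟨1, by simp⟩
    · exact ⟨0, by simp⟩
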